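/- **Conventions.** Let $d\ge 1$. Fix a smooth radial function $\chi:\mathbb R^d\to[0,1]$ with $\chi=1$ on $\{|\xi|\le 3/4\}$ and support in $\{|\xi|<4/3\}$, and put $\varphi(\xi)=\chi(\xi/2)-\chi(\xi)$, $\dot S_j=\chi(2^{-j}D)$, $\dot\Delta_j=\varphi(2^{-j}D)$ for $j\in\mathbb Z$. Let $\mathcal S'_0$ be the set of (complex-valued) tempered distributions $u$ on $\mathbb R^d$ with $\lim_{j\to-\infty}\|\dot S_ju\|_{L^\infty}=0$. For $s\in\mathbb R$ and $p,r\in[1,\infty]$ let $\|u\|_{\dot B^s_{p,r}}$ be the $\ell^r(\mathbb Z)$ norm of $j\mapsto 2^{js}\|\dot\Delta_ju\|_{L^p}$, and let $\dot B^s_{p,r}$ be the set of $u\in\mathcal S'_0$ for which it is finite. Let $\Lambda_1$ be the Fourier multiplier with symbol $|\xi|_1=\sum_{i=1}^d|\xi_i|$. For $\alpha\ge0$ and $u,U\in\mathcal S'_0$ such that every $\dot\Delta_ju$ is bounded, $U=e^{\alpha\Lambda_1}u$ means that $\dot\Delta_jU=\varphi(2^{-j}D)e^{\alpha\Lambda_1}(\dot\Delta_{j-1}+\dot\Delta_j+\dot\Delta_{j+1})u$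 for all $j\in\mathbb Z$, where $\varphi(2^{-j}D)e^{\alpha\Lambda_1}$ acts on bounded functions by convolution with its integrable kernel. The product $ab$ of two tempered distributions is the limit in $\mathcal S'$ of $\dot S_na\,\dot S_nb$ as $n\to+\infty$, when this limit exists. **Lemma 2.6.** Let $1<q,p<\infty$ with $p\le 2q$, and let $s,s_1,s_2\in\mathbb R$. (i) Suppose that $$s_1+s_2\ge d\max\Big(0,\frac2p-1\Big),\quad s_1\le d\min\Big(\frac1p,\frac2p-\frac1q\Big),\quad s_2<d\min\Big(\frac1p,\frac2p-\frac1q\Big),\quad s+\frac{2d}p-\frac dq=s_1+s_2 .$$ Then there is a constant $C$, depending only on $d,p,q,s_1,s_2$ and $\chi$, such that for all $c_0>0$ and $t\ge0$ and all $a,b\in\mathcal S'_0$ for which $A=e^{\sqrt{c_0t}\Lambda_1}a\in\dot B^{s_1}_{p,1}$ and $B=e^{\sqrt{c_0t}\Lambda_1}b\in\dot B^{s_2}_{p,\infty}$ are defined, the product $ab$ and $e^{\sqrt{c_0t}\Lambda_1}(ab)\in\mathcal S'_0$ exist and $$\|e^{\sqrt{c_0t}\Lambda_1}(ab)\|_{\dot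 B^s_{q,\infty}}\le C\,\|A\|_{\dot B^{s_1}_{p,1}}\|B\|_{\dot B^{s_2}_{p,\infty}} .$$ (ii) Suppose instead that $$s_1+s_2\ge d\max\Big(0,\frac1p+\frac1q-1\Big),\quad s_1\le\frac dp,\quad s_2<d\min\Big(\frac1p,\frac1q\Big),\quad s+\frac dp=s_1+s_2 .$$ Then there is a constant $C$, depending only on $d,p,q,s_1,s_2$ and $\chi$, such that for all $c_0>0$ and $t\ge0$ and all $a,b\in\mathcal S'_0$ for which $A=e^{\sqrt{c_0t}\Lambda_1}a\in\dot B^{s_1}_{p,1}$ and $B=e^{\sqrt{c_0t}\Lambda_1}b\in\dot B^{s_2}_{q,\infty}$ are defined, the product $ab$ and $e^{\sqrt{c_0t}\Lambda_1}(ab)\in\mathcal S'_0$ exist and $$\|e^{\sqrt{c_0t}\Lambda_1}(ab)\|_{\dot B^s_{q,\infty}}\le C\,\|A\|_{\dot B^{s_1}_{p,1}}\|B\|_{\dot B^{s_2}_{q,\infty}} .$$ -/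

import Mathlib

open MeasureTheory Filter Topology FourierTransform
open scoped SchwartzMap ENNReal NNReal

noncomputable section

/-- The space `ℝ^d` with its Euclidean norm. -/
abbrev RSpace (d : ℕ) : Type := EuclideanSpace ℝ (Fin d)

/-- A low-frequency cut-off generating a homogeneous Littlewood-Paley decomposition: a smooth radial
function `χ : ℝ^d → [0,1]`, equal to `1` on the ball of radius `3/4` and supported in the ball of
radius `4/3`. The associated annulus function is `φ(ξ) = χ(ξ/2) - χ(ξ)`, so that
`∑_{j ∈ ℤ} φ(2^{-j} ξ) = 1` for `ξ ≠ 0` and `supp φ ⊆ {3/4 ≤ |ξ| ≤ 8/3}`. -/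
structure LittlewoodPaley (d : ℕ) where
  /-- the cut-off function -/
  χ : RSpace d → ℝ
  smooth : ContDiff ℝ (⊤ : ℕ∞) χ
  radial : ∀ ξ η : RSpace d, ‖ξ‖ = ‖η‖ → χ ξ = χ η
  mem_Icc : ∀ ξ, χ ξ ∈ Set.Icc (0 : ℝ) 1
  eq_one : ∀ ξ, ‖ξ‖ ≤ 3 / 4 → χ ξ = 1
  tsupport_subset : tsupport χ ⊆ Metric.ball 0 (4 / 3)

/-- Littlewood-Paley cut-offs exist. -/
instance (d : ℕ) : Nonempty (LittlewoodPaley d) := by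
  refine ⟨⟨fun ξ => Real.smoothTransition (3 - 2 * ‖ξ‖ ^ 2), ?_, ?_, ?_, ?_, ?_⟩⟩
  · exact Real.smoothTransition.contDiff.comp
      (contDiff_const.sub (contDiff_const.mul (contDiff_norm_sq ℝ)))
  · intro ξ η h
    simp only [h]
  · exact fun ξ => ⟨Real.smoothTransition.nonneg _, Real.smoothTransition.le_one _⟩
  · intro ξ h
    apply Real.smoothTransition.one_of_one_le
    nlinarith [norm_nonneg ξ]
  · have hsub : tsupport (fun ξ : RSpace d => Real.smoothTransition (3 - 2 * ‖ξ‖ ^ 2)) ⊆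
        Metric.closedBall 0 (5 / 4) := by
      apply closure_minimal _ Metric.isClosed_closedBall
      intro ξ hξ
      rw [mem_closedBall_zero_iff]
      by_contra hlt
      push Not at hlt
      apply hξ
      apply Real.smoothTransition.zero_of_nonpos
      nlinarith
    exact hsub.trans (Metric.closedBall_subset_ball (by norm_num))

namespace LittlewoodPaley

variable {d : ℕ} (L : LittlewoodPaley d)

/-- The function `ν ↦ χ(2^{-j} · 2πν)`. Mathlib's Fourier transform is `∫ e^{-2πi⟨x,ν⟩} f(x) dx`, so
the classical frequency is `ξ = 2πν`. -/
def lowFun (j : ℤ) (ν : RSpace d) : ℂ :=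
  ((L.χ (((2 : ℝ) ^ (-j)) • ((2 * Real.pi) • ν)) : ℝ) : ℂ)

lemma lowFun_contDiff (j : ℤ) : ContDiff ℝ (⊤ : ℕ∞) (L.lowFun j) := by
  have h : ContDiff ℝ (⊤ : ℕ∞) (fun ν : RSpace d => L.χ (((2 : ℝ) ^ (-j)) • ((2 * Real.pi) • ν))) :=
    L.smooth.comp (contDiff_const_smul _ |>.comp (contDiff_const_smul _))
  exact Complex.ofRealCLM.contDiff.comp h

lemma lowFun_hasCompactSupport (j : ℤ) : HasCompactSupport (L.lowFun j) := by
  have hχ : HasCompactSupport L.χ :=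
    HasCompactSupport.of_support_subset_isCompact (isCompact_closedBall (0 : RSpace d) (4 / 3))
      ((subset_tsupport _).trans (L.tsupport_subset.trans Metric.ball_subset_closedBall))
  have h1 := (hχ.comp_smul (c := (2 : ℝ) ^ (-j)) (by positivity)).comp_smul
    (c := 2 * Real.pi) (by positivity)
  exact h1.comp_left (g := fun r : ℝ => (r : ℂ)) Complex.ofReal_zero

/-- The symbol `χ(2^{-j} ξ)`, `ξ = 2πν`, as a Schwartz function of `ν`. -/
def lowSymbol (j : ℤ) : 𝓢(RSpace d, ℂ) :=
  (L.lowFun_hasCompactSupport j).toSchwartzMap (L.lowFun_contDiff j)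

/-- The symbol `φ(2^{-j} ξ) = χ(2^{-j-1} ξ) - χ(2^{-j} ξ)`, `ξ = 2πν`. -/
def blockSymbol (j : ℤ) : 𝓢(RSpace d, ℂ) := L.lowSymbol (j + 1) - L.lowSymbol j

/-- For a Schwartz symbol `m` and a tempered distribution `u`, the smooth function `m(D)u = 𝓕⁻¹(m 𝓕u)`.
It is the convolution of `u` with the Schwartz kernel `𝓕⁻¹ m`: its value at `x` is `u` applied to
`y ↦ (𝓕⁻¹ m)(x - y) = (𝓕 m)(y - x)`. -/
def schwartzMultiplier (m : 𝓢(RSpace d, ℂ)) (u : 𝓢'(RSpace d, ℂ)) (x : RSpace d) : ℂ :=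
  u (SchwartzMap.compSubConstCLM ℂ x (𝓕 m))

/-- The low-frequency cut-off `Ṡ_j u = χ(2^{-j}D)u`, a smooth function. -/
def lowCut (j : ℤ) (u : 𝓢'(RSpace d, ℂ)) : RSpace d → ℂ := schwartzMultiplier (L.lowSymbol j) u

/-- The dyadic block `Δ̇_j u = φ(2^{-j}D)u`, a smooth function. -/
def dyadicBlock (j : ℤ) (u : 𝓢'(RSpace d, ℂ)) : RSpace d → ℂ := schwartzMultiplier (L.blockSymbol j) u

/-- The space `𝓢'₀` of tempered distributions with `‖Ṡ_j u‖_{L^∞} → 0` as `j → -∞`. -/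
def MemS0 (u : 𝓢'(RSpace d, ℂ)) : Prop :=
  Tendsto (fun j : ℤ => eLpNorm (L.lowCut j u) ∞ volume) atBot (𝓝 0)

/-- The homogeneous Besov norm `‖u‖_{Ḃ^s_{p,r}}`, the `ℓ^r(ℤ)` norm of
`j ↦ 2^{js} ‖Δ̇_j u‖_{L^p}`. -/
def besovNorm (s : ℝ) (p r : ℝ≥0∞) (u : 𝓢'(RSpace d, ℂ)) : ℝ≥0∞ :=
  eLpNorm (fun j : ℤ => ENNReal.ofReal ((2 : ℝ) ^ ((j : ℝ) * s)) * eLpNorm (L.dyadicBlock j u) p volume)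
    r Measure.count

/-- The homogeneous Besov space `Ḃ^s_{p,r}`. -/
def MemBesov (s : ℝ) (p r : ℝ≥0∞) (u : 𝓢'(RSpace d, ℂ)) : Prop :=
  L.MemS0 u ∧ L.besovNorm s p r u < ∞

/-- The integrable kernel of the multiplier with symbol `φ(2^{-j} ξ) e^{α |ξ|₁}`, where
`|ξ|₁ = ∑ᵢ |ξᵢ|` and `ξ = 2πν`. -/
def gevreyKernel (α : ℝ) (j : ℤ) : RSpace d → ℂ :=
  𝓕⁻ (fun ν : RSpace d =>
    L.blockSymbol j ν * ((Real.exp (α * ∑ i, |2 * Real.pi * ν i|) : ℝ) : ℂ))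

/-- The frequency-localized operator `Δ̇_j e^{αΛ₁} u`: the convolution of the kernel of
`φ(2^{-j} D) e^{αΛ₁}` with `(Δ̇_{j-1} + Δ̇_j + Δ̇_{j+1})u`. The three blocks together have symbol
`1` on the support of `φ(2^{-j} ·)`. -/
def gevreyBlock (α : ℝ) (j : ℤ) (u : 𝓢'(RSpace d, ℂ)) (x : RSpace d) : ℂ :=
  ∫ y, L.gevreyKernel α j y *
    (L.dyadicBlock (j - 1) u (x - y) + L.dyadicBlock j u (x - y) + L.dyadicBlock (j + 1) u (x - y))

/-- `U = e^{αΛ₁} u`, where `Λ₁` is the Fourier multiplier with symbol `|ξ|₁`. The symbol `e^{α|ξ|₁}`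
is not smooth, so it acts on those `u ∈ 𝓢'₀` whose dyadic blocks are bounded functions, block by
block; and `U ∈ 𝓢'₀` is determined by its dyadic blocks. -/
def IsGevrey (α : ℝ) (u U : 𝓢'(RSpace d, ℂ)) : Prop :=
  L.MemS0 u ∧ L.MemS0 U ∧ (∀ j : ℤ, eLpNorm (L.dyadicBlock j u) ∞ volume < ∞) ∧
    ∀ j : ℤ, L.dyadicBlock j U = L.gevreyBlock α j u

/-- `w = ab` is the product of the tempered distributions `a` and `b`: the limit in `𝓢'` of the
products of smooth functions `Ṡ_n a · Ṡ_n b` as `n → +∞`. -/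
def IsProduct (a b w : 𝓢'(RSpace d, ℂ)) : Prop :=
  ∀ ψ : 𝓢(RSpace d, ℂ),
    Tendsto (fun n : ℤ => ∫ x, L.lowCut n a x * L.lowCut n b x * ψ x) atTop (𝓝 (w ψ))

end LittlewoodPaley

end

/-!
Both estimates are instances of one product law, `exists_gevrey_product`, with reciprocal Lebesgue
exponents `x₁`, `x₂` for the factors and `y` for the product.

The symbol `e^{α|ξ|₁}` is reduced to exponentials of linear forms. From the identity
`e^{|x|} = e^x + e^{-x} - e^{-|x|}` in each variable, `e^{α|ξ|₁}` is a signed sum over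
`ε ∈ {-1, 0, 1}^d` of `e^{αε·ξ} ∏_{εᵢ = 0} e^{-α|ξᵢ|}` (`gevreySymbol_eq_sum`). Since
`e^{αε·(ξ + η)} = e^{αε·ξ} e^{αε·η}`, the function `e^{αΛ₁}(fg)` is a sum of products
`(e^{αε·D}f)(e^{αε·D}g)`, to which Poisson kernels in some of the variables are applied
(`multOp_gevrey_mul`). The Poisson kernels have mass one and cost nothing (`poisson_symbol`). On the
other hand `e^{αε·D}` is `e^{αΛ₁}` followed by a tensor product of one-dimensional multipliers that
decay exponentially on each half-line, at different rates. Their kernels are half sums of a Cauchy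
kernel and a conjugate Cauchy kernel, bounded on `L^p` for `1 < p < ∞` uniformly in the rates by
M. Riesz' theorem (`exists_lineKernel_convBound`). That theorem is proved for `p ≤ 2` by integrating
the `p`-th power of the holomorphic extension over squares, and for `p ≥ 2` by duality. Hence the
functions `e^{αε·D} Δ̇_j a` are bounded in `L^p` by the blocks of `A = e^{αΛ₁}a`, with a constant
independent of `α` (`exists_recipNorm_signBlock_le`).

The rest is paraproduct calculus for these functions. By Hölder's and Bernstein's inequalities and
the supports in frequency, the block `m` of a product of blocks `j` and `k` is bounded by a weight
summable over `k` (`exists_product_bound`); the sum over `j` uses the `ℓ¹` norm of `A`. The blocks of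
the product and of its image under `e^{αΛ₁}` are the sums over `j` and `k`.

These blocks have size `O(2^{mσ})` in `L^∞` with `σ = d(x₁ + x₂) - s₁ - s₂ > 0`. So they are the blocks
of elements of `𝓢'₀` (`exists_distribution_of_blocks`): at low frequency the series converges
uniformly, and at high frequency it converges against Schwartz functions. The distribution with the
unweighted blocks is the limit of `Ṡ_n a Ṡ_n b`, because the triple series over `j`, `k` and the blocks
`m`, tested against a Schwartz function, converges absolutely, and each product `Δ̇_j a Δ̇_k b` is the
sum of its blocks, being in some `L^p` with `p < ∞` (`hasSum_integral_block`).
-/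

set_option linter.unusedSectionVars false

noncomputable section

/-! ### Convolution and Young's inequality -/

/-- The convolution `k * f`, written in the form in which it occurs in `gevreyBlock`. -/
def conv {G : Type*} [AddCommGroup G] [MeasureSpace G] (k f : G → ℂ) (x : G) : ℂ :=
  ∫ y, k y * f (x - y)

/-- The `L^{1/t}` norm. Indexing by the reciprocal exponent makes Hölder's and Bernstein's
inequalities linear in the indices, and `t = 0` is the essential supremum. -/
def recipNorm {G : Type*} [MeasureSpace G] (t : ℝ) (f : G → ℂ) : ℝ≥0∞ :=
  eLpNorm f (ENNReal.ofReal t)⁻¹ volume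

lemma recipNorm_zero {G : Type*} [MeasureSpace G] (f : G → ℂ) :
    recipNorm 0 f = eLpNorm f ∞ volume := by
  simp [recipNorm]

lemma recipNorm_of_pos {G : Type*} [MeasureSpace G] {t : ℝ} (ht : 0 < t) (f : G → ℂ) :
    recipNorm t f = (∫⁻ x, ‖f x‖ₑ ^ (1 / t)) ^ t := by
  rw [recipNorm, eLpNorm_eq_lintegral_rpow_enorm_toReal]
  · simp [ENNReal.toReal_inv, ENNReal.toReal_ofReal ht.le]
  · simp
  · simp [ht]

lemma recipNorm_one_div {G : Type*} [MeasureSpace G] {p : ℝ} (hp : 0 < p) (f : G → ℂ) :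
    recipNorm (1 / p) f = eLpNorm f (ENNReal.ofReal p) volume := by
  rw [recipNorm, one_div, ENNReal.ofReal_inv_of_pos hp, inv_inv]

lemma recipNorm_rpow {G : Type*} [MeasureSpace G] {t : ℝ} (ht : 0 < t) (f : G → ℂ) :
    recipNorm t f ^ (1 / t) = ∫⁻ x, ‖f x‖ₑ ^ (1 / t) := by
  rw [recipNorm_of_pos ht, ← ENNReal.rpow_mul, mul_one_div_cancel ht.ne', ENNReal.rpow_one]

/-- Interpolation between `L^{1/t}` and `L^∞`. -/
lemma recipNorm_interpolate {G : Type*} [MeasureSpace G] {t t' : ℝ} (ht : 0 < t) (ht' : 0 ≤ t')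
    (htt : t' ≤ t) (f : G → ℂ) {S R : ℝ≥0∞} (h0 : recipNorm 0 f ≤ S * R ^ t)
    (h1 : recipNorm t f ≤ S) : recipNorm t' f ≤ S * R ^ (t - t') := by
  rcases ht'.eq_or_lt with rfl | hpos
  · simpa using h0
  have hne : t' ≠ 0 := hpos.ne'
  rw [recipNorm_of_pos hpos]
  have hae : ∀ᵐ x, ‖f x‖ₑ ≤ S * R ^ t := by
    rw [recipNorm_zero] at h0
    filter_upwards [enorm_ae_le_eLpNormEssSup f volume] with x hx
    rw [eLpNorm_exponent_top] at h0
    exact hx.trans h0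
  have he : 0 ≤ 1 / t' - 1 / t := by
    rw [sub_nonneg]; exact one_div_le_one_div_of_le hpos htt
  have hle : ∫⁻ x, ‖f x‖ₑ ^ (1 / t') ≤ (S * R ^ t) ^ (1 / t' - 1 / t) * S ^ (1 / t) := by
    calc ∫⁻ x, ‖f x‖ₑ ^ (1 / t')
        ≤ ∫⁻ x, (S * R ^ t) ^ (1 / t' - 1 / t) * ‖f x‖ₑ ^ (1 / t) := by
          apply lintegral_mono_ae
          filter_upwards [hae] with x hx
          have : ‖f x‖ₑ ^ (1 / t') = ‖f x‖ₑ ^ (1 / t' - 1 / t) * ‖f x‖ₑ ^ (1 / t) := by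
            rw [← ENNReal.rpow_add_of_nonneg _ _ he (by positivity)]; congr 1; ring
          rw [this]
          gcongr
      _ ≤ _ := by
          by_cases htop : (S * R ^ t) ^ (1 / t' - 1 / t) = ∞
          · by_cases hz : S ^ (1 / t) = 0
            · have h2 : ∫⁻ x, ‖f x‖ₑ ^ (1 / t) = 0 := by
                rw [← recipNorm_rpow ht]
                have hS : S = 0 := by
                  rw [ENNReal.rpow_eq_zero_iff] at hz
                  rcases hz with h | h
                  · exact h.1
                  · have : 0 < 1 / t := by positivity
                    linarith [h.2]
                rw [hS] at h1
                rw [le_antisymm h1 bot_le]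
                simp [ht]
              by_cases hS : S = 0
              · exfalso
                rw [hS, zero_mul] at htop
                rw [ENNReal.rpow_eq_top_iff] at htop
                rcases htop with h | h
                · linarith [h.2]
                · simp at h
              · exfalso
                rw [ENNReal.rpow_eq_zero_iff] at hz
                rcases hz with h | h
                · exact hS h.1
                · have : 0 < 1 / t := by positivity
                  linarith [h.2]
            · rw [htop, ENNReal.top_mul hz]; exact le_top
          · rw [lintegral_const_mul' _ _ htop, ← recipNorm_rpow ht]
            gcongr
  calc (∫⁻ x, ‖f x‖ₑ ^ (1 / t')) ^ t'
      ≤ ((S * R ^ t) ^ (1 / t' - 1 / t) * S ^ (1 / t)) ^ t' := by gcongr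
    _ = S * R ^ (t - t') := by
      rw [ENNReal.mul_rpow_of_nonneg _ _ ht', ENNReal.mul_rpow_of_nonneg _ _ he,
        ENNReal.mul_rpow_of_nonneg _ _ ht', ← ENNReal.rpow_mul, ← ENNReal.rpow_mul,
        ← ENNReal.rpow_mul, ← ENNReal.rpow_mul, mul_right_comm, ← ENNReal.rpow_add_of_nonneg]
      · have e1 : (1 / t' - 1 / t) * t' + 1 / t * t' = 1 := by field_simp; ring
        have e2 : t * ((1 / t' - 1 / t) * t') = t - t' := by field_simp
        rw [e1, e2, ENNReal.rpow_one]
      · positivity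
      · positivity

section Young

variable {G : Type*} [AddCommGroup G] [MeasureSpace G] [MeasurableAdd₂ G] [MeasurableNeg G]

lemma integrable_conv {k f : G → ℂ} (hk : Integrable k) (hf : Measurable f) {M : ℝ}
    (hM : ∀ x, ‖f x‖ ≤ M) (x : G) : Integrable (fun y => k y * f (x - y)) := by
  refine hk.mul_bdd (c := M) (hf.comp ?_).aestronglyMeasurable (Eventually.of_forall fun y => hM _)
  exact measurable_const.sub measurable_id

lemma norm_conv_le {k f : G → ℂ} (hk : Integrable k) {M : ℝ}
    (hM : ∀ x, ‖f x‖ ≤ M) (x : G) : ‖conv k f x‖ ≤ (∫ y, ‖k y‖) * M := by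
  rw [conv, ← integral_mul_const]
  refine norm_integral_le_of_norm_le (hk.norm.mul_const _) (Eventually.of_forall fun y => ?_)
  rw [norm_mul]
  gcongr
  exact hM _

lemma measurable_conv [SFinite (volume : Measure G)] {k f : G → ℂ} (hk : Integrable k)
    (hf : Measurable f) : Measurable (conv k f) := by
  have h : conv k f = fun x => ∫ y, hk.1.mk k y * f (x - y) := by
    ext x
    refine integral_congr_ae ?_
    filter_upwards [hk.1.ae_eq_mk] with y hy
    rw [hy]
  rw [h]
  have hm : StronglyMeasurable (Function.uncurry fun x y : G => hk.1.mk k y * f (x - y)) := by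
    apply Measurable.stronglyMeasurable
    exact (hk.1.measurable_mk.comp measurable_snd).mul
      (hf.comp (measurable_fst.sub measurable_snd))
  exact hm.integral_prod_right.measurable

/-- Jensen's inequality for the convolution with an integrable kernel. -/
lemma enorm_conv_rpow_le {k f : G → ℂ} (hk : AEStronglyMeasurable k) (hf : Measurable f) {r : ℝ}
    (hr : 1 ≤ r) (x : G) :
    ‖conv k f x‖ₑ ^ r ≤ (∫⁻ y, ‖k y‖ₑ) ^ (r - 1) * ∫⁻ y, ‖k y‖ₑ * ‖f (x - y)‖ₑ ^ r := by
  have h0 : ‖conv k f x‖ₑ ≤ ∫⁻ y, ‖k y‖ₑ * ‖f (x - y)‖ₑ := by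
    refine (enorm_integral_le_lintegral_enorm _).trans (le_of_eq ?_)
    simp [enorm_mul]
  rcases hr.eq_or_lt with rfl | hr1
  · simpa using h0
  have hr0 : 0 < r := by linarith
  set r' : ℝ := r / (r - 1) with hr'
  have hc : r'.HolderConjugate r := by
    have := (Real.HolderConjugate.conjExponent hr1).symm
    simpa [Real.conjExponent] using this
  have hfm : Measurable fun y => f (x - y) := hf.comp (measurable_const.sub measurable_id)
  have h1 := ENNReal.lintegral_mul_le_Lp_mul_Lq (volume : Measure G) hc
    (f := fun y => ‖k y‖ₑ ^ (1 / r')) (g := fun y => ‖k y‖ₑ ^ (1 / r) * ‖f (x - y)‖ₑ)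
    (hk.enorm.pow_const _) ((hk.enorm.pow_const _).mul hfm.enorm.aemeasurable)
  have hr'0 : 0 < r' := hc.pos
  have e1 : ∀ y, ‖k y‖ₑ ^ (1 / r') * (‖k y‖ₑ ^ (1 / r) * ‖f (x - y)‖ₑ)
      = ‖k y‖ₑ * ‖f (x - y)‖ₑ := by
    intro y
    rw [← mul_assoc, ← ENNReal.rpow_add_of_nonneg _ _ (by positivity) (by positivity)]
    have := hc.inv_add_inv_eq_one
    rw [one_div, one_div, this, ENNReal.rpow_one]
  have e2 : ∀ y, (‖k y‖ₑ ^ (1 / r')) ^ r' = ‖k y‖ₑ := by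
    intro y
    rw [← ENNReal.rpow_mul, one_div_mul_cancel hr'0.ne', ENNReal.rpow_one]
  have e3 : ∀ y, (‖k y‖ₑ ^ (1 / r) * ‖f (x - y)‖ₑ) ^ r = ‖k y‖ₑ * ‖f (x - y)‖ₑ ^ r := by
    intro y
    rw [ENNReal.mul_rpow_of_nonneg _ _ hr0.le, ← ENNReal.rpow_mul, one_div_mul_cancel hr0.ne',
      ENNReal.rpow_one]
  simp only [Pi.mul_apply, e1, e2, e3] at h1
  calc ‖conv k f x‖ₑ ^ r ≤ ((∫⁻ y, ‖k y‖ₑ) ^ (1 / r') *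
        (∫⁻ y, ‖k y‖ₑ * ‖f (x - y)‖ₑ ^ r) ^ (1 / r)) ^ r := by
        gcongr; exact h0.trans h1
    _ = _ := by
        rw [ENNReal.mul_rpow_of_nonneg _ _ hr0.le, ← ENNReal.rpow_mul, ← ENNReal.rpow_mul,
          one_div_mul_cancel hr0.ne', ENNReal.rpow_one]
        congr 2
        have : r - 1 ≠ 0 := by linarith
        rw [hr']; field_simp

variable [SFinite (volume : Measure G)] [(volume : Measure G).IsAddLeftInvariant]
  [(volume : Measure G).IsNegInvariant]

/-- Young's inequality `‖k * f‖_{L^r} ≤ ‖k‖_{L¹} ‖f‖_{L^r}`, with `t = 1/r`. -/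
lemma recipNorm_conv_le {k f : G → ℂ} (hk : AEStronglyMeasurable k) (hf : Measurable f) {t : ℝ}
    (ht : 0 < t) (ht1 : t ≤ 1) : recipNorm t (conv k f) ≤ (∫⁻ y, ‖k y‖ₑ) * recipNorm t f := by
  have hr : 1 ≤ 1 / t := by rw [le_div_iff₀ ht]; simpa
  have h : ∫⁻ x, ‖conv k f x‖ₑ ^ (1 / t) ≤
      (∫⁻ y, ‖k y‖ₑ) ^ (1 / t) * ∫⁻ x, ‖f x‖ₑ ^ (1 / t) := by
    calc ∫⁻ x, ‖conv k f x‖ₑ ^ (1 / t)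
        ≤ ∫⁻ x, (∫⁻ y, ‖k y‖ₑ) ^ (1 / t - 1) * ∫⁻ y, ‖k y‖ₑ * ‖f (x - y)‖ₑ ^ (1 / t) :=
          lintegral_mono fun x => enorm_conv_rpow_le hk hf hr x
      _ = (∫⁻ y, ‖k y‖ₑ) ^ (1 / t - 1) *
            ∫⁻ x, ∫⁻ y, ‖k y‖ₑ * ‖f (x - y)‖ₑ ^ (1 / t) := by
          refine lintegral_const_mul'' _ ?_
          refine AEMeasurable.lintegral_prod_right' (f := fun z : G × G =>
            ‖k z.2‖ₑ * ‖f (z.1 - z.2)‖ₑ ^ (1 / t)) ?_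
          exact (hk.enorm.comp_snd).mul
            ((hf.comp (measurable_fst.sub measurable_snd)).enorm.pow_const _).aemeasurable
      _ = (∫⁻ y, ‖k y‖ₑ) ^ (1 / t - 1) *
            ∫⁻ y, ∫⁻ x, ‖k y‖ₑ * ‖f (x - y)‖ₑ ^ (1 / t) := by
          rw [lintegral_lintegral_swap]
          exact (hk.enorm.comp_snd).mul
            ((hf.comp (measurable_fst.sub measurable_snd)).enorm.pow_const _).aemeasurable
      _ = (∫⁻ y, ‖k y‖ₑ) ^ (1 / t - 1) * ((∫⁻ y, ‖k y‖ₑ) * ∫⁻ x, ‖f x‖ₑ ^ (1 / t)) := by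
          congr 1
          rw [← lintegral_mul_const'' _ hk.enorm]
          refine lintegral_congr fun y => ?_
          have hm : Measurable fun x => ‖f (x - y)‖ₑ ^ (1 / t) :=
            (hf.comp (measurable_id.sub measurable_const)).enorm.pow_const _
          rw [lintegral_const_mul _ hm,
            lintegral_sub_right_eq_self (fun x => ‖f x‖ₑ ^ (1 / t)) y]
      _ = _ := by
          rw [← mul_assoc]
          congr 1
          nth_rewrite 2 [← ENNReal.rpow_one (∫⁻ y, ‖k y‖ₑ)]
          rw [← ENNReal.rpow_add_of_nonneg _ _ (by linarith) zero_le_one]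
          congr 1; ring
  rw [recipNorm_of_pos ht, recipNorm_of_pos ht]
  calc _ ≤ ((∫⁻ y, ‖k y‖ₑ) ^ (1 / t) * ∫⁻ x, ‖f x‖ₑ ^ (1 / t)) ^ t := by gcongr
    _ = _ := by
      rw [ENNReal.mul_rpow_of_nonneg _ _ ht.le, ← ENNReal.rpow_mul, one_div_mul_cancel ht.ne',
        ENNReal.rpow_one]

/-- `‖k * f‖_{L^∞} ≤ c R^{1/r} ‖f‖_{L^r}` if `‖k‖_{L¹} ≤ c` and `‖k‖_{L^∞} ≤ c R`; here `t = 1/r`. -/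
lemma enorm_conv_le_recipNorm {k f : G → ℂ} (hk : AEStronglyMeasurable k) (hf : Measurable f)
    {t : ℝ} (ht : 0 < t) (ht1 : t ≤ 1) {c R : ℝ≥0∞} (hc : ∫⁻ y, ‖k y‖ₑ ≤ c)
    (hR : ∀ y, ‖k y‖ₑ ≤ c * R) (x : G) : ‖conv k f x‖ₑ ≤ c * R ^ t * recipNorm t f := by
  have hr : 1 ≤ 1 / t := by rw [le_div_iff₀ ht]; simpa
  have h : ‖conv k f x‖ₑ ^ (1 / t) ≤ c ^ (1 / t - 1) * (c * R * ∫⁻ x, ‖f x‖ₑ ^ (1 / t)) := by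
    refine (enorm_conv_rpow_le hk hf hr x).trans ?_
    gcongr ?_ * ?_
    · exact ENNReal.rpow_le_rpow hc (by linarith)
    · calc ∫⁻ y, ‖k y‖ₑ * ‖f (x - y)‖ₑ ^ (1 / t)
          ≤ ∫⁻ y, c * R * ‖f (x - y)‖ₑ ^ (1 / t) := by
            refine lintegral_mono fun y => ?_
            dsimp only
            gcongr
            exact hR y
        _ = c * R * ∫⁻ y, ‖f (x - y)‖ₑ ^ (1 / t) := by
            rw [lintegral_const_mul]
            exact (hf.comp (measurable_const.sub measurable_id)).enorm.pow_const _
        _ = _ := by rw [lintegral_sub_left_eq_self (fun y => ‖f y‖ₑ ^ (1 / t)) x]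
  have h2 := ENNReal.rpow_le_rpow h ht.le
  rw [← ENNReal.rpow_mul, one_div_mul_cancel ht.ne', ENNReal.rpow_one] at h2
  refine h2.trans (le_of_eq ?_)
  rw [recipNorm_of_pos ht]
  have e : c ^ (1 / t - 1) * (c * R * ∫⁻ x, ‖f x‖ₑ ^ (1 / t)) =
      c ^ (1 / t) * R * ∫⁻ x, ‖f x‖ₑ ^ (1 / t) := by
    rw [← mul_assoc, ← mul_assoc]
    congr 2
    nth_rewrite 2 [← ENNReal.rpow_one c]
    rw [← ENNReal.rpow_add_of_nonneg _ _ (by linarith) zero_le_one]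
    congr 1; ring
  rw [e, ENNReal.mul_rpow_of_nonneg _ _ ht.le, ENNReal.mul_rpow_of_nonneg _ _ ht.le,
    ← ENNReal.rpow_mul, one_div_mul_cancel ht.ne', ENNReal.rpow_one]

/-- Bernstein's inequality in the abstract: a kernel with `‖k‖_{L¹} ≤ c` and `‖k‖_{L^∞} ≤ c R` maps
`L^{1/t}` to `L^{1/t'}` with norm at most `c R^{t - t'}`. -/
lemma recipNorm_conv_le_of_bounds {k f : G → ℂ} (hk : AEStronglyMeasurable k) (hf : Measurable f)
    {t t' : ℝ} (ht : 0 < t) (ht1 : t ≤ 1) (ht' : 0 ≤ t') (htt : t' ≤ t) {c R : ℝ≥0∞}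
    (hc : ∫⁻ y, ‖k y‖ₑ ≤ c) (hR : ∀ y, ‖k y‖ₑ ≤ c * R) :
    recipNorm t' (conv k f) ≤ c * R ^ (t - t') * recipNorm t f := by
  have := recipNorm_interpolate (R := R) (S := c * recipNorm t f) ht ht' htt (conv k f) ?_ ?_
  · refine this.trans (le_of_eq (by ring))
  · rw [recipNorm_zero, eLpNorm_exponent_top]
    refine eLpNormEssSup_le_of_ae_enorm_bound (Eventually.of_forall fun x => ?_)
    refine (enorm_conv_le_recipNorm hk hf ht ht1 hc hR x).trans (le_of_eq (by ring))
  · refine (recipNorm_conv_le hk hf ht ht1).trans ?_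
    gcongr

end Young

/-! ### Fourier multipliers with integrable kernels -/

/-- Bounded continuous functions, as a predicate. -/
def IsBddCont {X : Type*} [TopologicalSpace X] (f : X → ℂ) : Prop :=
  Continuous f ∧ ∃ M : ℝ, ∀ x, ‖f x‖ ≤ M

lemma IsBddCont.mul {X : Type*} [TopologicalSpace X] {f g : X → ℂ} (hf : IsBddCont f)
    (hg : IsBddCont g) : IsBddCont (fun x => f x * g x) := by
  obtain ⟨hf, M, hM⟩ := hf
  obtain ⟨hg, N, hN⟩ := hg
  refine ⟨hf.mul hg, M * N, fun x => ?_⟩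
  rw [norm_mul]
  have := (norm_nonneg _).trans (hM x)
  gcongr
  exacts [hM x, hN x]

lemma IsBddCont.add {X : Type*} [TopologicalSpace X] {f g : X → ℂ} (hf : IsBddCont f)
    (hg : IsBddCont g) : IsBddCont (fun x => f x + g x) := by
  obtain ⟨hf, M, hM⟩ := hf
  obtain ⟨hg, N, hN⟩ := hg
  exact ⟨hf.add hg, M + N, fun x => (norm_add_le _ _).trans (add_le_add (hM x) (hN x))⟩

section Symbols

variable {V : Type*} [NormedAddCommGroup V] [InnerProductSpace ℝ V] [FiniteDimensional ℝ V]
  [MeasurableSpace V] [BorelSpace V]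

/-- The continuous integrable symbols whose convolution kernel is integrable. By Fourier inversion,
the symbol is recovered from its kernel. -/
structure IsSymbol (m : V → ℂ) : Prop where
  cont : Continuous m
  int : Integrable m
  kerInt : Integrable (𝓕⁻ m)

/-- The Fourier multiplier with symbol `m`, acting by convolution with its kernel `𝓕⁻ m`. -/
def multOp (m f : V → ℂ) : V → ℂ := conv (𝓕⁻ m) f

lemma fourierInv_eq_integral_mul (m : V → ℂ) (x : V) :
    𝓕⁻ m x = ∫ ν, (Real.fourierChar (inner ℝ ν x) : ℂ) * m ν := by
  rw [Real.fourierInv_eq]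
  rfl

lemma fourier_eq_integral_mul (m : V → ℂ) (x : V) :
    𝓕 m x = ∫ ν, (Real.fourierChar (-inner ℝ ν x) : ℂ) * m ν := by
  rw [Real.fourier_eq]
  rfl

lemma continuous_fourierChar_coe : Continuous fun t : ℝ => (Real.fourierChar t : ℂ) :=
  continuous_subtype_val.comp Real.continuous_fourierChar

lemma continuous_fourier {f : V → ℂ} (hf : Integrable f) : Continuous (𝓕 f) :=
  VectorFourier.fourierIntegral_continuous Real.continuous_fourierChar
    (by exact continuous_inner) hf

lemma continuous_fourierInv {f : V → ℂ} (hf : Integrable f) : Continuous (𝓕⁻ f) := by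
  have h : 𝓕⁻ f = fun x => 𝓕 f (-x) := by
    ext x; exact Real.fourierInv_eq_fourier_neg f x
  rw [h]
  exact (continuous_fourier hf).comp continuous_neg

lemma norm_fourierChar_mul (t : ℝ) (z : ℂ) : ‖(Real.fourierChar t : ℂ) * z‖ = ‖z‖ := by
  rw [norm_mul, Circle.norm_coe, one_mul]

lemma norm_fourier_le {f : V → ℂ} (x : V) : ‖𝓕 f x‖ ≤ ∫ y, ‖f y‖ := by
  rw [fourier_eq_integral_mul]
  refine (norm_integral_le_integral_norm _).trans (le_of_eq ?_)
  simp only [norm_fourierChar_mul]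

lemma norm_fourierInv_le {f : V → ℂ} (x : V) : ‖𝓕⁻ f x‖ ≤ ∫ y, ‖f y‖ := by
  rw [fourierInv_eq_integral_mul]
  refine (norm_integral_le_integral_norm _).trans (le_of_eq ?_)
  simp only [norm_fourierChar_mul]

lemma IsSymbol.continuous_ker {m : V → ℂ} (hm : IsSymbol m) : Continuous (𝓕⁻ m) :=
  continuous_fourierInv hm.int

lemma IsSymbol.fourier_ker {m : V → ℂ} (hm : IsSymbol m) : 𝓕 (𝓕⁻ m) = m := by
  refine hm.cont.fourier_fourierInv_eq hm.int ?_
  have h : 𝓕 m = fun x => 𝓕⁻ m (-x) := by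
    ext x; rw [Real.fourierInv_eq_fourier_neg, neg_neg]
  rw [h]
  exact hm.kerInt.comp_neg

lemma IsSymbol.bounded {m : V → ℂ} (hm : IsSymbol m) : ∃ M : ℝ, ∀ x, ‖m x‖ ≤ M :=
  ⟨_, fun x => by rw [← hm.fourier_ker]; exact norm_fourier_le x⟩

lemma SchwartzMap.isSymbol (m : 𝓢(V, ℂ)) : IsSymbol (m : V → ℂ) :=
  ⟨m.continuous, m.integrable, by rw [← SchwartzMap.fourierInv_coe]; exact (𝓕⁻ m).integrable⟩

lemma fourierInv_add_apply {f g : V → ℂ} (hf : Integrable f) (hg : Integrable g) :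
    𝓕⁻ (fun x => f x + g x) = fun x => 𝓕⁻ f x + 𝓕⁻ g x := by
  ext x
  simp only [fourierInv_eq_integral_mul, mul_add]
  refine integral_add ?_ ?_
  · exact hf.bdd_mul (c := 1) (continuous_fourierChar_coe.comp (by fun_prop)).aestronglyMeasurable
      (Eventually.of_forall fun y => by rw [Circle.norm_coe])
  · exact hg.bdd_mul (c := 1) (continuous_fourierChar_coe.comp (by fun_prop)).aestronglyMeasurable
      (Eventually.of_forall fun y => by rw [Circle.norm_coe])

lemma fourierInv_const_mul (c : ℂ) (f : V → ℂ) :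
    𝓕⁻ (fun x => c * f x) = fun x => c * 𝓕⁻ f x := by
  ext x
  simp only [fourierInv_eq_integral_mul]
  rw [← integral_const_mul]
  congr 1; ext ν; ring

lemma IsSymbol.add {m n : V → ℂ} (hm : IsSymbol m) (hn : IsSymbol n) :
    IsSymbol (fun x => m x + n x) :=
  ⟨hm.cont.add hn.cont, hm.int.add hn.int, by
    rw [fourierInv_add_apply hm.int hn.int]; exact hm.kerInt.add hn.kerInt⟩

lemma IsSymbol.const_mul {m : V → ℂ} (c : ℂ) (hm : IsSymbol m) : IsSymbol (fun x => c * m x) :=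
  ⟨continuous_const.mul hm.cont, hm.int.const_mul c, by
    rw [fourierInv_const_mul]; exact hm.kerInt.const_mul c⟩

lemma isSymbol_zero : IsSymbol (fun _ : V => (0 : ℂ)) := by
  simpa using (SchwartzMap.isSymbol (0 : 𝓢(V, ℂ))).const_mul 0

lemma IsSymbol.sum {ι : Type*} (s : Finset ι) {m : ι → V → ℂ} (hm : ∀ i ∈ s, IsSymbol (m i)) :
    IsSymbol (fun x => ∑ i ∈ s, m i x) := by
  classical
  induction s using Finset.induction_on with
  | empty => simpa using isSymbol_zero
  | insert i s hi ih =>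
    simp only [Finset.sum_insert hi]
    exact (hm i (Finset.mem_insert_self i s)).add
      (ih fun j hj => hm j (Finset.mem_insert_of_mem hj))

lemma multOp_add_symbol {m n f : V → ℂ} (hm : IsSymbol m) (hn : IsSymbol n) (hf : IsBddCont f)
    (x : V) : multOp (fun ξ => m ξ + n ξ) f x = multOp m f x + multOp n f x := by
  obtain ⟨hf, M, hM⟩ := hf
  rw [multOp, fourierInv_add_apply hm.int hn.int]
  simp only [conv, add_mul]
  exact integral_add (integrable_conv hm.kerInt hf.measurable hM x)
    (integrable_conv hn.kerInt hf.measurable hM x)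

lemma multOp_const_mul_symbol (c : ℂ) (m f : V → ℂ) (x : V) :
    multOp (fun ξ => c * m ξ) f x = c * multOp m f x := by
  rw [multOp, fourierInv_const_mul]
  simp only [conv, multOp, mul_assoc]
  rw [integral_const_mul]

lemma multOp_zero_symbol (f : V → ℂ) (x : V) : multOp (fun _ => 0) f x = 0 := by
  simpa using multOp_const_mul_symbol 0 (fun _ => 0) f x

lemma IsBddCont.conv {k f : V → ℂ} (hk : Integrable k) (hf : IsBddCont f) :
    IsBddCont (conv k f) := by
  obtain ⟨hf, M, hM⟩ := hf
  refine ⟨?_, _, norm_conv_le hk hM⟩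
  refine continuous_of_dominated (bound := fun y => ‖k y‖ * M) ?_ ?_ (hk.norm.mul_const M) ?_
  · exact fun x => (integrable_conv hk hf.measurable hM x).1
  · intro x
    refine Eventually.of_forall fun y => ?_
    rw [norm_mul]
    gcongr
    exact hM _
  · exact Eventually.of_forall fun y => by fun_prop

lemma IsBddCont.multOp {m f : V → ℂ} (hm : IsSymbol m) (hf : IsBddCont f) :
    IsBddCont (multOp m f) := IsBddCont.conv hm.kerInt hf

/-- `k * 𝓕⁻ m = 𝓕⁻ (𝓕 k · m)`. -/
lemma conv_fourierInv {k m : V → ℂ} (hk : Integrable k) (hm : Integrable m) :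
    conv k (𝓕⁻ m) = 𝓕⁻ (fun ν => 𝓕 k ν * m ν) := by
  ext x
  simp only [conv, fourierInv_eq_integral_mul, fourier_eq_integral_mul]
  simp_rw [← integral_const_mul]
  rw [integral_integral_swap]
  · congr 1
    ext ν
    rw [mul_comm (∫ _, _) (m ν), ← mul_assoc, ← integral_const_mul]
    congr 1
    ext y
    have e : (Real.fourierChar (inner ℝ ν (x - y)) : ℂ)
        = Real.fourierChar (inner ℝ ν x) * Real.fourierChar (-inner ℝ y ν) := by
      rw [inner_sub_right, sub_eq_add_neg, AddChar.map_add_eq_mul, Circle.coe_mul,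
        real_inner_comm y ν]
    rw [e]; ring
  · have h := (hk.mul_prod hm).bdd_mul (c := 1)
      (f := fun z : V × V => (Real.fourierChar (inner ℝ z.2 (x - z.1)) : ℂ))
      (continuous_fourierChar_coe.comp (by fun_prop)).aestronglyMeasurable
      (Eventually.of_forall fun y => by rw [Circle.norm_coe])
    refine h.congr (Eventually.of_forall fun z => ?_)
    simp only [Function.uncurry]
    ring

lemma integrable_conv_ker {k₁ k₂ : V → ℂ} (h₁ : Integrable k₁) (h₂ : Integrable k₂) :
    Integrable (conv k₁ k₂) :=
  h₁.integrable_convolution (ContinuousLinearMap.mul ℂ ℂ) h₂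

lemma lintegral_conv_le {k₁ k₂ : V → ℂ} (h₁ : Integrable k₁) (h₂ : Continuous k₂) :
    ∫⁻ x, ‖conv k₁ k₂ x‖ₑ ≤ (∫⁻ x, ‖k₁ x‖ₑ) * ∫⁻ x, ‖k₂ x‖ₑ := by
  simpa [recipNorm_of_pos] using recipNorm_conv_le h₁.1 h₂.measurable one_pos le_rfl

lemma conv_assoc {k₁ k₂ f : V → ℂ} (h₁ : Integrable k₁) (h₂ : Integrable k₂)
    (hf : IsBddCont f) : conv k₁ (conv k₂ f) = conv (conv k₁ k₂) f := by
  obtain ⟨hf, M, hM⟩ := hf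
  ext x
  simp only [conv]
  have e : ∀ y, k₁ y * ∫ z, k₂ z * f (x - y - z) = ∫ z, k₁ y * k₂ (z - y) * f (x - z) := by
    intro y
    rw [← integral_const_mul, ← integral_sub_right_eq_self _ y]
    congr 1; ext z
    rw [sub_sub, add_sub_cancel]; ring
  simp_rw [e]
  rw [integral_integral_swap]
  · congr 1; ext z
    rw [integral_mul_const]
  · have h := (h₁.convolution_integrand (ContinuousLinearMap.mul ℂ ℂ) h₂).swap
    refine (h.mul_bdd (c := M) (g := fun z : V × V => f (x - z.2)) ?_ ?_).congr ?_
    · exact (by fun_prop : Continuous fun z : V × V => f (x - z.2)).aestronglyMeasurable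
    · exact Eventually.of_forall fun z => hM _
    · exact Eventually.of_forall fun z => by simp [Function.uncurry]

/-- Multiplying a symbol by the Fourier transform of an integrable kernel. -/
lemma IsSymbol.fourier_mul {k m : V → ℂ} (hk : Integrable k) (hm : IsSymbol m) :
    IsSymbol (fun ν => 𝓕 k ν * m ν) := by
  refine ⟨(continuous_fourier hk).mul hm.cont, ?_, ?_⟩
  · exact hm.int.bdd_mul (continuous_fourier hk).aestronglyMeasurable
      (Eventually.of_forall norm_fourier_le)
  · rw [← conv_fourierInv hk hm.int]
    exact integrable_conv_ker hk hm.kerInt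

lemma conv_multOp {k m f : V → ℂ} (hk : Integrable k) (hm : IsSymbol m) (hf : IsBddCont f) :
    conv k (multOp m f) = multOp (fun ν => 𝓕 k ν * m ν) f := by
  rw [multOp, conv_assoc hk hm.kerInt hf, conv_fourierInv hk hm.int, multOp]

lemma multOp_multOp {m n f : V → ℂ} (hm : IsSymbol m) (hn : IsSymbol n) (hf : IsBddCont f) :
    multOp m (multOp n f) = multOp (fun ν => m ν * n ν) f := by
  have := conv_multOp hm.kerInt hn hf
  rwa [hm.fourier_ker] at this

lemma summable_apply_of_bound {ι X : Type*} {f : ι → X → ℂ} {u : ι → ℝ} (hu : Summable u)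
    (hfu : ∀ i x, ‖f i x‖ ≤ u i) (x : X) : Summable fun i => f i x :=
  Summable.of_norm_bounded hu fun i => hfu i x

lemma IsBddCont.tsum {ι X : Type*} [TopologicalSpace X] {f : ι → X → ℂ} {u : ι → ℝ}
    (hf : ∀ i, IsBddCont (f i)) (hu : Summable u) (hfu : ∀ i x, ‖f i x‖ ≤ u i) :
    IsBddCont (fun x => ∑' i, f i x) :=
  ⟨continuous_tsum (fun i => (hf i).1) hu hfu, ∑' i, u i, fun x =>
    tsum_of_norm_bounded hu.hasSum fun i => hfu i x⟩

lemma multOp_tsum {ι : Type*} [Countable ι] {m : V → ℂ} (hm : IsSymbol m) {f : ι → V → ℂ}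
    {u : ι → ℝ} (hf : ∀ i, IsBddCont (f i)) (hu : Summable u) (hfu : ∀ i x, ‖f i x‖ ≤ u i) (x : V) :
    multOp m (fun x => ∑' i, f i x) x = ∑' i, multOp m (f i) x := by
  have h := hasSum_integral_of_dominated_convergence (μ := volume)
    (F := fun i y => 𝓕⁻ m y * f i (x - y)) (f := fun y => 𝓕⁻ m y * ∑' i, f i (x - y))
    (fun i y => ‖𝓕⁻ m y‖ * u i) ?_ ?_ ?_ ?_ ?_
  · exact h.tsum_eq.symm
  · exact fun i => (hm.continuous_ker.mul ((hf i).1.comp (by fun_prop))).aestronglyMeasurable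
  · intro i
    refine Eventually.of_forall fun y => ?_
    rw [norm_mul]; gcongr; exact hfu _ _
  · exact Eventually.of_forall fun y => hu.mul_left _
  · simp_rw [tsum_mul_left]
    exact hm.kerInt.norm.mul_const _
  · exact Eventually.of_forall fun y => (summable_apply_of_bound hu hfu _).hasSum.mul_left _

/-! ### Bilinear multipliers -/

/-- The kernel of the bilinear operator `(h₁, h₂) ↦ M(D)(m(D)h₁ · n(D)h₂)` evaluated at `x` depends
only on the bilinear symbol `M(ξ + η) m(ξ) n(η)`. -/
lemma bilinear_kernel_eq {M m n : V → ℂ} (hM : IsSymbol M) (hm : IsSymbol m) (hn : IsSymbol n)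
    (x y z : V) :
    ∫ w, 𝓕⁻ M w * (𝓕⁻ m (x - w - y) * 𝓕⁻ n (x - w - z)) =
      ∫ p : V × V, (Real.fourierChar (inner ℝ p.1 (x - y) + inner ℝ p.2 (x - z)) : ℂ) *
        (M (p.1 + p.2) * m p.1 * n p.2) := by
  have e1 : ∀ w, 𝓕⁻ M w * (𝓕⁻ m (x - w - y) * 𝓕⁻ n (x - w - z)) =
      ∫ p : V × V, 𝓕⁻ M w * (((Real.fourierChar (inner ℝ p.1 (x - w - y)) : ℂ) * m p.1) *
        ((Real.fourierChar (inner ℝ p.2 (x - w - z)) : ℂ) * n p.2)) := by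
    intro w
    rw [integral_const_mul]
    congr 1
    rw [fourierInv_eq_integral_mul m, fourierInv_eq_integral_mul n]
    exact (integral_prod_mul (fun ξ => (Real.fourierChar (inner ℝ ξ (x - w - y)) : ℂ) * m ξ)
      (fun η => (Real.fourierChar (inner ℝ η (x - w - z)) : ℂ) * n η)).symm
  simp_rw [e1]
  rw [integral_integral_swap]
  · congr 1
    ext p
    have e2 : M (p.1 + p.2) = ∫ w, (Real.fourierChar (-inner ℝ w (p.1 + p.2)) : ℂ) * 𝓕⁻ M w := by
      rw [← fourier_eq_integral_mul, hM.fourier_ker]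
    rw [e2, mul_assoc, mul_comm (∫ _, _), ← integral_const_mul, ← integral_const_mul]
    congr 1
    ext w
    have e3 : (Real.fourierChar (inner ℝ p.1 (x - w - y)) : ℂ) *
        Real.fourierChar (inner ℝ p.2 (x - w - z)) =
        Real.fourierChar (inner ℝ p.1 (x - y) + inner ℝ p.2 (x - z)) *
          Real.fourierChar (-inner ℝ w (p.1 + p.2)) := by
      rw [← Circle.coe_mul, ← Circle.coe_mul, ← AddChar.map_add_eq_mul, ← AddChar.map_add_eq_mul]
      congr 2
      simp only [inner_sub_right, inner_add_right, real_inner_comm w]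
      ring
    calc _ = ((Real.fourierChar (inner ℝ p.1 (x - w - y)) : ℂ) *
        Real.fourierChar (inner ℝ p.2 (x - w - z))) * (𝓕⁻ M w * m p.1 * n p.2) := by ring
      _ = _ := by rw [e3]; ring
  · have h := (hM.kerInt.mul_prod (hm.int.mul_prod hn.int)).bdd_mul (c := 1)
      (f := fun q : V × (V × V) => (Real.fourierChar (inner ℝ q.2.1 (x - q.1 - y)) : ℂ) *
        (Real.fourierChar (inner ℝ q.2.2 (x - q.1 - z)) : ℂ))
      ((continuous_fourierChar_coe.comp (by fun_prop)).mul
        (continuous_fourierChar_coe.comp (by fun_prop))).aestronglyMeasurable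
      (Eventually.of_forall fun y => by rw [norm_mul, Circle.norm_coe, Circle.norm_coe, one_mul])
    refine h.congr (Eventually.of_forall fun q => ?_)
    simp only [Function.uncurry]
    ring

lemma integrable_bilinear {M m n h₁ h₂ : V → ℂ} (hM : IsSymbol M) (hm : IsSymbol m)
    (hn : IsSymbol n) (hh₁ : IsBddCont h₁) (hh₂ : IsBddCont h₂) (x : V) :
    Integrable (Function.uncurry fun (w : V) (p : V × V) =>
      𝓕⁻ M w * (𝓕⁻ m (x - w - p.1) * 𝓕⁻ n (x - w - p.2)) * (h₁ p.1 * h₂ p.2))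
      (volume.prod volume) := by
  obtain ⟨c₁, M₁, hM₁⟩ := hh₁
  obtain ⟨c₂, M₂, hM₂⟩ := hh₂
  have cM := hM.continuous_ker
  have cm := hm.continuous_ker
  have cn := hn.continuous_ker
  refine Integrable.mul_bdd (c := M₁ * M₂) ?_ ?_ ?_
  · have hc : Continuous fun q : V × (V × V) =>
        𝓕⁻ M q.1 * (𝓕⁻ m (x - q.1 - q.2.1) * 𝓕⁻ n (x - q.1 - q.2.2)) := by fun_prop
    rw [integrable_prod_iff hc.aestronglyMeasurable]
    constructor
    · refine Eventually.of_forall fun w => ?_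
      have i₁ : Integrable fun y => 𝓕⁻ m (x - w - y) := hm.kerInt.comp_sub_left (x - w)
      have i₂ : Integrable fun y => 𝓕⁻ n (x - w - y) := hn.kerInt.comp_sub_left (x - w)
      exact (i₁.mul_prod i₂).const_mul (𝓕⁻ M w)
    · have e : ∀ w, ∫ p : V × V, ‖𝓕⁻ M w * (𝓕⁻ m (x - w - p.1) * 𝓕⁻ n (x - w - p.2))‖ =
          ‖𝓕⁻ M w‖ * ((∫ y, ‖𝓕⁻ m y‖) * ∫ z, ‖𝓕⁻ n z‖) := by
        intro w
        simp only [norm_mul]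
        rw [integral_const_mul]
        congr 1
        rw [← integral_sub_left_eq_self (fun y => ‖𝓕⁻ m y‖) volume (x - w),
          ← integral_sub_left_eq_self (fun y => ‖𝓕⁻ n y‖) volume (x - w)]
        exact integral_prod_mul (fun y => ‖𝓕⁻ m (x - w - y)‖) (fun z => ‖𝓕⁻ n (x - w - z)‖)
      simp_rw [e]
      exact hM.kerInt.norm.mul_const _
  · exact (by fun_prop : Continuous fun q : V × (V × V) => h₁ q.2.1 * h₂ q.2.2).aestronglyMeasurable
  · refine Eventually.of_forall fun q => ?_
    rw [norm_mul]
    have := (norm_nonneg _).trans (hM₁ q.2.1)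
    gcongr
    exacts [hM₁ _, hM₂ _]

lemma multOp_mul_eq_integral {M m n h₁ h₂ : V → ℂ} (hM : IsSymbol M) (hm : IsSymbol m)
    (hn : IsSymbol n) (hh₁ : IsBddCont h₁) (hh₂ : IsBddCont h₂) (x : V) :
    multOp M (fun w => multOp m h₁ w * multOp n h₂ w) x =
      ∫ p : V × V, (∫ w, 𝓕⁻ M w * (𝓕⁻ m (x - w - p.1) * 𝓕⁻ n (x - w - p.2))) *
        (h₁ p.1 * h₂ p.2) := by
  have e1 : ∀ w, 𝓕⁻ M w * (multOp m h₁ (x - w) * multOp n h₂ (x - w)) =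
      ∫ p : V × V, 𝓕⁻ M w * (𝓕⁻ m (x - w - p.1) * 𝓕⁻ n (x - w - p.2)) * (h₁ p.1 * h₂ p.2) := by
    intro w
    have em : multOp m h₁ (x - w) = ∫ y, 𝓕⁻ m (x - w - y) * h₁ y := by
      rw [multOp, conv, ← integral_sub_left_eq_self _ volume (x - w)]
      simp
    have en : multOp n h₂ (x - w) = ∫ y, 𝓕⁻ n (x - w - y) * h₂ y := by
      rw [multOp, conv, ← integral_sub_left_eq_self _ volume (x - w)]
      simp
    rw [em, en, ← integral_prod_mul, ← integral_const_mul]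
    congr 1; ext p; ring
  rw [multOp, conv]
  simp_rw [e1]
  rw [integral_integral_swap (integrable_bilinear hM hm hn hh₁ hh₂ x)]
  simp_rw [integral_mul_const]

/-- A linear combination of operators `(h₁, h₂) ↦ M(D)(m(D)h₁ · n(D)h₂)` vanishes as soon as the
same combination of the bilinear symbols `M(ξ + η) m(ξ) n(η)` does. -/
theorem sum_multOp_mul_eq_zero {ι : Type*} (s : Finset ι) (c : ι → ℂ) {M m n : ι → V → ℂ}
    {h₁ h₂ : V → ℂ} (hM : ∀ i ∈ s, IsSymbol (M i)) (hm : ∀ i ∈ s, IsSymbol (m i))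
    (hn : ∀ i ∈ s, IsSymbol (n i)) (hh₁ : IsBddCont h₁) (hh₂ : IsBddCont h₂)
    (h : ∀ ξ η, ∑ i ∈ s, c i * (M i (ξ + η) * m i ξ * n i η) = 0) (x : V) :
    ∑ i ∈ s, c i * multOp (M i) (fun w => multOp (m i) h₁ w * multOp (n i) h₂ w) x = 0 := by
  have e1 : ∀ i ∈ s, c i * multOp (M i) (fun w => multOp (m i) h₁ w * multOp (n i) h₂ w) x =
      ∫ p : V × V, c i * ((∫ w, 𝓕⁻ (M i) w * (𝓕⁻ (m i) (x - w - p.1) * 𝓕⁻ (n i) (x - w - p.2))) *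
        (h₁ p.1 * h₂ p.2)) := by
    intro i hi
    rw [multOp_mul_eq_integral (hM i hi) (hm i hi) (hn i hi) hh₁ hh₂, integral_const_mul]
  rw [Finset.sum_congr rfl e1, ← integral_finsetSum]
  · refine integral_eq_zero_of_ae (Eventually.of_forall fun p => ?_)
    simp only [Pi.zero_apply]
    simp_rw [← mul_assoc]
    rw [← Finset.sum_mul, ← Finset.sum_mul]
    have e2 : ∑ i ∈ s, c i * (∫ w, 𝓕⁻ (M i) w * 𝓕⁻ (m i) (x - w - p.1) * 𝓕⁻ (n i) (x - w - p.2))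
        = 0 := by
      have e3 : ∀ i ∈ s, c i * (∫ w, 𝓕⁻ (M i) w * 𝓕⁻ (m i) (x - w - p.1) *
          𝓕⁻ (n i) (x - w - p.2)) = ∫ q : V × V,
          c i * ((Real.fourierChar (inner ℝ q.1 (x - p.1) + inner ℝ q.2 (x - p.2)) : ℂ) *
            (M i (q.1 + q.2) * m i q.1 * n i q.2)) := by
        intro i hi
        rw [integral_const_mul, ← bilinear_kernel_eq (hM i hi) (hm i hi) (hn i hi)]
        simp only [mul_assoc]
      rw [Finset.sum_congr rfl e3, ← integral_finsetSum]
      · refine integral_eq_zero_of_ae (Eventually.of_forall fun q => ?_)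
        simp only [Pi.zero_apply]
        have e4 : ∀ (z : ℂ), ∑ i ∈ s, c i * (z * (M i (q.1 + q.2) * m i q.1 * n i q.2)) = 0 := by
          intro z
          rw [← mul_zero z, ← h q.1 q.2, Finset.mul_sum]
          exact Finset.sum_congr rfl fun i _ => by ring
        exact e4 _
      · intro i hi
        refine Integrable.const_mul ?_ _
        refine Integrable.bdd_mul (c := 1) ?_ ?_ ?_
        · obtain ⟨B, hB⟩ := (hM i hi).bounded
          have := ((hm i hi).int.mul_prod (hn i hi).int).bdd_mul (c := B)
            (f := fun q : V × V => M i (q.1 + q.2))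
            ((hM i hi).cont.comp (by fun_prop)).aestronglyMeasurable
            (Eventually.of_forall fun q => hB _)
          refine this.congr (Eventually.of_forall fun q => ?_)
          simp only; ring
        · exact (continuous_fourierChar_coe.comp (by fun_prop)).aestronglyMeasurable
        · exact Eventually.of_forall fun q => by rw [Circle.norm_coe]
    rw [e2]; ring
  · intro i hi
    refine Integrable.const_mul ?_ _
    have := (integrable_bilinear (hM i hi) (hm i hi) (hn i hi) hh₁ hh₂ x).integral_prod_right
    refine this.congr (Eventually.of_forall fun p => ?_)
    simp only [Function.uncurry]
    rw [integral_mul_const]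

end Symbols

/-! ### The one-dimensional kernels -/

/-- The symbol `ξ ↦ e^{-y₁ ξ}` for `ξ ≥ 0`, `e^{y₂ ξ}` for `ξ ≤ 0`, where `ξ = 2πν`. As `y₁ → 0` and
`y₂ → ∞` it tends to the symbol of the Riesz projection. -/
def lineSymbol (y₁ y₂ ν : ℝ) : ℂ :=
  ((Real.exp (-(y₁ * max (2 * Real.pi * ν) 0) - y₂ * max (-(2 * Real.pi * ν)) 0) : ℝ) : ℂ)

/-- The kernel of the multiplier with symbol `lineSymbol y₁ y₂`, half the sum of a Cauchy kernel
and a conjugate Cauchy kernel. -/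
def lineKernel (y₁ y₂ x : ℝ) : ℂ :=
  (1 / (2 * Real.pi)) * (1 / (y₁ - Complex.I * x) + 1 / (y₂ + Complex.I * x))

lemma continuous_lineSymbol (y₁ y₂ : ℝ) : Continuous (lineSymbol y₁ y₂) := by
  unfold lineSymbol; fun_prop

lemma sub_I_mul_ne_zero {y : ℝ} (hy : 0 < y) (x : ℝ) : (y : ℂ) - Complex.I * x ≠ 0 := by
  intro h
  have := congrArg Complex.re h
  simp at this
  exact hy.ne' this

lemma add_I_mul_ne_zero {y : ℝ} (hy : 0 < y) (x : ℝ) : (y : ℂ) + Complex.I * x ≠ 0 := by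
  intro h
  have := congrArg Complex.re h
  simp at this
  exact hy.ne' this

lemma continuous_lineKernel {y₁ y₂ : ℝ} (h₁ : 0 < y₁) (h₂ : 0 < y₂) :
    Continuous (lineKernel y₁ y₂) := by
  unfold lineKernel
  refine continuous_const.mul (Continuous.add ?_ ?_)
  · exact continuous_const.div (by fun_prop) (sub_I_mul_ne_zero h₁)
  · exact continuous_const.div (by fun_prop) (add_I_mul_ne_zero h₂)

lemma lineKernel_eq {y₁ y₂ : ℝ} (h₁ : 0 < y₁) (h₂ : 0 < y₂) (x : ℝ) :
    lineKernel y₁ y₂ x =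
      ((y₁ + y₂ : ℝ) / (2 * Real.pi)) * (1 / ((y₁ - Complex.I * x) * (y₂ + Complex.I * x))) := by
  have a := sub_I_mul_ne_zero h₁ x
  have b := add_I_mul_ne_zero h₂ x
  have c : (Real.pi : ℂ) ≠ 0 := by exact_mod_cast Real.pi_ne_zero
  unfold lineKernel
  field_simp
  push_cast
  ring

lemma integrable_lineKernel {y₁ y₂ : ℝ} (h₁ : 0 < y₁) (h₂ : 0 < y₂) :
    Integrable (lineKernel y₁ y₂) := by
  set δ := min 1 (min y₁ y₂) with hδ
  have hδ0 : 0 < δ := by positivity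
  have hn : ∀ (y x : ℝ), δ ≤ y → δ ^ 2 * (1 + x ^ 2) ≤ y ^ 2 + x ^ 2 := by
    intro y x hy
    have h1 : δ ^ 2 ≤ y ^ 2 := by gcongr
    have h2 : δ ^ 2 ≤ 1 := by
      have : δ ≤ 1 := min_le_left _ _
      nlinarith
    nlinarith [sq_nonneg x]
  refine (integrable_inv_one_add_sq.const_mul ((y₁ + y₂) / (2 * Real.pi) * (δ ^ 2)⁻¹)).mono'
    (continuous_lineKernel h₁ h₂).aestronglyMeasurable (Eventually.of_forall fun x => ?_)
  rw [lineKernel_eq h₁ h₂, norm_mul, norm_div, norm_div, norm_mul, norm_mul]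
  have e1 : ‖(y₁ : ℂ) - Complex.I * x‖ = Real.sqrt (y₁ ^ 2 + x ^ 2) := by
    rw [Complex.norm_def, Complex.normSq_apply]; simp; ring_nf
  have e2 : ‖(y₂ : ℂ) + Complex.I * x‖ = Real.sqrt (y₂ ^ 2 + x ^ 2) := by
    rw [Complex.norm_def, Complex.normSq_apply]; simp; ring_nf
  rw [e1, e2, ← Real.sqrt_mul (by positivity)]
  have e3 : δ ^ 2 * (1 + x ^ 2) ≤ Real.sqrt ((y₁ ^ 2 + x ^ 2) * (y₂ ^ 2 + x ^ 2)) := by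
    apply Real.le_sqrt_of_sq_le
    have a1 := hn y₁ x ((min_le_right _ _).trans (min_le_left _ _))
    have a2 := hn y₂ x ((min_le_right _ _).trans (min_le_right _ _))
    have : 0 ≤ δ ^ 2 * (1 + x ^ 2) := by positivity
    rw [sq]
    gcongr
  have e4 : ‖((y₁ + y₂ : ℝ) : ℂ)‖ = y₁ + y₂ := by
    rw [Complex.norm_real, Real.norm_of_nonneg (by positivity)]
  rw [e4]
  simp only [norm_one, Complex.norm_ofNat, Complex.norm_real, Real.norm_of_nonneg Real.pi_pos.le]
  rw [mul_assoc _ (δ ^ 2)⁻¹, ← mul_inv, one_div]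
  gcongr

lemma lineSymbol_of_nonneg (y₁ y₂ : ℝ) {ν : ℝ} (hν : 0 ≤ ν) :
    lineSymbol y₁ y₂ ν = Complex.exp (-(2 * Real.pi * y₁) * ν) := by
  have : 0 ≤ 2 * Real.pi * ν := by positivity
  rw [lineSymbol, max_eq_left this, max_eq_right (by linarith)]
  push_cast; congr 1; ring

lemma lineSymbol_of_nonpos (y₁ y₂ : ℝ) {ν : ℝ} (hν : ν ≤ 0) :
    lineSymbol y₁ y₂ ν = Complex.exp ((2 * Real.pi * y₂) * ν) := by
  have : 2 * Real.pi * ν ≤ 0 := mul_nonpos_of_nonneg_of_nonpos (by positivity) hν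
  rw [lineSymbol, max_eq_right this, max_eq_left (by linarith)]
  push_cast; congr 1; ring

lemma fourierChar_eq_exp (t : ℝ) :
    (Real.fourierChar t : ℂ) = Complex.exp (2 * Real.pi * t * Complex.I) := by
  rw [Real.fourierChar_apply]; push_cast; rfl

lemma hasIntegral_lineSymbol {y₁ y₂ : ℝ} (h₁ : 0 < y₁) (h₂ : 0 < y₂) (x : ℝ) :
    Integrable (fun ν : ℝ => (Real.fourierChar (inner ℝ ν x) : ℂ) * lineSymbol y₁ y₂ ν) ∧
    ∫ ν : ℝ, (Real.fourierChar (inner ℝ ν x) : ℂ) * lineSymbol y₁ y₂ ν = lineKernel y₁ y₂ x := by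
  have hπ : (Real.pi : ℂ) ≠ 0 := by exact_mod_cast Real.pi_ne_zero
  set a : ℂ := 2 * Real.pi * (Complex.I * x - y₁) with ha
  set b : ℂ := 2 * Real.pi * (Complex.I * x + y₂) with hb
  have har : a.re < 0 := by
    have : a.re = -(2 * Real.pi * y₁) := by simp [ha]
    rw [this]; have := Real.pi_pos; nlinarith [mul_pos this h₁]
  have hbr : 0 < b.re := by
    have : b.re = 2 * Real.pi * y₂ := by simp [hb]
    rw [this]; positivity
  have e1 : Set.EqOn (fun ν : ℝ => Complex.exp (a * ν))
      (fun ν : ℝ => (Real.fourierChar (inner ℝ ν x) : ℂ) * lineSymbol y₁ y₂ ν) (Set.Ioi 0) := by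
    intro ν hν
    simp only
    rw [lineSymbol_of_nonneg _ _ (le_of_lt hν), fourierChar_eq_exp, ← Complex.exp_add]
    congr 1
    simp [ha]; ring
  have e2 : Set.EqOn (fun ν : ℝ => Complex.exp (b * ν))
      (fun ν : ℝ => (Real.fourierChar (inner ℝ ν x) : ℂ) * lineSymbol y₁ y₂ ν) (Set.Iic 0) := by
    intro ν hν
    simp only
    rw [lineSymbol_of_nonpos _ _ hν, fourierChar_eq_exp, ← Complex.exp_add]
    congr 1
    simp [hb]; ring
  have i1 := (integrableOn_exp_mul_complex_Ioi har 0).congr_fun e1 measurableSet_Ioi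
  have i2 := (integrableOn_exp_mul_complex_Iic hbr 0).congr_fun e2 measurableSet_Iic
  constructor
  · rw [← integrableOn_univ, ← Set.Iic_union_Ioi (a := (0 : ℝ))]
    exact i2.union i1
  · rw [← intervalIntegral.integral_Iic_add_Ioi i2 i1, ← setIntegral_congr_fun measurableSet_Ioi e1,
      ← setIntegral_congr_fun measurableSet_Iic e2, integral_exp_mul_complex_Ioi har,
      integral_exp_mul_complex_Iic hbr]
    have c1 := sub_I_mul_ne_zero h₁ x
    have c2 := add_I_mul_ne_zero h₂ x
    have d1 : a = -(2 * Real.pi * (y₁ - Complex.I * x)) := by rw [ha]; ring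
    have d2 : b = 2 * Real.pi * (y₂ + Complex.I * x) := by rw [hb]; ring
    rw [d1, d2, lineKernel]
    simp only [Complex.ofReal_zero, mul_zero, Complex.exp_zero, neg_div_neg_eq]
    field_simp
    ring

lemma isSymbol_lineSymbol {y₁ y₂ : ℝ} (h₁ : 0 < y₁) (h₂ : 0 < y₂) :
    IsSymbol (lineSymbol y₁ y₂) := by
  refine ⟨continuous_lineSymbol _ _, ?_, ?_⟩
  · simpa using (hasIntegral_lineSymbol h₁ h₂ 0).1
  · have : 𝓕⁻ (lineSymbol y₁ y₂) = lineKernel y₁ y₂ := by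
      ext x; rw [fourierInv_eq_integral_mul]; exact (hasIntegral_lineSymbol h₁ h₂ x).2
    rw [this]; exact integrable_lineKernel h₁ h₂

lemma fourierInv_lineSymbol {y₁ y₂ : ℝ} (h₁ : 0 < y₁) (h₂ : 0 < y₂) :
    𝓕⁻ (lineSymbol y₁ y₂) = lineKernel y₁ y₂ := by
  ext x; rw [fourierInv_eq_integral_mul]; exact (hasIntegral_lineSymbol h₁ h₂ x).2

lemma fourier_lineKernel {y₁ y₂ : ℝ} (h₁ : 0 < y₁) (h₂ : 0 < y₂) :
    𝓕 (lineKernel y₁ y₂) = lineSymbol y₁ y₂ := by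
  rw [← fourierInv_lineSymbol h₁ h₂]
  exact (isSymbol_lineSymbol h₁ h₂).fourier_ker

/-- For `y₁ = y₂` the kernel is the Poisson kernel. -/
lemma lineKernel_self {y : ℝ} (hy : 0 < y) (x : ℝ) :
    lineKernel y y x = ((y / (Real.pi * (y ^ 2 + x ^ 2)) : ℝ) : ℂ) := by
  have a := sub_I_mul_ne_zero hy x
  have b := add_I_mul_ne_zero hy x
  have c : (Real.pi : ℂ) ≠ 0 := by exact_mod_cast Real.pi_ne_zero
  have d : ((y : ℂ) - Complex.I * x) * (y + Complex.I * x) = y ^ 2 + x ^ 2 := by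
    linear_combination -(x : ℂ) ^ 2 * Complex.I_sq
  rw [lineKernel_eq hy hy, d]
  have e : ((y : ℂ) ^ 2 + (x : ℂ) ^ 2) ≠ 0 := by rw [← d]; exact mul_ne_zero a b
  push_cast
  field_simp
  ring

lemma norm_lineKernel_self {y : ℝ} (hy : 0 < y) (x : ℝ) :
    (‖lineKernel y y x‖ : ℂ) = lineKernel y y x := by
  rw [lineKernel_self hy, Complex.norm_real, Real.norm_of_nonneg (by positivity)]

lemma integral_lineKernel {y₁ y₂ : ℝ} (h₁ : 0 < y₁) (h₂ : 0 < y₂) :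
    ∫ x, lineKernel y₁ y₂ x = 1 := by
  have h := congrFun (fourier_lineKernel h₁ h₂) 0
  rw [fourier_eq_integral_mul] at h
  simpa [lineSymbol] using h

lemma lintegral_lineKernel_self {y : ℝ} (hy : 0 < y) : ∫⁻ x, ‖lineKernel y y x‖ₑ = 1 := by
  rw [← ofReal_integral_norm_eq_lintegral_enorm (integrable_lineKernel hy hy)]
  have h : ((∫ x, ‖lineKernel y y x‖ : ℝ) : ℂ) = 1 := by
    rw [← integral_complex_ofReal, ← integral_lineKernel hy hy]
    simp only [norm_lineKernel_self hy]
  have h' : (∫ x, ‖lineKernel y y x‖ : ℝ) = 1 := by exact_mod_cast h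
  rw [h', ENNReal.ofReal_one]

/-! ### M. Riesz' theorem -/

/-- The pointwise inequality behind M. Riesz' theorem: on the right half-plane `|w|^p` is controlled
by `(Re w)^p` up to a multiple of the real part of the holomorphic function `w^p`. Near the
imaginary axis this holds because `cos (pπ/2) < 0`. -/
lemma exists_norm_rpow_le {p : ℝ} (hp : 1 < p) (hp2 : p ≤ 2) :
    ∃ A B : ℝ, 0 ≤ A ∧ 0 ≤ B ∧ ∀ w : ℂ, 0 < w.re →
      ‖w‖ ^ p ≤ A * w.re ^ p - B * (w ^ (p : ℂ)).re := by
  have hπ := Real.pi_pos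
  have hp0 : 0 < p := by linarith
  -- the angle beyond which `cos (pθ)` is negative, halfway between `π / (2p)` and `π / 2`
  set θ₀ : ℝ := (Real.pi / (2 * p) + Real.pi / 2) / 2 with hθ₀
  have h1 : Real.pi / (2 * p) < Real.pi / 2 := by
    apply div_lt_div_of_pos_left hπ <;> linarith
  have h2 : Real.pi / (2 * p) < θ₀ := by rw [hθ₀]; linarith
  have h3 : θ₀ < Real.pi / 2 := by rw [hθ₀]; linarith
  have h0 : 0 < θ₀ := lt_trans (by positivity) h2
  have hpθ : Real.pi / 2 < p * θ₀ := by
    have := mul_lt_mul_of_pos_left h2 hp0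
    have e : p * (Real.pi / (2 * p)) = Real.pi / 2 := by field_simp
    linarith
  have hpθ' : p * θ₀ ≤ Real.pi := by nlinarith
  have hc : Real.cos (p * θ₀) < 0 :=
    Real.cos_neg_of_pi_div_two_lt_of_lt hpθ (by linarith)
  set B : ℝ := 1 / (-Real.cos (p * θ₀)) with hB
  have hB0 : 0 < B := by rw [hB]; apply one_div_pos.2; linarith
  have hcos0 : 0 < Real.cos θ₀ := Real.cos_pos_of_mem_Ioo ⟨by linarith, h3⟩
  set A : ℝ := (1 + B) / Real.cos θ₀ ^ p with hA
  have hA0 : 0 ≤ A := by positivity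
  refine ⟨A, B, hA0, hB0.le, fun w hw => ?_⟩
  have hw0 : w ≠ 0 := by rintro rfl; simp at hw
  have hn : 0 < ‖w‖ := norm_pos_iff.2 hw0
  have habs : |w.arg| < Real.pi / 2 := Complex.abs_arg_lt_pi_div_two_iff.2 (Or.inl hw)
  have hre : w.re = ‖w‖ * Real.cos |w.arg| := by rw [Real.cos_abs, Complex.norm_mul_cos_arg]
  have hcosarg : 0 < Real.cos |w.arg| :=
    Real.cos_pos_of_mem_Ioo ⟨by linarith [abs_nonneg w.arg], habs⟩
  have hpow : (w ^ (p : ℂ)).re = ‖w‖ ^ p * Real.cos (p * |w.arg|) := by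
    rw [Complex.cpow_ofReal_re, mul_comm w.arg, ← Real.cos_abs (p * w.arg), abs_mul, abs_of_pos hp0]
  rw [hpow, hre, Real.mul_rpow hn.le hcosarg.le]
  have key : 1 ≤ A * Real.cos |w.arg| ^ p - B * Real.cos (p * |w.arg|) := by
    rcases le_total |w.arg| θ₀ with hle | hle
    · have e1 : Real.cos θ₀ ^ p ≤ Real.cos |w.arg| ^ p := by
        apply Real.rpow_le_rpow hcos0.le _ hp0.le
        exact Real.cos_le_cos_of_nonneg_of_le_pi (abs_nonneg _) (by linarith) hle
      have e2 : 1 + B ≤ A * Real.cos |w.arg| ^ p := by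
        calc 1 + B = A * Real.cos θ₀ ^ p := by rw [hA]; field_simp
          _ ≤ _ := by gcongr
      have e3 := Real.cos_le_one (p * |w.arg|)
      nlinarith
    · have e1 : Real.cos (p * |w.arg|) ≤ Real.cos (p * θ₀) := by
        apply Real.cos_le_cos_of_nonneg_of_le_pi (by positivity)
        · nlinarith
        · gcongr
      have e2 : 1 ≤ B * (-Real.cos (p * |w.arg|)) := by
        calc (1 : ℝ) = B * (-Real.cos (p * θ₀)) := by
              rw [hB, one_div_mul_cancel]; linarith
          _ ≤ _ := by gcongr
      have e3 : 0 ≤ A * Real.cos |w.arg| ^ p := by positivity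
      linarith
  have hnp : 0 < ‖w‖ ^ p := by positivity
  nlinarith

/-- The holomorphic function on the upper half-plane whose real part is the Poisson extension
of `f` and whose imaginary part is the conjugate Poisson extension. -/
def cauchyExt (f : ℝ → ℝ) (z : ℂ) : ℂ := ∫ t, (f t : ℂ) * (Complex.I / (Real.pi * (z - t)))

lemma sub_ofReal_ne_zero {z : ℂ} (hz : 0 < z.im) (t : ℝ) : z - t ≠ 0 := by
  intro h
  have := congrArg Complex.im h
  simp at this
  exact hz.ne' this

lemma im_le_norm_sub (z : ℂ) (t : ℝ) : z.im ≤ ‖z - t‖ := by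
  have := Complex.abs_im_le_norm (z - t)
  simp only [Complex.sub_im, Complex.ofReal_im, sub_zero] at this
  exact (le_abs_self _).trans this

lemma norm_I_div {z : ℂ} (t : ℝ) : ‖Complex.I / (Real.pi * (z - t))‖ = 1 / (Real.pi * ‖z - t‖) := by
  rw [norm_div, norm_mul, Complex.norm_I, Complex.norm_real, Real.norm_of_nonneg Real.pi_pos.le]

lemma continuous_cauchyIntegrand {z : ℂ} (hz : 0 < z.im) :
    Continuous fun t : ℝ => Complex.I / (Real.pi * (z - t)) := by
  refine continuous_const.div (by fun_prop) fun t => ?_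
  exact mul_ne_zero (by exact_mod_cast Real.pi_ne_zero) (sub_ofReal_ne_zero hz t)

lemma integrable_cauchyExt {f : ℝ → ℝ} (hf : Integrable f) {z : ℂ} (hz : 0 < z.im) :
    Integrable fun t => (f t : ℂ) * (Complex.I / (Real.pi * (z - t))) := by
  refine hf.ofReal.mul_bdd (c := 1 / (Real.pi * z.im))
    (continuous_cauchyIntegrand hz).aestronglyMeasurable (Eventually.of_forall fun t => ?_)
  rw [norm_I_div]
  have := im_le_norm_sub z t
  have := Real.pi_pos
  gcongr

lemma differentiableAt_cauchyExt {f : ℝ → ℝ} (hf : Integrable f) {z : ℂ} (hz : 0 < z.im) :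
    DifferentiableAt ℂ (cauchyExt f) z := by
  have hπ : (Real.pi : ℂ) ≠ 0 := by exact_mod_cast Real.pi_ne_zero
  have hs : {w : ℂ | z.im / 2 < w.im} ∈ 𝓝 z :=
    (isOpen_lt continuous_const Complex.continuous_im).mem_nhds
      (show z.im / 2 < z.im by linarith)
  have h := hasDerivAt_integral_of_dominated_loc_of_deriv_le (μ := volume) (𝕜 := ℂ) (x₀ := z)
    (F := fun (w : ℂ) (t : ℝ) => (f t : ℂ) * (Complex.I / (Real.pi * (w - t))))
    (F' := fun (w : ℂ) (t : ℝ) => (f t : ℂ) * (-Complex.I / (Real.pi * (w - t) ^ 2)))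
    (bound := fun t => |f t| * (1 / (Real.pi * (z.im / 2) ^ 2))) hs ?_ ?_ ?_ ?_ ?_ ?_
  · exact h.2.differentiableAt
  · filter_upwards [hs] with w hw
    have hw : z.im / 2 < w.im := hw
    exact (integrable_cauchyExt hf (by linarith)).1
  · exact integrable_cauchyExt hf hz
  · refine hf.ofReal.1.mul (Continuous.aestronglyMeasurable ?_)
    refine continuous_const.div (by fun_prop) fun t => ?_
    exact mul_ne_zero hπ (pow_ne_zero 2 (sub_ofReal_ne_zero hz t))
  · refine Eventually.of_forall fun t w hw => ?_
    have hw : z.im / 2 < w.im := hw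
    have h1 := im_le_norm_sub w t
    have := Real.pi_pos
    rw [norm_mul, norm_div, norm_neg, Complex.norm_I, norm_mul, norm_pow, Complex.norm_real,
      Complex.norm_real, Real.norm_of_nonneg Real.pi_pos.le, Real.norm_eq_abs]
    have : z.im / 2 ≤ ‖w - t‖ := by linarith
    gcongr
  · exact hf.abs.mul_const _
  · refine Eventually.of_forall fun t w hw => ?_
    have hw : z.im / 2 < w.im := hw
    have hw0 := sub_ofReal_ne_zero (show 0 < w.im by linarith) t
    have h1 : HasDerivAt (fun w : ℂ => (Real.pi : ℂ) * (w - t)) (Real.pi * 1) w :=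
      ((hasDerivAt_id w).sub_const _).const_mul _
    have h2 := ((hasDerivAt_const w Complex.I).div h1 (mul_ne_zero hπ hw0)).const_mul (f t : ℂ)
    refine h2.congr_deriv ?_
    field_simp
    ring

lemma norm_cauchyExt_le {f : ℝ → ℝ} (hf : Integrable f) (h0 : ∀ t, 0 ≤ f t) {R : ℝ}
    (hR : ∀ t, R < |t| → f t = 0) {z : ℂ} {δ : ℝ} (hδ : 0 < δ)
    (h : ∀ t : ℝ, |t| ≤ R → δ ≤ ‖z - t‖) : ‖cauchyExt f z‖ ≤ (∫ t, f t) / (Real.pi * δ) := by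
  rw [cauchyExt, div_eq_mul_inv, ← integral_mul_const]
  refine norm_integral_le_of_norm_le (hf.mul_const _) (Eventually.of_forall fun t => ?_)
  rw [norm_mul, norm_I_div, Complex.norm_real, Real.norm_of_nonneg (h0 t)]
  rcases le_or_gt |t| R with ht | ht
  · have := h t ht
    have := Real.pi_pos
    have := h0 t
    rw [one_div]
    gcongr
  · simp [hR t ht]

lemma cauchyKernel_eq {y : ℝ} (hy : 0 < y) (x t : ℝ) :
    Complex.I / (Real.pi * ((x + y * Complex.I : ℂ) - t)) =
      (1 / Real.pi) * (1 / (y - Complex.I * ((x - t : ℝ) : ℂ))) := by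
  have hπ : (Real.pi : ℂ) ≠ 0 := by exact_mod_cast Real.pi_ne_zero
  have h1 := sub_I_mul_ne_zero hy (x - t)
  have h2 := sub_ofReal_ne_zero (z := (x + y * Complex.I : ℂ)) (by simpa) t
  have e : (x + y * Complex.I : ℂ) - t = Complex.I * (y - Complex.I * ((x - t : ℝ) : ℂ)) := by
    push_cast
    linear_combination ((x : ℂ) - t) * Complex.I_sq
  rw [e]
  have := Complex.I_ne_zero
  field_simp

lemma conv_lineKernel_eq {f : ℝ → ℝ} (hf : Integrable f) {y₁ y₂ : ℝ} (h₁ : 0 < y₁) (h₂ : 0 < y₂)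
    (x : ℝ) : conv (lineKernel y₁ y₂) (fun t => (f t : ℂ)) x =
      (1 / 2) * (cauchyExt f (x + y₁ * Complex.I) +
        (starRingEnd ℂ) (cauchyExt f (x + y₂ * Complex.I))) := by
  have i1 := integrable_cauchyExt hf (z := (x + y₁ * Complex.I : ℂ)) (by simpa)
  have i2 := integrable_cauchyExt hf (z := (x + y₂ * Complex.I : ℂ)) (by simpa)
  have i3 : Integrable fun t => (starRingEnd ℂ)
      ((f t : ℂ) * (Complex.I / (Real.pi * ((x + y₂ * Complex.I : ℂ) - t)))) :=
    ContinuousLinearEquiv.integrable_comp_iff (Complex.conjCLE) |>.2 i2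
  rw [conv, cauchyExt, cauchyExt, ← integral_conj, ← integral_add i1 i3, ← integral_const_mul,
    ← integral_sub_left_eq_self _ volume x]
  congr 1
  ext t
  rw [map_mul, cauchyKernel_eq h₁, cauchyKernel_eq h₂, lineKernel]
  simp only [map_mul, map_div₀, map_one, map_sub, Complex.conj_ofReal, Complex.conj_I,
    sub_sub_cancel]
  rw [neg_mul, sub_neg_eq_add]
  ring

lemma cauchyExt_re {f : ℝ → ℝ} (hf : Integrable f) {y : ℝ} (hy : 0 < y) (x : ℝ) :
    ((cauchyExt f (x + y * Complex.I)).re : ℂ) =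
      conv (lineKernel y y) (fun t => (f t : ℂ)) x := by
  rw [conv_lineKernel_eq hf hy hy, Complex.add_conj]
  push_cast; ring

lemma cauchyExt_re_pos {f : ℝ → ℝ} (hf : Integrable f) (h0 : ∀ t, 0 ≤ f t)
    (hpos : 0 < ∫ t, f t) {z : ℂ} (hz : 0 < z.im) : 0 < (cauchyExt f z).re := by
  have i1 := integrable_cauchyExt hf hz
  have e : ∀ t : ℝ, ((f t : ℂ) * (Complex.I / (Real.pi * (z - t)))).re =
      f t * (z.im / (Real.pi * Complex.normSq (z - t))) := by
    intro t
    have hn : Complex.normSq (z - t) ≠ 0 := by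
      simpa using sub_ofReal_ne_zero hz t
    rw [Complex.re_ofReal_mul]
    congr 1
    rw [Complex.div_re]
    simp [Complex.normSq_mul]
    have := Real.pi_ne_zero
    field_simp
  have h1 : (cauchyExt f z).re = ∫ t, f t * (z.im / (Real.pi * Complex.normSq (z - t))) := by
    rw [cauchyExt, ← RCLike.re_eq_complex_re, ← integral_re i1]
    simp only [RCLike.re_eq_complex_re, e]
  rw [h1]
  have i2 : Integrable fun t => f t * (z.im / (Real.pi * Complex.normSq (z - t))) := by
    simpa only [RCLike.re_eq_complex_re, e] using i1.re
  have hk : ∀ t : ℝ, 0 < z.im / (Real.pi * Complex.normSq (z - t)) := by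
    intro t
    have : 0 < Complex.normSq (z - t) := Complex.normSq_pos.2 (sub_ofReal_ne_zero hz t)
    have := Real.pi_pos
    positivity
  rw [integral_pos_iff_support_of_nonneg (fun t => mul_nonneg (h0 t) (hk t).le) i2]
  rw [integral_pos_iff_support_of_nonneg h0 hf] at hpos
  convert hpos using 2
  ext t
  simp only [Function.mem_support, ne_eq, mul_eq_zero, (hk t).ne', or_false]

/-- Cauchy's theorem on the square over `[-X, X]` of height `X`. -/
lemma norm_integral_cauchyExt_cpow_le {f : ℝ → ℝ} (hf : Integrable f) (h0 : ∀ t, 0 ≤ f t)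
    (hpos : 0 < ∫ t, f t) {R : ℝ} (hR : ∀ t, R < |t| → f t = 0) {p y X : ℝ} (hp : 1 < p)
    (hy : 0 < y) (hX0 : 0 < X) (hX : 2 * R ≤ X) :
    ‖∫ x in (-X)..X, cauchyExt f (x + y * Complex.I) ^ (p : ℂ)‖ ≤
      4 * X * (2 * (∫ t, f t) / (Real.pi * X)) ^ p := by
  set c := ∫ t, f t with hc
  have hp0 : 0 < p := by linarith
  have hπ := Real.pi_pos
  have hd : DifferentiableOn ℂ (fun z => cauchyExt f z ^ (p : ℂ)) {z | 0 < z.im} := by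
    intro z hz
    refine ((differentiableAt_cauchyExt hf hz).cpow_const ?_).differentiableWithinAt
    exact Complex.mem_slitPlane_iff.2 (Or.inl (cauchyExt_re_pos hf h0 hpos hz))
  have hsub : (Set.uIcc (-X + y * Complex.I : ℂ).re (X + (y + X) * Complex.I : ℂ).re ×ℂ
      Set.uIcc (-X + y * Complex.I : ℂ).im (X + (y + X) * Complex.I : ℂ).im) ⊆ {z | 0 < z.im} := by
    intro z hz
    have h2 := hz.2
    simp only [Complex.add_im, Complex.neg_im, Complex.ofReal_im, Complex.mul_im,
      Complex.ofReal_re, Complex.I_im, Complex.I_re, Complex.add_re] at h2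
    norm_num at h2
    rw [Set.uIcc_of_le (by linarith)] at h2
    exact lt_of_lt_of_le hy h2.1
  have hrect := Complex.integral_boundary_rect_eq_zero_of_differentiableOn
    (fun z => cauchyExt f z ^ (p : ℂ)) (-X + y * Complex.I) (X + (y + X) * Complex.I)
    (hd.mono hsub)
  simp only [Complex.add_im, Complex.neg_im, Complex.ofReal_im, Complex.mul_im,
      Complex.ofReal_re, Complex.I_im, Complex.I_re, Complex.add_re, Complex.neg_re,
      Complex.mul_re] at hrect
  norm_num at hrect
  -- away from the support of `f` the extension is `O(1 / X)`; this applies to the top and both sides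
  have hb : ∀ z : ℂ, (∀ t : ℝ, |t| ≤ R → X / 2 ≤ ‖z - t‖) → 0 < z.im →
      ‖cauchyExt f z ^ (p : ℂ)‖ ≤ (2 * c / (Real.pi * X)) ^ p := by
    intro z hz hzim
    rw [Complex.norm_cpow_real]
    refine Real.rpow_le_rpow (norm_nonneg _) ?_ hp0.le
    refine (norm_cauchyExt_le hf h0 hR (half_pos hX0) hz).trans (le_of_eq ?_)
    rw [← hc]; field_simp
  set K := (2 * c / (Real.pi * X)) ^ p with hK
  have b1 : ‖∫ x in (-X)..X, cauchyExt f (x + (y + X) * Complex.I) ^ (p : ℂ)‖ ≤ K * |X - -X| := by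
    refine intervalIntegral.norm_integral_le_of_norm_le_const fun x _ => hb _ ?_ ?_
    · intro t _
      refine le_trans ?_ (im_le_norm_sub _ t)
      simp; linarith
    · simp; linarith
  have b2 : ‖∫ v in y..(y + X), cauchyExt f (X + v * Complex.I) ^ (p : ℂ)‖ ≤ K * |y + X - y| := by
    refine intervalIntegral.norm_integral_le_of_norm_le_const fun v hv => hb _ ?_ ?_
    · intro t ht
      refine le_trans ?_ (Complex.abs_re_le_norm _)
      simp
      have := abs_le.1 ht
      exact le_trans (by linarith) (le_abs_self _)
    · rw [Set.uIoc_of_le (by linarith)] at hv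
      simp; linarith [hv.1]
  have b3 : ‖∫ v in y..(y + X), cauchyExt f (-X + v * Complex.I) ^ (p : ℂ)‖ ≤ K * |y + X - y| := by
    refine intervalIntegral.norm_integral_le_of_norm_le_const fun v hv => hb _ ?_ ?_
    · intro t ht
      refine le_trans ?_ (Complex.abs_re_le_norm _)
      simp
      have := abs_le.1 ht
      exact le_trans (by linarith) (neg_le_abs _)
    · rw [Set.uIoc_of_le (by linarith)] at hv
      simp; linarith [hv.1]
  rw [abs_of_pos (by linarith)] at b1 b2 b3
  set I₀ := ∫ x in (-X)..X, cauchyExt f (x + y * Complex.I) ^ (p : ℂ)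
  set I₁ := ∫ x in (-X)..X, cauchyExt f (x + (y + X) * Complex.I) ^ (p : ℂ)
  set I₂ := ∫ v in y..(y + X), cauchyExt f (X + v * Complex.I) ^ (p : ℂ)
  set I₃ := ∫ v in y..(y + X), cauchyExt f (-X + v * Complex.I) ^ (p : ℂ)
  have e : I₀ = I₁ - Complex.I * I₂ + Complex.I * I₃ := by linear_combination hrect
  rw [e]
  calc ‖I₁ - Complex.I * I₂ + Complex.I * I₃‖ ≤ ‖I₁‖ + ‖Complex.I * I₂‖ + ‖Complex.I * I₃‖ :=
        (norm_add_le _ _).trans (add_le_add (norm_sub_le _ _) le_rfl)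
    _ = ‖I₁‖ + ‖I₂‖ + ‖I₃‖ := by simp
    _ ≤ K * (X - -X) + K * (y + X - y) + K * (y + X - y) := by gcongr
    _ = 4 * X * K := by ring

/-- M. Riesz' inequality for the holomorphic extension of a nonnegative function with bounded
support, for `1 < p ≤ 2`. -/
lemma exists_lintegral_cauchyExt_le {p : ℝ} (hp : 1 < p) (hp2 : p ≤ 2) :
    ∃ A : ℝ≥0, ∀ f : ℝ → ℝ, Integrable f → Measurable f → (∀ t, 0 ≤ f t) →
      (∃ R, ∀ t, R < |t| → f t = 0) → ∀ y : ℝ, 0 < y →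
      ∫⁻ x : ℝ, ‖cauchyExt f (x + y * Complex.I)‖ₑ ^ p ≤ A * ∫⁻ x, ‖f x‖ₑ ^ p := by
  obtain ⟨A, B, hA, hB, hAB⟩ := exists_norm_rpow_le hp hp2
  have hp0 : 0 < p := by linarith
  have hπ := Real.pi_pos
  refine ⟨A.toNNReal, fun f hf hfm h0 ⟨R, hR⟩ y hy => ?_⟩
  rcases (integral_nonneg (show 0 ≤ f from h0)).eq_or_lt with hz | hpos
  · have hae : f =ᵐ[volume] 0 := (integral_eq_zero_iff_of_nonneg h0 hf).1 hz.symm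
    have : ∀ x : ℝ, cauchyExt f (x + y * Complex.I) = 0 := by
      intro x
      refine integral_eq_zero_of_ae ?_
      filter_upwards [hae] with t ht
      simp [ht]
    simp [this, hp0]
  set G : ℝ → ℂ := fun x => cauchyExt f (x + y * Complex.I) with hG
  have him : ∀ x : ℝ, 0 < (x + y * Complex.I : ℂ).im := fun x => by simpa
  have hGc : Continuous G := by
    rw [continuous_iff_continuousAt]
    intro x
    exact (differentiableAt_cauchyExt hf (him x)).continuousAt.comp (f := fun x : ℝ =>
      (x + y * Complex.I : ℂ)) (by fun_prop)
  have hGpos : ∀ x, 0 < (G x).re := fun x => cauchyExt_re_pos hf h0 hpos (him x)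
  have hGp : Continuous fun x => G x ^ (p : ℂ) := by
    rw [continuous_iff_continuousAt]
    intro x
    exact hGc.continuousAt.cpow continuousAt_const
      (Complex.mem_slitPlane_iff.2 (Or.inl (hGpos x)))
  have hn : Continuous fun x => ‖G x‖ ^ p :=
    hGc.norm.rpow_const fun x => Or.inr hp0.le
  have hu : Continuous fun x => (G x).re ^ p :=
    (Complex.continuous_re.comp hGc).rpow_const fun x => Or.inr hp0.le
  -- the Poisson extension is a contraction
  have hu2 : ∫⁻ x, ENNReal.ofReal ((G x).re ^ p) ≤ ∫⁻ x, ‖f x‖ₑ ^ p := by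
    have h := recipNorm_conv_le (integrable_lineKernel hy hy).1
      (f := fun t => (f t : ℂ)) (by fun_prop) (t := 1 / p) (by positivity)
      (by rw [div_le_one hp0]; exact hp.le)
    rw [lintegral_lineKernel_self hy, one_mul] at h
    have h' := ENNReal.rpow_le_rpow h hp0.le
    have e : (1 / (1 / p)) = p := by simp
    have h1 := recipNorm_rpow (t := 1 / p) (by positivity) (conv (lineKernel y y) fun t => (f t : ℂ))
    have h2 := recipNorm_rpow (t := 1 / p) (by positivity) (fun t => (f t : ℂ))
    rw [e] at h1 h2
    rw [h1, h2] at h'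
    calc ∫⁻ x, ENNReal.ofReal ((G x).re ^ p)
        = ∫⁻ x, ‖conv (lineKernel y y) (fun t => (f t : ℂ)) x‖ₑ ^ p := by
          refine lintegral_congr fun x => ?_
          rw [← cauchyExt_re hf hy, ← ofReal_norm, Complex.norm_real,
            Real.norm_of_nonneg (hGpos x).le, ENNReal.ofReal_rpow_of_pos (hGpos x)]
      _ ≤ ∫⁻ x, ‖(f x : ℂ)‖ₑ ^ p := h'
      _ = _ := by
          refine lintegral_congr fun x => ?_
          rw [← ofReal_norm, ← ofReal_norm, Complex.norm_real]
  set c := ∫ t, f t with hc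
  -- the other three sides of the square contribute `O(X ^ (1 - p))`, which vanishes in the limit
  set err : ℝ → ℝ := fun X => B * (4 * X * (2 * c / (Real.pi * X)) ^ p) with herr
  have hmain : ∀ᶠ X : ℝ in atTop, ∫⁻ x in Set.Ioc (-X) X, ‖G x‖ₑ ^ p ≤
      ENNReal.ofReal A * (∫⁻ x, ‖f x‖ₑ ^ p) + ENNReal.ofReal (err X) := by
    filter_upwards [eventually_gt_atTop 0, eventually_ge_atTop (2 * R)] with X hX0 hX
    have hle : (-X) ≤ X := by linarith
    have i1 : IntervalIntegrable (fun x => ‖G x‖ ^ p) volume (-X) X := hn.intervalIntegrable _ _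
    have i2 : IntervalIntegrable (fun x => (G x).re ^ p) volume (-X) X := hu.intervalIntegrable _ _
    have i3 : IntervalIntegrable (fun x => (G x ^ (p : ℂ)).re) volume (-X) X :=
      (Complex.continuous_re.comp hGp).intervalIntegrable _ _
    have i4 : IntervalIntegrable (fun x => G x ^ (p : ℂ)) volume (-X) X :=
      hGp.intervalIntegrable _ _
    have h1 : ∫ x in (-X)..X, ‖G x‖ ^ p ≤ A * (∫ x in (-X)..X, (G x).re ^ p) + err X := by
      calc ∫ x in (-X)..X, ‖G x‖ ^ p
          ≤ ∫ x in (-X)..X, (A * (G x).re ^ p - B * (G x ^ (p : ℂ)).re) :=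
            intervalIntegral.integral_mono_on hle i1 ((i2.const_mul A).sub (i3.const_mul B))
              fun x _ => hAB _ (hGpos x)
        _ = A * (∫ x in (-X)..X, (G x).re ^ p) - B * ∫ x in (-X)..X, (G x ^ (p : ℂ)).re := by
            rw [intervalIntegral.integral_sub (i2.const_mul A) (i3.const_mul B),
              intervalIntegral.integral_const_mul, intervalIntegral.integral_const_mul]
        _ ≤ _ := by
            have e : ∫ x in (-X)..X, (G x ^ (p : ℂ)).re = (∫ x in (-X)..X, G x ^ (p : ℂ)).re := by
              rw [intervalIntegral.integral_of_le hle, intervalIntegral.integral_of_le hle]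
              exact integral_re ((intervalIntegrable_iff_integrableOn_Ioc_of_le hle).1 i4)
            have h2 := norm_integral_cauchyExt_cpow_le hf h0 hpos hR hp hy hX0 hX
            have h3 := (Complex.abs_re_le_norm _).trans h2
            have h4 := (abs_le.1 h3).1
            rw [e]
            simp only [hG, herr]
            nlinarith
    have e1 : ∫⁻ x in Set.Ioc (-X) X, ‖G x‖ₑ ^ p =
        ENNReal.ofReal (∫ x in (-X)..X, ‖G x‖ ^ p) := by
      rw [intervalIntegral.integral_of_le hle, ofReal_integral_eq_lintegral_ofReal
        ((intervalIntegrable_iff_integrableOn_Ioc_of_le hle).1 i1)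
        (Eventually.of_forall fun x => by positivity)]
      refine lintegral_congr fun x => ?_
      rw [← ofReal_norm, ENNReal.ofReal_rpow_of_nonneg (norm_nonneg _) hp0.le]
    have e2 : ENNReal.ofReal (∫ x in (-X)..X, (G x).re ^ p) ≤ ∫⁻ x, ‖f x‖ₑ ^ p := by
      refine le_trans ?_ hu2
      rw [intervalIntegral.integral_of_le hle, ofReal_integral_eq_lintegral_ofReal
        ((intervalIntegrable_iff_integrableOn_Ioc_of_le hle).1 i2)
        (Eventually.of_forall fun x => Real.rpow_nonneg (hGpos x).le _)]
      exact setLIntegral_le_lintegral _ _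
    rw [e1]
    calc ENNReal.ofReal (∫ x in (-X)..X, ‖G x‖ ^ p)
        ≤ ENNReal.ofReal (A * (∫ x in (-X)..X, (G x).re ^ p) + err X) :=
          ENNReal.ofReal_le_ofReal h1
      _ ≤ ENNReal.ofReal (A * (∫ x in (-X)..X, (G x).re ^ p)) + ENNReal.ofReal (err X) :=
          ENNReal.ofReal_add_le
      _ ≤ _ := by
          rw [ENNReal.ofReal_mul hA]
          gcongr
  have herr0 : Tendsto err atTop (𝓝 0) := by
    have h1 : Tendsto (fun X : ℝ => B * (4 * (2 * c / Real.pi) ^ p) * X ^ (-(p - 1))) atTop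
        (𝓝 (B * (4 * (2 * c / Real.pi) ^ p) * 0)) :=
      (tendsto_rpow_neg_atTop (by linarith)).const_mul _
    rw [mul_zero] at h1
    refine h1.congr' ?_
    filter_upwards [eventually_gt_atTop 0] with X hX
    have e1 : 2 * c / (Real.pi * X) = 2 * c / Real.pi * X⁻¹ := by field_simp
    rw [herr]
    simp only
    rw [e1, Real.mul_rpow (by positivity) (by positivity), Real.inv_rpow hX.le, neg_sub,
      Real.rpow_sub hX, Real.rpow_one]
    ring
  have hlim1 := (aecover_Ioc (μ := (volume : Measure ℝ)) tendsto_neg_atTop_atBot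
    tendsto_id).lintegral_tendsto_of_countably_generated
    (f := fun x => ‖G x‖ₑ ^ p) (hGc.measurable.enorm.pow_const _).aemeasurable
  have hlim2 : Tendsto (fun X => ENNReal.ofReal A * (∫⁻ x, ‖f x‖ₑ ^ p) + ENNReal.ofReal (err X))
      atTop (𝓝 (ENNReal.ofReal A * (∫⁻ x, ‖f x‖ₑ ^ p) + ENNReal.ofReal 0)) :=
    tendsto_const_nhds.add (ENNReal.tendsto_ofReal herr0)
  have := le_of_tendsto_of_tendsto hlim1 hlim2 hmain
  simpa using! this

/-- `κ` acts on `L^p` with norm at most `C`; tested on bounded measurable functions, on which the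
convolution is everywhere defined. -/
def ConvBound {G : Type*} [AddCommGroup G] [MeasureSpace G] (κ : G → ℂ) (p : ℝ) (C : ℝ≥0∞) : Prop :=
  ∀ f : G → ℂ, Measurable f → (∃ M, ∀ x, ‖f x‖ ≤ M) →
    eLpNorm (conv κ f) (ENNReal.ofReal p) volume ≤ C * eLpNorm f (ENNReal.ofReal p) volume

lemma eLpNorm_ofReal_eq {G : Type*} [MeasureSpace G] {p : ℝ} (hp : 0 < p) (f : G → ℂ) :
    eLpNorm f (ENNReal.ofReal p) volume = (∫⁻ x, ‖f x‖ₑ ^ p) ^ (1 / p) := by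
  rw [← recipNorm_one_div hp, recipNorm_of_pos (by positivity)]
  simp

lemma eLpNorm_ofReal_rpow {G : Type*} [MeasureSpace G] {p : ℝ} (hp : 0 < p) (f : G → ℂ) :
    eLpNorm f (ENNReal.ofReal p) volume ^ p = ∫⁻ x, ‖f x‖ₑ ^ p := by
  rw [eLpNorm_ofReal_eq hp, ← ENNReal.rpow_mul, one_div_mul_cancel hp.ne', ENNReal.rpow_one]

/-- The bound for `1 < p ≤ 2`, for nonnegative functions with bounded support. -/
lemma exists_lineKernel_bound_nonneg {p : ℝ} (hp : 1 < p) (hp2 : p ≤ 2) :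
    ∃ C : ℝ≥0, ∀ y₁ y₂ : ℝ, 0 < y₁ → 0 < y₂ → ∀ f : ℝ → ℝ, Integrable f → Measurable f →
      (∀ t, 0 ≤ f t) → (∃ R, ∀ t, R < |t| → f t = 0) →
      eLpNorm (conv (lineKernel y₁ y₂) fun t => (f t : ℂ)) (ENNReal.ofReal p) volume ≤
        C * eLpNorm f (ENNReal.ofReal p) volume := by
  obtain ⟨A, hA⟩ := exists_lintegral_cauchyExt_le hp hp2
  have hp0 : 0 < p := by linarith
  refine ⟨A ^ (1 / p), fun y₁ y₂ h₁ h₂ f hf hfm h0 hR => ?_⟩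
  have hfe : eLpNorm f (ENNReal.ofReal p) volume = (∫⁻ x, ‖f x‖ₑ ^ p) ^ (1 / p) := by
    rw [← eLpNorm_norm]
    have := eLpNorm_ofReal_eq hp0 (fun x => (f x : ℂ))
    rw [← eLpNorm_norm] at this
    simpa only [Complex.norm_real, ← ofReal_norm] using this
  have hb : ∀ y : ℝ, 0 < y → eLpNorm (fun x : ℝ => cauchyExt f (x + y * Complex.I))
      (ENNReal.ofReal p) volume ≤ (A : ℝ≥0∞) ^ (1 / p) * eLpNorm f (ENNReal.ofReal p) volume := by
    intro y hy
    rw [eLpNorm_ofReal_eq hp0, hfe, ← ENNReal.mul_rpow_of_nonneg _ _ (by positivity)]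
    exact ENNReal.rpow_le_rpow (hA f hf hfm h0 hR y hy) (by positivity)
  have hcont : ∀ y : ℝ, 0 < y → Continuous (fun x : ℝ => cauchyExt f (x + y * Complex.I)) := by
    intro y hy
    rw [continuous_iff_continuousAt]
    intro x
    exact (differentiableAt_cauchyExt hf (by simpa)).continuousAt.comp (f := fun x : ℝ =>
      (x + y * Complex.I : ℂ)) (by fun_prop)
  have hconj : eLpNorm (fun x : ℝ => (starRingEnd ℂ) (cauchyExt f (x + y₂ * Complex.I)))
      (ENNReal.ofReal p) volume =
      eLpNorm (fun x : ℝ => cauchyExt f (x + y₂ * Complex.I)) (ENNReal.ofReal p) volume :=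
    eLpNorm_congr_norm_ae (Eventually.of_forall fun x => by simp)
  have hfun : (conv (lineKernel y₁ y₂) fun t => (f t : ℂ)) =
      (1 / 2 : ℂ) • ((fun x : ℝ => cauchyExt f (x + y₁ * Complex.I)) +
        fun x : ℝ => (starRingEnd ℂ) (cauchyExt f (x + y₂ * Complex.I))) := by
    ext x; rw [conv_lineKernel_eq hf h₁ h₂]; simp
  rw [hfun, eLpNorm_const_smul]
  have hadd := eLpNorm_add_le (hcont y₁ h₁).aestronglyMeasurable (μ := volume)
    (Complex.continuous_conj.comp (hcont y₂ h₂)).aestronglyMeasurable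
    (p := ENNReal.ofReal p) (by rw [← ENNReal.ofReal_one]; exact ENNReal.ofReal_le_ofReal hp.le)
  have h12 : ‖(1 / 2 : ℂ)‖ₑ = 1 / 2 := by
    rw [← ofReal_norm]
    simp [ENNReal.ofReal_inv_of_pos]
  rw [h12, ENNReal.coe_rpow_of_nonneg _ (by positivity)]
  set E := (A : ℝ≥0∞) ^ (1 / p) * eLpNorm f (ENNReal.ofReal p) volume
  calc _ ≤ (1 / 2) * (E + E) := by
        gcongr
        refine hadd.trans (add_le_add (hb y₁ h₁) ?_)
        exact hconj.le.trans (hb y₂ h₂)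
    _ = E := by
        rw [← two_mul, ← mul_assoc, one_div, ENNReal.inv_mul_cancel (by simp) (by simp), one_mul]

/-- Fatou's lemma for the `L^p` norm. -/
lemma eLpNorm_le_of_tendsto {X ι : Type*} [MeasureSpace X] {l : Filter ι} [l.NeBot]
    [l.IsCountablyGenerated] {p : ℝ≥0∞} {g : ι → X → ℂ} {f : X → ℂ} {K : ℝ≥0∞}
    (hg : ∀ᶠ n in l, AEStronglyMeasurable (g n) volume)
    (hK : ∀ᶠ n in l, eLpNorm (g n) p volume ≤ K) (h : ∀ x, Tendsto (fun n => g n x) l (𝓝 (f x))) :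
    eLpNorm f p volume ≤ K := by
  obtain ⟨u, hu⟩ := l.exists_seq_tendsto
  obtain ⟨N, hN⟩ := eventually_atTop.1 (hu.eventually (hg.and hK))
  have h' : ∀ x, Tendsto (fun n => g (u (n + N)) x) atTop (𝓝 (f x)) := fun x =>
    ((h x).comp hu).comp (tendsto_add_atTop_nat N)
  refine (Lp.eLpNorm_lim_le_liminf_eLpNorm (f := fun n => g (u (n + N)))
    (fun n => (hN _ (by omega)).1) f (Eventually.of_forall h')).trans ?_
  refine (liminf_le_liminf (v := fun _ => K) (Eventually.of_forall fun n => ?_)).trans ?_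
  · exact (hN _ (by omega)).2
  · simp

lemma one_le_ofReal {p : ℝ} (hp : 1 < p) : 1 ≤ ENNReal.ofReal p := by
  rw [← ENNReal.ofReal_one]; exact ENNReal.ofReal_le_ofReal hp.le

/-- Convolution with an integrable kernel is continuous along dominated pointwise limits. -/
lemma tendsto_conv {G ι : Type*} [AddCommGroup G] [MeasureSpace G] [MeasurableAdd₂ G]
    [MeasurableNeg G] {l : Filter ι} [l.IsCountablyGenerated] {κ : G → ℂ} (hκ : Integrable κ)
    {F : ι → G → ℂ} {f : G → ℂ}
    (hF : ∀ i, Measurable (F i)) {M : ℝ} (hM : ∀ i x, ‖F i x‖ ≤ M)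
    (h : ∀ x, Tendsto (fun i => F i x) l (𝓝 (f x))) (x : G) :
    Tendsto (fun i => conv κ (F i) x) l (𝓝 (conv κ f x)) := by
  refine tendsto_integral_filter_of_dominated_convergence (fun y => ‖κ y‖ * M) ?_ ?_
    (hκ.norm.mul_const M) ?_
  · exact Eventually.of_forall fun i => (integrable_conv hκ (hF i) (hM i) x).1
  · refine Eventually.of_forall fun i => Eventually.of_forall fun y => ?_
    rw [norm_mul]
    gcongr
    exact hM _ _
  · exact Eventually.of_forall fun y => (h _).const_mul _

/-- A bound on nonnegative functions of bounded support extends to all bounded functions. -/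
lemma ConvBound.of_nonneg {κ : ℝ → ℂ} (hκ : Integrable κ) {p : ℝ} (hp : 1 < p) {C : ℝ≥0}
    (h : ∀ f : ℝ → ℝ, Integrable f → Measurable f → (∀ t, 0 ≤ f t) →
      (∃ R, ∀ t, R < |t| → f t = 0) →
      eLpNorm (conv κ fun t => (f t : ℂ)) (ENNReal.ofReal p) volume ≤
        C * eLpNorm f (ENNReal.ofReal p) volume) : ConvBound κ p (4 * C : ℝ≥0) := by
  have hnn : ∀ f : ℝ → ℝ, Measurable f → (∀ t, 0 ≤ f t) → (∃ M, ∀ t, f t ≤ M) →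
      eLpNorm (conv κ fun t => (f t : ℂ)) (ENNReal.ofReal p) volume ≤
        C * eLpNorm f (ENNReal.ofReal p) volume := by
    rintro f hf h0 ⟨M, hM⟩
    set F : ℕ → ℝ → ℝ := fun n => (Set.Icc (-n : ℝ) n).indicator f with hF
    have hFm : ∀ n, Measurable (F n) := fun n => hf.indicator measurableSet_Icc
    have hF0 : ∀ n t, 0 ≤ F n t := fun n t => Set.indicator_nonneg (fun x _ => h0 x) t
    have hFf : ∀ n t, F n t ≤ f t := fun n t => Set.indicator_le_self' (fun x _ => h0 x) t
    have hFb : ∀ n t, ‖(F n t : ℂ)‖ ≤ M := by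
      intro n t
      rw [Complex.norm_real, Real.norm_of_nonneg (hF0 n t)]
      exact (hFf n t).trans (hM t)
    refine eLpNorm_le_of_tendsto (l := atTop) (g := fun n => conv κ fun t => (F n t : ℂ)) ?_ ?_ ?_
    · exact Eventually.of_forall fun n =>
        (measurable_conv hκ ((Complex.measurable_ofReal.comp (hFm n)))).aestronglyMeasurable
    · refine Eventually.of_forall fun n => (h (F n) ?_ (hFm n) (hF0 n) ⟨n, ?_⟩).trans ?_
      · rw [hF]
        simp only
        rw [integrable_indicator_iff measurableSet_Icc]
        refine Measure.integrableOn_of_bounded (M := M) (by simp) hf.aestronglyMeasurable ?_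
        exact Eventually.of_forall fun x => by
          rw [Real.norm_of_nonneg (h0 x)]; exact hM x
      · intro t ht
        refine Set.indicator_of_notMem ?_ _
        rintro ⟨a, b⟩
        exact absurd (abs_le.2 ⟨a, b⟩) (not_le.2 ht)
      · gcongr
        refine eLpNorm_mono fun t => ?_
        rw [Real.norm_of_nonneg (hF0 n t), Real.norm_of_nonneg (h0 t)]
        exact hFf n t
    · refine tendsto_conv hκ (fun n => Complex.measurable_ofReal.comp (hFm n)) hFb fun t => ?_
      refine tendsto_const_nhds.congr' ?_
      obtain ⟨N, hN⟩ := exists_nat_ge |t|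
      filter_upwards [eventually_ge_atTop N] with n hn
      have : t ∈ Set.Icc (-n : ℝ) n := by
        have : |t| ≤ n := hN.trans (by exact_mod_cast hn)
        exact abs_le.1 this
      simp [hF, this]
  rintro f hf ⟨M, hM⟩
  have hre := Complex.measurable_re.comp hf
  have him := Complex.measurable_im.comp hf
  set f₁ : ℝ → ℝ := fun t => max (f t).re 0
  set f₂ : ℝ → ℝ := fun t => max (-(f t).re) 0
  set f₃ : ℝ → ℝ := fun t => max (f t).im 0
  set f₄ : ℝ → ℝ := fun t => max (-(f t).im) 0
  -- the factor `4` comes from the positive and negative parts of the real and imaginary parts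
  have key : ∀ g : ℝ → ℝ, Measurable g → (∀ t, 0 ≤ g t) → (∀ t, g t ≤ ‖f t‖) →
      AEStronglyMeasurable (conv κ fun t => (g t : ℂ)) volume ∧
      eLpNorm (conv κ fun t => (g t : ℂ)) (ENNReal.ofReal p) volume ≤
        C * eLpNorm f (ENNReal.ofReal p) volume := by
    intro g hg h0 hgf
    refine ⟨(measurable_conv hκ (Complex.measurable_ofReal.comp hg)).aestronglyMeasurable,
      (hnn g hg h0 ⟨M, fun t => (hgf t).trans (hM t)⟩).trans ?_⟩
    gcongr
    refine eLpNorm_mono fun t => ?_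
    rw [Real.norm_of_nonneg (h0 t)]
    exact hgf t
  have a1 := fun t => (Complex.abs_re_le_norm (f t))
  have a2 := fun t => (Complex.abs_im_le_norm (f t))
  obtain ⟨m₁, b₁⟩ := key f₁ (by fun_prop) (fun t => le_max_right _ _)
    (fun t => max_le ((le_abs_self _).trans (a1 t)) (norm_nonneg _))
  obtain ⟨m₂, b₂⟩ := key f₂ (by fun_prop) (fun t => le_max_right _ _)
    (fun t => max_le ((neg_le_abs _).trans (a1 t)) (norm_nonneg _))
  obtain ⟨m₃, b₃⟩ := key f₃ (by fun_prop) (fun t => le_max_right _ _)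
    (fun t => max_le ((le_abs_self _).trans (a2 t)) (norm_nonneg _))
  obtain ⟨m₄, b₄⟩ := key f₄ (by fun_prop) (fun t => le_max_right _ _)
    (fun t => max_le ((neg_le_abs _).trans (a2 t)) (norm_nonneg _))
  have hint : ∀ g : ℝ → ℝ, Measurable g → (∀ t, 0 ≤ g t) → (∀ t, g t ≤ ‖f t‖) → ∀ x,
      Integrable fun y => κ y * (g (x - y) : ℂ) := by
    intro g hg h0 hgf x
    refine integrable_conv (f := fun t => (g t : ℂ)) hκ (Complex.measurable_ofReal.comp hg)
      (M := M) (fun t => ?_) x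
    rw [Complex.norm_real, Real.norm_of_nonneg (h0 t)]
    exact (hgf t).trans (hM t)
  have j₁ := hint f₁ (by fun_prop) (fun t => le_max_right _ _)
    (fun t => max_le ((le_abs_self _).trans (a1 t)) (norm_nonneg _))
  have j₂ := hint f₂ (by fun_prop) (fun t => le_max_right _ _)
    (fun t => max_le ((neg_le_abs _).trans (a1 t)) (norm_nonneg _))
  have j₃ := hint f₃ (by fun_prop) (fun t => le_max_right _ _)
    (fun t => max_le ((le_abs_self _).trans (a2 t)) (norm_nonneg _))
  have j₄ := hint f₄ (by fun_prop) (fun t => le_max_right _ _)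
    (fun t => max_le ((neg_le_abs _).trans (a2 t)) (norm_nonneg _))
  have hsplit : conv κ f = ((conv κ fun t => (f₁ t : ℂ)) - (conv κ fun t => (f₂ t : ℂ))) +
      Complex.I • ((conv κ fun t => (f₃ t : ℂ)) - (conv κ fun t => (f₄ t : ℂ))) := by
    ext x
    simp only [Pi.add_apply, Pi.sub_apply, Pi.smul_apply, smul_eq_mul, conv]
    rw [← integral_sub (j₁ x) (j₂ x), ← integral_sub (j₃ x) (j₄ x), ← integral_const_mul,
      ← integral_add (by exact (j₁ x).sub (j₂ x)) (by exact ((j₃ x).sub (j₄ x)).const_mul _)]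
    congr 1
    ext y
    have e : ∀ r : ℝ, ((max r 0 : ℝ) : ℂ) - ((max (-r) 0 : ℝ) : ℂ) = r := by
      intro r
      rw [← Complex.ofReal_sub]
      congr 1
      rcases le_total 0 r with hr | hr
      · rw [max_eq_left hr, max_eq_right (by linarith), sub_zero]
      · rw [max_eq_right hr, max_eq_left (by linarith)]; ring
    calc κ y * f (x - y) = κ y * (((f (x - y)).re : ℂ) + (f (x - y)).im * Complex.I) := by
          rw [Complex.re_add_im]
      _ = _ := by rw [← e (f (x - y)).re, ← e (f (x - y)).im]; ring
  have hp1 := one_le_ofReal hp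
  rw [hsplit]
  refine (eLpNorm_add_le (m₁.sub m₂) ((m₃.sub m₄).const_smul _) hp1).trans ?_
  rw [eLpNorm_const_smul]
  have hI : ‖Complex.I‖ₑ = 1 := by rw [← ofReal_norm]; simp
  rw [hI, one_mul]
  calc _ ≤ (_ + _) + (_ + _) :=
        add_le_add ((eLpNorm_sub_le m₁ m₂ hp1).trans (add_le_add b₁ b₂))
          ((eLpNorm_sub_le m₃ m₄ hp1).trans (add_le_add b₃ b₄))
    _ = _ := by push_cast; ring

/-- Duality: a bound for the reflected kernel on `L^{p'}` gives one for the kernel on `L^p`. -/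
lemma ConvBound.dual {κ κ' : ℝ → ℂ} (hκ : Integrable κ) (hκ' : ∀ x, κ' x = κ (-x)) {p q : ℝ}
    (hpq : p.HolderConjugate q) {C : ℝ≥0∞} (h : ConvBound κ' q C) (hp2 : 2 ≤ p) :
    ConvBound κ p C := by
  have hp0 : 0 < p := by linarith
  have hq0 : 0 < q := hpq.symm.pos
  -- it suffices to treat integrable functions
  have hint : ∀ f : ℝ → ℂ, Measurable f → (∃ M, ∀ x, ‖f x‖ ≤ M) → Integrable f →
      eLpNorm (conv κ f) (ENNReal.ofReal p) volume ≤ C * eLpNorm f (ENNReal.ofReal p) volume := by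
    rintro f hf ⟨M, hM⟩ hfi
    set g := conv κ f with hg
    have hgm : Measurable g := measurable_conv hκ hf
    have hgi : Integrable g := integrable_conv_ker hκ hfi
    have hgb : ∀ x, ‖g x‖ ≤ (∫ y, ‖κ y‖) * M := norm_conv_le hκ hM
    set N := (∫ y, ‖κ y‖) * M with hN
    -- the extremal function of the pairing, `g k = ‖g‖ ^ p` and `‖k‖ ^ q = ‖g‖ ^ p`
    set k : ℝ → ℂ := fun x => (starRingEnd ℂ) (g x) * ((‖g x‖ ^ (p - 2) : ℝ) : ℂ) with hk
    have hkm : Measurable k := by fun_prop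
    have hkn : ∀ x, ‖k x‖ = ‖g x‖ ^ (p - 1) := by
      intro x
      rw [hk]
      simp only [norm_mul, RCLike.norm_conj, Complex.norm_real]
      rw [Real.norm_of_nonneg (by positivity)]
      rcases eq_or_ne ‖g x‖ 0 with h0 | h0
      · rw [h0, zero_mul, Real.zero_rpow (by linarith)]
      · nth_rewrite 1 [← Real.rpow_one ‖g x‖]
        rw [← Real.rpow_add (by positivity)]
        congr 1; ring
    have hN0 : 0 ≤ N := (norm_nonneg _).trans (hgb 0)
    have hkb : ∀ x, ‖k x‖ ≤ N ^ (p - 1) := by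
      intro x; rw [hkn]
      exact Real.rpow_le_rpow (norm_nonneg _) (hgb x) (by linarith)
    have hgk : ∀ x, g x * k x = ((‖g x‖ ^ p : ℝ) : ℂ) := by
      intro x
      have : g x * (starRingEnd ℂ) (g x) = ((‖g x‖ ^ 2 : ℝ) : ℂ) := by
        rw [Complex.mul_conj, Complex.normSq_eq_norm_sq]
      rw [hk]
      simp only
      rw [← mul_assoc, this, ← Complex.ofReal_mul]
      congr 1
      rcases eq_or_ne ‖g x‖ 0 with h0 | h0
      · rw [h0, Real.zero_rpow hp0.ne']; simp
      · rw [← Real.rpow_natCast, ← Real.rpow_add (by positivity)]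
        congr 1; push_cast; ring
    have hkq : ∫⁻ x, ‖k x‖ₑ ^ q = ∫⁻ x, ‖g x‖ₑ ^ p := by
      refine lintegral_congr fun x => ?_
      rw [← ofReal_norm, hkn, ← ENNReal.ofReal_rpow_of_nonneg (norm_nonneg _) (by linarith),
        ofReal_norm, ← ENNReal.rpow_mul, hpq.sub_one_mul_conj]
    have hgp : Integrable fun x => ‖g x‖ ^ p := by
      have : ∀ x, ‖g x‖ ^ p = ‖g x‖ * ‖k x‖ := by
        intro x
        rw [← norm_mul, hgk, Complex.norm_real, Real.norm_of_nonneg (by positivity)]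
      simp_rw [this]
      exact hgi.norm.mul_bdd (c := N ^ (p - 1)) hkm.norm.aestronglyMeasurable
        (Eventually.of_forall fun x => by rw [norm_norm]; exact hkb x)
    -- finiteness, needed to divide by a power of this integral in the end
    have hfin : ∫⁻ x, ‖g x‖ₑ ^ p ≠ ∞ := by
      have := hgp.lintegral_lt_top.ne
      convert this using 2 with x
      ext x
      rw [← ofReal_norm, ENNReal.ofReal_rpow_of_nonneg (norm_nonneg _) hp0.le]
    -- the duality pairing
    have hpair : ∫ x, g x * k x = ∫ t, f t * conv κ' k t := by
      have e1 : ∀ x, g x * k x = ∫ t, κ (x - t) * f t * k x := by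
        intro x
        rw [integral_mul_const]
        congr 1
        rw [hg, conv, ← integral_sub_left_eq_self _ volume x]
        simp
      have e2 : ∀ t, f t * conv κ' k t = ∫ x, κ (x - t) * f t * k x := by
        intro t
        rw [conv, ← integral_const_mul, ← integral_sub_left_eq_self _ volume t]
        congr 1; ext x
        rw [hκ']
        simp only [neg_sub, sub_sub_cancel]
        ring
      simp_rw [e1, e2]
      rw [integral_integral_swap]
      have h1 := hfi.convolution_integrand (ContinuousLinearMap.mul ℂ ℂ) hκ
      refine (h1.mul_bdd (c := N ^ (p - 1)) (g := fun z : ℝ × ℝ => k z.1)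
        (hkm.comp measurable_fst).aestronglyMeasurable (Eventually.of_forall fun z => hkb _)).congr ?_
      refine Eventually.of_forall fun z => ?_
      simp [Function.uncurry, mul_comm]
    have hle : ∫⁻ x, ‖g x‖ₑ ^ p ≤ ∫⁻ t, ‖f t‖ₑ * ‖conv κ' k t‖ₑ := by
      calc ∫⁻ x, ‖g x‖ₑ ^ p = ENNReal.ofReal (∫ x, ‖g x‖ ^ p) := by
            rw [ofReal_integral_eq_lintegral_ofReal hgp
              (Eventually.of_forall fun x => by positivity)]
            refine lintegral_congr fun x => ?_
            rw [← ofReal_norm, ENNReal.ofReal_rpow_of_nonneg (norm_nonneg _) hp0.le]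
        _ = ‖∫ x, g x * k x‖ₑ := by
            simp_rw [hgk]
            rw [integral_complex_ofReal, ← ofReal_norm, Complex.norm_real,
              Real.norm_of_nonneg (integral_nonneg fun x => by positivity)]
        _ ≤ _ := by
            rw [hpair]
            refine (enorm_integral_le_lintegral_enorm _).trans (le_of_eq ?_)
            simp [enorm_mul]
    have hκ'i : Integrable κ' := by
      have : κ' = fun x => κ (-x) := funext hκ'
      rw [this]; exact hκ.comp_neg
    have hhol := ENNReal.lintegral_mul_le_Lp_mul_Lq (volume : Measure ℝ) hpq
      (f := fun t => ‖f t‖ₑ) (g := fun t => ‖conv κ' k t‖ₑ) hf.enorm.aemeasurable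
      (measurable_conv hκ'i hkm).enorm.aemeasurable
    have hdual := h k hkm ⟨_, hkb⟩
    rw [eLpNorm_ofReal_eq hq0, eLpNorm_ofReal_eq hq0, hkq] at hdual
    rw [eLpNorm_ofReal_eq hp0, eLpNorm_ofReal_eq hp0]
    set S := ∫⁻ x, ‖g x‖ₑ ^ p with hS
    have hfinal : S ≤ (∫⁻ t, ‖f t‖ₑ ^ p) ^ (1 / p) * (C * S ^ (1 / q)) := by
      refine hle.trans (hhol.trans ?_)
      gcongr
    rcases eq_or_ne S 0 with h0 | h0
    · rw [h0, ENNReal.zero_rpow_of_pos (by positivity)]; exact bot_le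
    have e : S = S ^ (1 / p) * S ^ (1 / q) := by
      rw [← ENNReal.rpow_add _ _ h0 hfin, one_div, one_div, hpq.inv_add_inv_eq_one,
        ENNReal.rpow_one]
    have hSq0 : S ^ (1 / q) ≠ 0 := by
      rw [Ne, ENNReal.rpow_eq_zero_iff]
      rintro (⟨a, _⟩ | ⟨a, _⟩)
      exacts [h0 a, hfin a]
    have hSqt : S ^ (1 / q) ≠ ∞ := ENNReal.rpow_ne_top_of_nonneg (by positivity) hfin
    rw [← ENNReal.mul_le_mul_iff_left hSq0 hSqt, ← e]
    refine hfinal.trans (le_of_eq (by ring))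
  rintro f hf ⟨M, hM⟩
  set F : ℕ → ℝ → ℂ := fun n => (Set.Icc (-n : ℝ) n).indicator f with hF
  have hFm : ∀ n, Measurable (F n) := fun n => hf.indicator measurableSet_Icc
  have hFf : ∀ n t, ‖F n t‖ ≤ ‖f t‖ := fun n t => norm_indicator_le_norm_self _ _
  refine eLpNorm_le_of_tendsto (l := atTop) (g := fun n => conv κ (F n)) ?_ ?_ ?_
  · exact Eventually.of_forall fun n => (measurable_conv hκ (hFm n)).aestronglyMeasurable
  · refine Eventually.of_forall fun n =>
      (hint (F n) (hFm n) ⟨M, fun t => (hFf n t).trans (hM t)⟩ ?_).trans ?_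
    · rw [hF]
      simp only
      rw [integrable_indicator_iff measurableSet_Icc]
      exact Measure.integrableOn_of_bounded (M := M) (by simp) hf.aestronglyMeasurable
        (Eventually.of_forall hM)
    · gcongr
      exact eLpNorm_mono fun t => hFf n t
  · refine tendsto_conv hκ hFm (fun n t => (hFf n t).trans (hM t)) fun t => ?_
    refine tendsto_const_nhds.congr' ?_
    obtain ⟨N, hN⟩ := exists_nat_ge |t|
    filter_upwards [eventually_ge_atTop N] with n hn
    have : t ∈ Set.Icc (-n : ℝ) n := by
      have : |t| ≤ n := hN.trans (by exact_mod_cast hn)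
      exact abs_le.1 this
    simp [hF, this]

/-- **M. Riesz' theorem** for the one-dimensional kernels: their norms on `L^p`, `1 < p < ∞`, are
bounded uniformly in the parameters. -/
theorem exists_lineKernel_convBound {p : ℝ} (hp : 1 < p) :
    ∃ C : ℝ≥0, ∀ y₁ y₂ : ℝ, 0 < y₁ → 0 < y₂ → ConvBound (lineKernel y₁ y₂) p C := by
  have hle : ∀ p : ℝ, 1 < p → p ≤ 2 →
      ∃ C : ℝ≥0, ∀ y₁ y₂ : ℝ, 0 < y₁ → 0 < y₂ → ConvBound (lineKernel y₁ y₂) p C := by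
    intro p hp hp2
    obtain ⟨C, hC⟩ := exists_lineKernel_bound_nonneg hp hp2
    exact ⟨4 * C, fun y₁ y₂ h₁ h₂ =>
      ConvBound.of_nonneg (integrable_lineKernel h₁ h₂) hp (hC y₁ y₂ h₁ h₂)⟩
  rcases le_total p 2 with hp2 | hp2
  · exact hle p hp hp2
  · have hpq : p.HolderConjugate (p / (p - 1)) := Real.HolderConjugate.conjExponent hp
    have hq2 : p / (p - 1) ≤ 2 := by rw [div_le_iff₀ (by linarith)]; linarith
    obtain ⟨C, hC⟩ := hle _ hpq.symm.lt hq2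
    -- reflecting the kernel interchanges `y₁` and `y₂`
    refine ⟨C, fun y₁ y₂ h₁ h₂ => ConvBound.dual (integrable_lineKernel h₁ h₂) (fun x => ?_) hpq
      (hC y₂ y₁ h₂ h₁) hp2⟩
    simp only [lineKernel]
    push_cast
    rw [mul_neg, sub_neg_eq_add, ← sub_eq_add_neg, add_comm]

/-! ### Tensor products of kernels -/

section Tensor

variable {G H : Type*} [AddCommGroup G] [MeasureSpace G] [MeasurableAdd₂ G] [MeasurableNeg G]
  [SFinite (volume : Measure G)] [AddCommGroup H] [MeasureSpace H] [MeasurableAdd₂ H]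
  [MeasurableNeg H] [SFinite (volume : Measure H)]

instance measurableAdd₂_prod {G H : Type*} [Add G] [MeasurableSpace G] [MeasurableAdd₂ G] [Add H]
    [MeasurableSpace H] [MeasurableAdd₂ H] : MeasurableAdd₂ (G × H) :=
  ⟨((measurable_fst.comp measurable_fst).add (measurable_fst.comp measurable_snd)).prodMk
    ((measurable_snd.comp measurable_fst).add (measurable_snd.comp measurable_snd))⟩

instance measurableNeg_prod {G H : Type*} [Neg G] [MeasurableSpace G] [MeasurableNeg G] [Neg H]
    [MeasurableSpace H] [MeasurableNeg H] : MeasurableNeg (G × H) :=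
  ⟨measurable_fst.neg.prodMk measurable_snd.neg⟩

lemma ConvBound.prod {κ : G → ℂ} {κ' : H → ℂ} (hκ : Integrable κ) (hκ' : Integrable κ')
    (mκ' : Measurable κ') {p : ℝ} (hp : 0 < p) {C C' : ℝ≥0∞} (h : ConvBound κ p C)
    (h' : ConvBound κ' p C') : ConvBound (fun z : G × H => κ z.1 * κ' z.2) p (C * C') := by
  rintro f hf ⟨M, hM⟩
  set g : G → H → ℂ := fun x w => conv κ' (fun s => f (x, s)) w with hg
  have hgm : Measurable (Function.uncurry g) := by
    have hm : StronglyMeasurable (Function.uncurry fun (z : G × H) (s : H) =>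
        κ' s * f (z.1, z.2 - s)) := by
      apply Measurable.stronglyMeasurable
      exact (mκ'.comp measurable_snd).mul (hf.comp (by fun_prop))
    exact hm.integral_prod_right.measurable
  have hgb : ∀ x w, ‖g x w‖ ≤ (∫ y, ‖κ' y‖) * M := fun x w =>
    norm_conv_le (f := fun s => f (x, s)) hκ' (fun s => hM _) w
  have hconv : ∀ z : G × H, conv (fun z : G × H => κ z.1 * κ' z.2) f z =
      conv κ (fun x => g x z.2) z.1 := by
    intro z
    have hi : Integrable (fun y : G × H => κ y.1 * κ' y.2 * f (z - y)) (volume.prod volume) :=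
      integrable_conv (G := G × H) (hκ.mul_prod hκ') hf hM z
    calc conv (fun z : G × H => κ z.1 * κ' z.2) f z
        = ∫ y : G × H, κ y.1 * κ' y.2 * f (z - y) ∂(volume.prod volume) := rfl
      _ = ∫ x, ∫ s, κ x * κ' s * f (z - (x, s)) := integral_prod _ hi
      _ = _ := by
          rw [conv]
          congr 1; ext x
          rw [hg]
          simp only [conv]
          rw [← integral_const_mul]
          congr 1; ext s
          rw [mul_assoc]
          rfl
  have hgw : ∀ w, Measurable fun x => g x w := fun w => hgm.comp measurable_prodMk_right
  have step1 : ∀ w, ∫⁻ x, ‖conv κ (fun x => g x w) x‖ₑ ^ p ≤ C ^ p * ∫⁻ x, ‖g x w‖ₑ ^ p := by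
    intro w
    have := ENNReal.rpow_le_rpow (h (fun x => g x w) (hgw w) ⟨_, fun x => hgb x w⟩) hp.le
    rwa [ENNReal.mul_rpow_of_nonneg _ _ hp.le, eLpNorm_ofReal_rpow hp, eLpNorm_ofReal_rpow hp]
      at this
  have step2 : ∀ x, ∫⁻ w, ‖g x w‖ₑ ^ p ≤ C' ^ p * ∫⁻ w, ‖f (x, w)‖ₑ ^ p := by
    intro x
    have := ENNReal.rpow_le_rpow (h' (fun s => f (x, s)) (hf.comp measurable_prodMk_left)
      ⟨M, fun s => hM _⟩) hp.le
    rwa [ENNReal.mul_rpow_of_nonneg _ _ hp.le, eLpNorm_ofReal_rpow hp, eLpNorm_ofReal_rpow hp]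
      at this
  have hmconv : Measurable (conv (fun z : G × H => κ z.1 * κ' z.2) f) :=
    measurable_conv (G := G × H) (hκ.mul_prod hκ') hf
  have hmain : ∫⁻ z : G × H, ‖conv (fun z : G × H => κ z.1 * κ' z.2) f z‖ₑ ^ p ≤
      (C * C') ^ p * ∫⁻ z : G × H, ‖f z‖ₑ ^ p := by
    calc ∫⁻ z : G × H, ‖conv (fun z : G × H => κ z.1 * κ' z.2) f z‖ₑ ^ p
        = ∫⁻ w, ∫⁻ x, ‖conv (fun z : G × H => κ z.1 * κ' z.2) f (x, w)‖ₑ ^ p := by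
          rw [Measure.volume_eq_prod]
          exact lintegral_prod_symm _ (hmconv.enorm.pow_const _).aemeasurable
      _ ≤ ∫⁻ w, C ^ p * ∫⁻ x, ‖g x w‖ₑ ^ p := by
          refine lintegral_mono fun w => ?_
          simp only [hconv]
          exact step1 w
      _ = C ^ p * ∫⁻ x, ∫⁻ w, ‖g x w‖ₑ ^ p := by
          rw [lintegral_const_mul]
          · rw [lintegral_lintegral_swap]
            exact ((hgm.comp measurable_swap).enorm.pow_const _).aemeasurable
          · exact Measurable.lintegral_prod_left' (f := fun z : G × H => ‖g z.1 z.2‖ₑ ^ p)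
              (hgm.enorm.pow_const _)
      _ ≤ C ^ p * ∫⁻ x, C' ^ p * ∫⁻ w, ‖f (x, w)‖ₑ ^ p := by
          gcongr with x
          exact step2 x
      _ = _ := by
          rw [lintegral_const_mul, ENNReal.mul_rpow_of_nonneg _ _ hp.le, mul_assoc,
            Measure.volume_eq_prod, lintegral_prod _ (hf.enorm.pow_const _).aemeasurable]
          exact Measurable.lintegral_prod_right' (f := fun z : G × H => ‖f z‖ₑ ^ p)
            (hf.enorm.pow_const _)
  rw [eLpNorm_ofReal_eq hp, eLpNorm_ofReal_eq hp]
  refine (ENNReal.rpow_le_rpow hmain (by positivity : 0 ≤ 1 / p)).trans (le_of_eq ?_)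
  rw [ENNReal.mul_rpow_of_nonneg _ _ (by positivity), ← ENNReal.rpow_mul,
    mul_one_div_cancel hp.ne', ENNReal.rpow_one]

lemma ConvBound.comp_equiv (e : G ≃ᵐ H) (he : MeasurePreserving e volume volume)
    (hsub : ∀ x y, e (x - y) = e x - e y) {κ : H → ℂ} (hκ : Integrable κ) {p : ℝ} {C : ℝ≥0∞}
    (h : ConvBound κ p C) : ConvBound (fun x => κ (e x)) p C := by
  rintro f hf ⟨M, hM⟩
  have hfe : Measurable fun z => f (e.symm z) := hf.comp e.symm.measurable
  have hconv : conv (fun x => κ (e x)) f = (conv κ fun z => f (e.symm z)) ∘ e := by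
    ext x
    simp only [conv, Function.comp]
    rw [← he.integral_comp e.measurableEmbedding]
    congr 1; ext y
    rw [← hsub, e.symm_apply_apply]
  rw [hconv, eLpNorm_comp_measurePreserving (measurable_conv hκ hfe).aestronglyMeasurable he]
  refine (h _ hfe ⟨M, fun z => hM _⟩).trans (le_of_eq ?_)
  congr 1
  exact eLpNorm_comp_measurePreserving hf.aestronglyMeasurable (he.symm e)

end Tensor

/-- The symbol `∏ᵢ σᵢ(ξᵢ)` with `σᵢ` the one-dimensional symbol `lineSymbol (y₁ i) (y₂ i)`. -/
def prodSymbol {d : ℕ} (y₁ y₂ : Fin d → ℝ) (ν : RSpace d) : ℂ :=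
  ∏ i, lineSymbol (y₁ i) (y₂ i) (ν i)

/-- The kernel of the multiplier with symbol `prodSymbol`. -/
def prodKernel {d : ℕ} (y₁ y₂ : Fin d → ℝ) (x : RSpace d) : ℂ :=
  ∏ i, lineKernel (y₁ i) (y₂ i) (x i)

lemma exists_equiv_succ (n : ℕ) : ∃ e : (Fin (n + 1) → ℝ) ≃ᵐ ℝ × (Fin n → ℝ),
    MeasurePreserving e volume volume ∧ ∀ x, e x = (x 0, fun i => x i.succ) :=
  ⟨MeasurableEquiv.piFinSuccAbove (fun _ : Fin (n + 1) => ℝ) 0,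
    volume_preserving_piFinSuccAbove (fun _ : Fin (n + 1) => ℝ) 0, fun _ => rfl⟩

lemma convBound_pi {p : ℝ} (hp : 0 < p) {C : ℝ≥0} (n : ℕ) (κ : Fin n → ℝ → ℂ)
    (hκ : ∀ i, Integrable (κ i)) (hc : ∀ i, Continuous (κ i)) (h : ∀ i, ConvBound (κ i) p C) :
    ConvBound (fun x : Fin n → ℝ => ∏ i, κ i (x i)) p (C ^ n) := by
  induction n with
  | zero =>
    rintro f hf -
    refine le_of_eq ?_
    rw [pow_zero, one_mul]
    congr 1
    ext x
    rw [conv]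
    have : ∀ y : Fin 0 → ℝ, (∏ i, κ i (y i)) * f (x - y) = f x := by
      intro y
      rw [Subsingleton.elim (x - y) x]; simp
    simp_rw [this]
    rw [Measure.volume_pi_eq_dirac (x := (fun i => i.elim0 : Fin 0 → ℝ))]
    simp
  | succ n ih =>
    have hi : Integrable (fun x : Fin n → ℝ => ∏ i, κ i.succ (x i)) :=
      Integrable.fintype_prod fun i => hκ i.succ
    have hm : Measurable (fun x : Fin n → ℝ => ∏ i, κ i.succ (x i)) := Continuous.measurable
      (continuous_finsetProd _ fun i _ => (hc i.succ).comp (continuous_apply i))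
    have hn := ih (fun i => κ i.succ) (fun i => hκ _) (fun i => hc _) fun i => h _
    have hprod := ConvBound.prod (G := ℝ) (H := Fin n → ℝ) (hκ 0) hi hm hp (h 0) hn
    have hint : Integrable (fun z : ℝ × (Fin n → ℝ) => κ 0 z.1 * ∏ i, κ i.succ (z.2 i)) :=
      (hκ 0).mul_prod hi
    obtain ⟨e, he, hx⟩ := exists_equiv_succ n
    have := ConvBound.comp_equiv (G := Fin (n + 1) → ℝ) (H := ℝ × (Fin n → ℝ))
      (κ := fun z : ℝ × (Fin n → ℝ) => κ 0 z.1 * ∏ i, κ i.succ (z.2 i))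
      e he (fun x y => by simp only [hx]; rfl) hint hprod
    rw [pow_succ']
    convert this using 2 with x
    rw [Fin.prod_univ_succ, hx]

section ProdKernel

variable {d : ℕ} {y₁ y₂ : Fin d → ℝ}

lemma continuous_prodKernel (h₁ : ∀ i, 0 < y₁ i) (h₂ : ∀ i, 0 < y₂ i) :
    Continuous (prodKernel y₁ y₂) :=
  continuous_finsetProd _ fun i _ => (continuous_lineKernel (h₁ i) (h₂ i)).comp (by fun_prop)

lemma integrable_prodKernel (h₁ : ∀ i, 0 < y₁ i) (h₂ : ∀ i, 0 < y₂ i) :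
    Integrable (prodKernel y₁ y₂) := by
  have h : Integrable (fun x : Fin d → ℝ => ∏ i, lineKernel (y₁ i) (y₂ i) (x i)) :=
    Integrable.fintype_prod fun i => integrable_lineKernel (h₁ i) (h₂ i)
  exact ((PiLp.volume_preserving_ofLp (Fin d)).integrable_comp_emb
    (MeasurableEquiv.toLp 2 (Fin d → ℝ)).symm.measurableEmbedding).2 h

lemma prodKernel_convBound {p : ℝ} (hp : 0 < p) {C : ℝ≥0}
    (hC : ∀ y₁ y₂ : ℝ, 0 < y₁ → 0 < y₂ → ConvBound (lineKernel y₁ y₂) p C)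
    (h₁ : ∀ i, 0 < y₁ i) (h₂ : ∀ i, 0 < y₂ i) :
    ConvBound (prodKernel y₁ y₂) p (C ^ d) := by
  have h := convBound_pi hp d (fun i => lineKernel (y₁ i) (y₂ i))
    (fun i => integrable_lineKernel (h₁ i) (h₂ i)) (fun i => continuous_lineKernel (h₁ i) (h₂ i))
    fun i => hC _ _ (h₁ i) (h₂ i)
  exact ConvBound.comp_equiv (MeasurableEquiv.toLp 2 (Fin d → ℝ)).symm
    (PiLp.volume_preserving_ofLp (Fin d)) (fun x y => rfl)
    (Integrable.fintype_prod fun i => integrable_lineKernel (h₁ i) (h₂ i)) h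

lemma fourier_prodKernel (h₁ : ∀ i, 0 < y₁ i) (h₂ : ∀ i, 0 < y₂ i) :
    𝓕 (prodKernel y₁ y₂) = prodSymbol y₁ y₂ := by
  ext ν
  rw [fourier_eq_integral_mul, prodSymbol]
  have e : ∀ x : RSpace d, (Real.fourierChar (-inner ℝ x ν) : ℂ) * prodKernel y₁ y₂ x =
      ∏ i, ((Real.fourierChar (-inner ℝ (x i) (ν i)) : ℂ) * lineKernel (y₁ i) (y₂ i) (x i)) := by
    intro x
    rw [Finset.prod_mul_distrib, prodKernel]
    congr 1
    rw [PiLp.inner_apply, ← Finset.sum_neg_distrib]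
    simp only [fourierChar_eq_exp, ← Complex.exp_sum]
    congr 1
    push_cast
    rw [Finset.mul_sum, Finset.sum_mul]
  simp_rw [e]
  rw [(PiLp.volume_preserving_ofLp (Fin d)).integral_comp
    (MeasurableEquiv.toLp 2 (Fin d → ℝ)).symm.measurableEmbedding (fun x : Fin d → ℝ =>
      ∏ i, ((Real.fourierChar (-inner ℝ (x i) (ν i)) : ℂ) * lineKernel (y₁ i) (y₂ i) (x i)))]
  rw [integral_fintype_prod_volume_eq_prod (f := fun i (t : ℝ) =>
    ((Real.fourierChar (-inner ℝ t (ν i)) : ℂ) * lineKernel (y₁ i) (y₂ i) t))]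
  refine Finset.prod_congr rfl fun i _ => ?_
  rw [← fourier_eq_integral_mul, fourier_lineKernel (h₁ i) (h₂ i)]

lemma prodSymbol_zero : prodSymbol y₁ y₂ 0 = 1 := by
  simp [prodSymbol, lineSymbol]

lemma integral_prodKernel (h₁ : ∀ i, 0 < y₁ i) (h₂ : ∀ i, 0 < y₂ i) :
    ∫ x, prodKernel y₁ y₂ x = 1 := by
  have h := congrFun (fourier_prodKernel h₁ h₂) 0
  rw [fourier_eq_integral_mul, prodSymbol_zero] at h
  simpa using h

lemma lintegral_prodKernel_self {y : Fin d → ℝ} (hy : ∀ i, 0 < y i) :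
    ∫⁻ x, ‖prodKernel y y x‖ₑ = 1 := by
  rw [← ofReal_integral_norm_eq_lintegral_enorm (integrable_prodKernel hy hy)]
  have h : ((∫ x, ‖prodKernel y y x‖ : ℝ) : ℂ) = 1 := by
    rw [← integral_complex_ofReal, ← integral_prodKernel hy hy]
    congr 1; ext x
    rw [prodKernel, norm_prod]
    push_cast
    exact Finset.prod_congr rfl fun i _ => norm_lineKernel_self (hy i) _
  have h' : (∫ x, ‖prodKernel y y x‖ : ℝ) = 1 := by exact_mod_cast h
  rw [h', ENNReal.ofReal_one]

/-- The Poisson kernels are an approximate identity. -/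
lemma tendsto_conv_prodKernel {f : RSpace d → ℂ} (hf : IsBddCont f) (x : RSpace d) :
    Tendsto (fun y : ℝ => conv (prodKernel (fun _ => y) (fun _ => y)) f x) (𝓝[>] 0)
      (𝓝 (f x)) := by
  obtain ⟨hf, M, hM⟩ := hf
  set K : RSpace d → ℂ := prodKernel (fun _ => 1) (fun _ => 1) with hK
  have hKi : Integrable K := integrable_prodKernel (fun _ => one_pos) (fun _ => one_pos)
  have hscale : ∀ y : ℝ, 0 < y → conv (prodKernel (fun _ => y) (fun _ => y)) f x =
      ∫ u, K u * f (x - y • u) := by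
    intro y hy
    have e1 : ∀ t : RSpace d, prodKernel (fun _ => y) (fun _ => y) t =
        ((y ^ d)⁻¹ : ℝ) * K (y⁻¹ • t) := by
      intro t
      rw [hK, prodKernel, prodKernel]
      have e2 : ∀ i, lineKernel y y (t i) = (y⁻¹ : ℝ) * lineKernel 1 1 ((y⁻¹ • t) i) := by
        intro i
        rw [lineKernel_self hy, lineKernel_self one_pos, ← Complex.ofReal_mul]
        congr 1
        simp only [PiLp.smul_apply, smul_eq_mul]
        have := Real.pi_pos
        field_simp
      simp_rw [e2]
      rw [Finset.prod_mul_distrib]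
      simp
    have h := Measure.integral_comp_smul (volume : Measure (RSpace d))
      (fun u => K u * f (x - y • u)) y⁻¹
    rw [conv]
    simp_rw [e1, mul_assoc]
    rw [integral_const_mul]
    have e3 : ∀ t : RSpace d, K (y⁻¹ • t) * f (x - t) =
        K (y⁻¹ • t) * f (x - y • (y⁻¹ • t)) := by
      intro t; rw [smul_inv_smul₀ hy.ne']
    simp_rw [e3]
    rw [h]
    simp only [finrank_euclideanSpace, Fintype.card_fin]
    rw [abs_of_pos (by positivity), Complex.real_smul, ← mul_assoc, ← Complex.ofReal_mul]
    have : (y ^ d)⁻¹ * (y⁻¹ ^ d)⁻¹ = 1 := by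
      rw [inv_pow, inv_inv, inv_mul_cancel₀ (by positivity)]
    rw [this]; simp
  have hlim : Tendsto (fun y : ℝ => ∫ u, K u * f (x - y • u)) (𝓝[>] 0) (𝓝 (∫ u, K u * f x)) := by
    refine tendsto_integral_filter_of_dominated_convergence (fun u => ‖K u‖ * M) ?_ ?_
      (hKi.norm.mul_const M) ?_
    · refine Eventually.of_forall fun y => hKi.1.mul ?_
      exact (by fun_prop : Continuous fun u : RSpace d => f (x - y • u)).aestronglyMeasurable
    · refine Eventually.of_forall fun y => Eventually.of_forall fun u => ?_
      rw [norm_mul]; gcongr; exact hM _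
    · refine Eventually.of_forall fun u => Tendsto.const_mul _ ?_
      have : Tendsto (fun y : ℝ => f (x - y • u)) (𝓝 0) (𝓝 (f (x - (0 : ℝ) • u))) :=
        (by fun_prop : Continuous fun y : ℝ => f (x - y • u)).tendsto 0
      simpa using this.mono_left nhdsWithin_le_nhds
  rw [integral_mul_const, hK, integral_prodKernel (fun _ => one_pos) (fun _ => one_pos),
    one_mul] at hlim
  refine hlim.congr' ?_
  filter_upwards [self_mem_nhdsWithin] with y hy
  exact (hscale y hy).symm

end ProdKernel

/-! ### The Gevrey symbol -/

section Gevrey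

variable {d : ℕ}

/-- The symbol `e^{α|ξ|₁}`, `ξ = 2πν`. -/
def gevreySymbol (α : ℝ) (ν : RSpace d) : ℂ :=
  ((Real.exp (α * ∑ i, |2 * Real.pi * ν i|) : ℝ) : ℂ)

/-- The exponential `e^{α ε·ξ}`, `ξ = 2πν`, for a vector of signs `ε ∈ {-1, 0, 1}^d`. -/
def signExp (α : ℝ) (ε : Fin d → SignType) (ν : RSpace d) : ℂ :=
  ((Real.exp (α * ∑ i, (ε i : ℝ) * (2 * Real.pi * ν i)) : ℝ) : ℂ)

/-- The exponents of the Poisson factor `∏_{εᵢ = 0} e^{-α|ξᵢ|}`. -/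
def signDamp (α : ℝ) (ε : Fin d → SignType) (i : Fin d) : ℝ := if ε i = 0 then α else 0

/-- The sign of the term with index `ε` in `gevreySymbol_eq_sum`. -/
def signCoeff (ε : Fin d → SignType) : ℂ := ∏ i, if ε i = 0 then -1 else 1

lemma lineSymbol_self (c ν : ℝ) :
    lineSymbol c c ν = ((Real.exp (-(c * |2 * Real.pi * ν|)) : ℝ) : ℂ) := by
  rw [lineSymbol]
  congr 2
  rcases le_total 0 (2 * Real.pi * ν) with h | h
  · rw [max_eq_left h, max_eq_right (by linarith), abs_of_nonneg h]; ring
  · rw [max_eq_right h, max_eq_left (by linarith), abs_of_nonpos h]; ring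

lemma signExp_add (α : ℝ) (ε : Fin d → SignType) (ξ η : RSpace d) :
    signExp α ε (ξ + η) = signExp α ε ξ * signExp α ε η := by
  simp only [signExp, ← Complex.ofReal_mul, ← Real.exp_add, ← mul_add, ← Finset.sum_add_distrib]
  rfl

/-- The tensor product of the identities `e^{|x|} = e^x + e^{-x} - e^{-|x|}`. The exponentials of
linear forms are multiplicative in `ξ + η`, and the remaining factors are Poisson kernels. -/
lemma gevreySymbol_eq_sum (α : ℝ) (ν : RSpace d) :
    gevreySymbol α ν = ∑ ε : Fin d → SignType, signCoeff ε *
      (prodSymbol (signDamp α ε) (signDamp α ε) ν * signExp α ε ν) := by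
  have h1 : ∀ x : ℝ, ((Real.exp (α * |x|) : ℝ) : ℂ) = ∑ ε : SignType,
      ((if ε = 0 then -1 else 1 : ℂ) * (((Real.exp (-((if ε = 0 then α else 0) * |x|)) : ℝ) : ℂ) *
        ((Real.exp (α * ((ε : ℝ) * x)) : ℝ) : ℂ))) := by
    intro x
    have hu : (Finset.univ : Finset SignType) = {0, -1, 1} := rfl
    rw [hu, Finset.sum_insert (by decide), Finset.sum_insert (by decide), Finset.sum_singleton]
    norm_cast
    rcases le_total 0 x with h | h
    · rw [abs_of_nonneg h]; simp
    · rw [abs_of_nonpos h]; simp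
  have h2 : gevreySymbol α ν = ∏ i, ((Real.exp (α * |2 * Real.pi * ν i|) : ℝ) : ℂ) := by
    rw [gevreySymbol, Finset.mul_sum, Real.exp_sum]; push_cast; rfl
  rw [h2]
  simp_rw [h1]
  rw [Fintype.prod_sum]
  refine Finset.sum_congr rfl fun ε _ => ?_
  rw [Finset.prod_mul_distrib, Finset.prod_mul_distrib, signCoeff, prodSymbol, signExp,
    Finset.mul_sum, Real.exp_sum]
  push_cast
  congr 2
  refine Finset.prod_congr rfl fun i _ => ?_
  rw [lineSymbol_self, signDamp]
  push_cast; rfl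

lemma continuous_prodSymbol (y₁ y₂ : Fin d → ℝ) : Continuous (prodSymbol y₁ y₂) :=
  continuous_finsetProd _ fun i _ => (continuous_lineSymbol _ _).comp (by fun_prop)

lemma norm_lineSymbol_le {y₁ y₂ : ℝ} (h₁ : 0 ≤ y₁) (h₂ : 0 ≤ y₂) (ν : ℝ) :
    ‖lineSymbol y₁ y₂ ν‖ ≤ 1 := by
  rw [lineSymbol, Complex.norm_real, Real.norm_of_nonneg (Real.exp_pos _).le, Real.exp_le_one_iff]
  have := mul_nonneg h₁ (le_max_right (2 * Real.pi * ν) 0)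
  have := mul_nonneg h₂ (le_max_right (-(2 * Real.pi * ν)) 0)
  linarith

lemma norm_prodSymbol_le {y₁ y₂ : Fin d → ℝ} (h₁ : ∀ i, 0 ≤ y₁ i) (h₂ : ∀ i, 0 ≤ y₂ i)
    (ν : RSpace d) : ‖prodSymbol y₁ y₂ ν‖ ≤ 1 := by
  rw [prodSymbol, norm_prod]
  exact Finset.prod_le_one (fun i _ => norm_nonneg _) fun i _ => norm_lineSymbol_le (h₁ i) (h₂ i) _

/-- A Poisson factor `e^{-∑ cᵢ|ξᵢ|}` increases neither the `L¹` norm nor the supremum of a kernel. -/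
lemma poisson_symbol {c : Fin d → ℝ} (hc : ∀ i, 0 ≤ c i) {m : RSpace d → ℂ} (hm : IsSymbol m) :
    IsSymbol (fun ν => prodSymbol c c ν * m ν) ∧
      ∫⁻ x, ‖𝓕⁻ (fun ν => prodSymbol c c ν * m ν) x‖ₑ ≤ ∫⁻ x, ‖𝓕⁻ m x‖ₑ ∧
      ∀ R : ℝ≥0∞, (∀ x, ‖𝓕⁻ m x‖ₑ ≤ R) →
        ∀ x, ‖𝓕⁻ (fun ν => prodSymbol c c ν * m ν) x‖ₑ ≤ R := by
  -- for positive exponents the Poisson kernel is integrable of mass one; the others are limits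
  have hpos : ∀ {b : Fin d → ℝ}, (∀ i, 0 < b i) →
      IsSymbol (fun ν => prodSymbol b b ν * m ν) ∧
      ∫⁻ x, ‖𝓕⁻ (fun ν => prodSymbol b b ν * m ν) x‖ₑ ≤ ∫⁻ x, ‖𝓕⁻ m x‖ₑ ∧
      ∀ R : ℝ≥0∞, (∀ x, ‖𝓕⁻ m x‖ₑ ≤ R) →
        ∀ x, ‖𝓕⁻ (fun ν => prodSymbol b b ν * m ν) x‖ₑ ≤ R := by
    intro b hb
    have hk := integrable_prodKernel hb hb
    have e : 𝓕⁻ (fun ν => prodSymbol b b ν * m ν) = conv (prodKernel b b) (𝓕⁻ m) := by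
      rw [conv_fourierInv hk hm.int, fourier_prodKernel hb hb]
    refine ⟨?_, ?_, ?_⟩
    · have := IsSymbol.fourier_mul hk hm
      rwa [fourier_prodKernel hb hb] at this
    · rw [e]
      refine (lintegral_conv_le hk hm.continuous_ker).trans ?_
      rw [lintegral_prodKernel_self hb, one_mul]
    · intro R hR x
      rw [e, conv]
      refine (enorm_integral_le_lintegral_enorm _).trans ?_
      calc ∫⁻ y, ‖prodKernel b b y * 𝓕⁻ m (x - y)‖ₑ
          ≤ ∫⁻ y, ‖prodKernel b b y‖ₑ * R := by
            refine lintegral_mono fun y => ?_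
            rw [enorm_mul]
            gcongr
            exact hR _
        _ = R := by
            rw [lintegral_mul_const _ (continuous_prodKernel hb hb).measurable.enorm,
              lintegral_prodKernel_self hb, one_mul]
  have hcy : ∀ y : ℝ, 0 < y → ∀ i, 0 < c i + y := fun y hy i => add_pos_of_nonneg_of_pos (hc i) hy
  have hlim : ∀ x, Tendsto (fun y : ℝ => 𝓕⁻ (fun ν : RSpace d =>
      prodSymbol (fun i => c i + y) (fun i => c i + y) ν * m ν) x) (𝓝[>] 0)
      (𝓝 (𝓕⁻ (fun ν => prodSymbol c c ν * m ν) x)) := by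
    intro x
    simp only [fourierInv_eq_integral_mul]
    refine tendsto_integral_filter_of_dominated_convergence (fun ν => ‖m ν‖) ?_ ?_ hm.int.norm ?_
    · refine Eventually.of_forall fun y => Continuous.aestronglyMeasurable ?_
      exact (continuous_fourierChar_coe.comp (by fun_prop)).mul
        ((continuous_prodSymbol _ _).mul hm.cont)
    · filter_upwards [self_mem_nhdsWithin] with y hy
      refine Eventually.of_forall fun ν => ?_
      rw [norm_fourierChar_mul, norm_mul]
      exact mul_le_of_le_one_left (norm_nonneg _)
        (norm_prodSymbol_le (fun i => (hcy y hy i).le) (fun i => (hcy y hy i).le) ν)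
    · refine Eventually.of_forall fun ν => ?_
      refine Tendsto.const_mul _ (Tendsto.mul_const _ ?_)
      have hcont : Continuous fun y : ℝ => prodSymbol (fun i => c i + y) (fun i => c i + y) ν := by
        unfold prodSymbol lineSymbol; fun_prop
      have := (hcont.tendsto 0).mono_left (nhdsWithin_le_nhds (s := Set.Ioi 0))
      simpa using this
  have hle : ∫⁻ x, ‖𝓕⁻ (fun ν => prodSymbol c c ν * m ν) x‖ₑ ≤ ∫⁻ x, ‖𝓕⁻ m x‖ₑ := by
    simp_rw [← eLpNorm_one_eq_lintegral_enorm]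
    refine eLpNorm_le_of_tendsto ?_ ?_ hlim
    · filter_upwards [self_mem_nhdsWithin] with y hy
      exact (hpos (hcy y hy)).1.continuous_ker.aestronglyMeasurable
    · filter_upwards [self_mem_nhdsWithin] with y hy
      simp_rw [eLpNorm_one_eq_lintegral_enorm]
      exact (hpos (hcy y hy)).2.1
  have hint : Integrable (fun ν => prodSymbol c c ν * m ν) :=
    hm.int.bdd_mul (c := 1) (continuous_prodSymbol _ _).aestronglyMeasurable
      (Eventually.of_forall fun ν => norm_prodSymbol_le hc hc ν)
  refine ⟨⟨(continuous_prodSymbol _ _).mul hm.cont, hint,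
    (continuous_fourierInv hint).aestronglyMeasurable, hle.trans_lt hm.kerInt.2⟩, hle, ?_⟩
  intro R hR x
  refine le_of_tendsto (hlim x).enorm ?_
  filter_upwards [self_mem_nhdsWithin] with y hy
  exact (hpos (hcy y hy)).2.2 R hR x

lemma isSymbol_of_contDiff {m : RSpace d → ℂ} (hm : ContDiff ℝ (⊤ : ℕ∞) m)
    (hc : HasCompactSupport m) : IsSymbol m :=
  (hc.toSchwartzMap hm).isSymbol

lemma contDiff_signExp (α : ℝ) (ε : Fin d → SignType) :
    ContDiff ℝ (⊤ : ℕ∞) (signExp α ε) := by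
  unfold signExp
  refine Complex.ofRealCLM.contDiff.comp (Real.contDiff_exp.comp ?_)
  fun_prop

lemma isSymbol_mul_signExp {m : 𝓢(RSpace d, ℂ)} (hc : HasCompactSupport m) (α : ℝ)
    (ε : Fin d → SignType) : IsSymbol (fun ν => m ν * signExp α ε ν) :=
  isSymbol_of_contDiff ((m.smooth ⊤).mul (contDiff_signExp α ε)) hc.mul_right

lemma signDamp_nonneg {α : ℝ} (hα : 0 ≤ α) (ε : Fin d → SignType) (i : Fin d) :
    0 ≤ signDamp α ε i := by
  unfold signDamp; split_ifs <;> simp [hα]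

lemma isSymbol_mul_gevreySymbol {m : 𝓢(RSpace d, ℂ)} (hc : HasCompactSupport m) {α : ℝ}
    (hα : 0 ≤ α) : IsSymbol (fun ν => m ν * gevreySymbol α ν) := by
  have h : IsSymbol (fun ν => ∑ ε : Fin d → SignType, signCoeff ε *
      (prodSymbol (signDamp α ε) (signDamp α ε) ν * (m ν * signExp α ε ν))) :=
    IsSymbol.sum _ fun ε _ => IsSymbol.const_mul _
      (poisson_symbol (signDamp_nonneg hα ε) (isSymbol_mul_signExp hc α ε)).1
  convert h using 2 with ν
  rw [gevreySymbol_eq_sum, Finset.mul_sum]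
  exact Finset.sum_congr rfl fun ε _ => by ring

/-- The components `e^{αε·D}` are dominated by `e^{αΛ₁}` in `L^p`, by the boundedness on `L^p` of the
one-dimensional multipliers `lineSymbol`. -/
lemma eLpNorm_signExp_le {p : ℝ} (hp : 0 < p) {C : ℝ≥0}
    (hC : ∀ y₁ y₂ : ℝ, 0 < y₁ → 0 < y₂ → ConvBound (lineKernel y₁ y₂) p C)
    {m : 𝓢(RSpace d, ℂ)} (hc : HasCompactSupport m) {α : ℝ} (hα : 0 ≤ α) (ε : Fin d → SignType)
    {h : RSpace d → ℂ} (hh : IsBddCont h) :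
    eLpNorm (multOp (fun ν => m ν * signExp α ε ν) h) (ENNReal.ofReal p) volume ≤
      (C : ℝ≥0∞) ^ d *
        eLpNorm (multOp (fun ν => m ν * gevreySymbol α ν) h) (ENNReal.ofReal p) volume := by
  set F := multOp (fun ν => m ν * signExp α ε ν) h with hF
  set A := multOp (fun ν => m ν * gevreySymbol α ν) h with hA
  have hsF := isSymbol_mul_signExp hc α ε
  have hsA := isSymbol_mul_gevreySymbol hc hα
  have hFb : IsBddCont F := hh.multOp hsF
  have hAb : IsBddCont A := hh.multOp hsA
  have hε : ∀ i, (-1 : ℝ) ≤ (ε i : ℝ) ∧ (ε i : ℝ) ≤ 1 := by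
    intro i
    cases ε i <;> simp
  -- `ε x - |x| = -(1 - ε) max x 0 - (1 + ε) max (-x) 0`. As `1 - ε` or `1 + ε` may vanish, both sides
  -- are first smoothed with a Poisson kernel of parameter `y`
  have hkey : ∀ y : ℝ, 0 < y → conv (prodKernel (fun _ => y) (fun _ => y)) F =
      conv (prodKernel (fun i => (1 - ε i) * α + y) (fun i => (1 + ε i) * α + y)) A := by
    intro y hy
    have h₁ : ∀ i, 0 < (1 - (ε i : ℝ)) * α + y := fun i =>
      add_pos_of_nonneg_of_pos (mul_nonneg (by linarith [(hε i).2]) hα) hy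
    have h₂ : ∀ i, 0 < (1 + (ε i : ℝ)) * α + y := fun i =>
      add_pos_of_nonneg_of_pos (mul_nonneg (by linarith [(hε i).1]) hα) hy
    rw [hF, hA, conv_multOp (integrable_prodKernel (fun _ => hy) (fun _ => hy)) hsF hh,
      conv_multOp (integrable_prodKernel h₁ h₂) hsA hh, fourier_prodKernel (fun _ => hy)
      (fun _ => hy), fourier_prodKernel h₁ h₂]
    congr 1; ext ν
    have e : prodSymbol (fun _ => y) (fun _ => y) ν * signExp α ε ν =
        prodSymbol (fun i => (1 - ε i) * α + y) (fun i => (1 + ε i) * α + y) ν *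
          gevreySymbol α ν := by
      simp only [prodSymbol, signExp, gevreySymbol, Finset.mul_sum, Real.exp_sum, Complex.ofReal_prod,
        ← Finset.prod_mul_distrib]
      refine Finset.prod_congr rfl fun i _ => ?_
      simp only [lineSymbol, ← Complex.ofReal_mul, ← Real.exp_add]
      congr 2
      set x := 2 * Real.pi * ν i
      rcases le_total 0 x with h | h
      · rw [max_eq_left h, max_eq_right (by linarith), abs_of_nonneg h]; ring
      · rw [max_eq_right h, max_eq_left (by linarith), abs_of_nonpos h]; ring
    linear_combination m ν * e
  refine eLpNorm_le_of_tendsto (l := 𝓝[>] (0 : ℝ)) ?_ ?_ fun x => tendsto_conv_prodKernel hFb x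
  · filter_upwards [self_mem_nhdsWithin] with y hy
    exact (hFb.conv (integrable_prodKernel (fun _ => hy) (fun _ => hy))).1.aestronglyMeasurable
  · filter_upwards [self_mem_nhdsWithin] with y hy
    rw [hkey y hy]
    have := prodKernel_convBound hp hC
      (y₁ := fun i => (1 - ε i) * α + y) (y₂ := fun i => (1 + ε i) * α + y)
      (fun i => add_pos_of_nonneg_of_pos (mul_nonneg (by linarith [(hε i).2]) hα) hy)
      (fun i => add_pos_of_nonneg_of_pos (mul_nonneg (by linarith [(hε i).1]) hα) hy)
      A hAb.1.measurable hAb.2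
    simpa using this

/-- `e^{αΛ₁}` of a product, expanded into products of the components `e^{αε·D}`. -/
lemma multOp_gevrey_mul {M m n : 𝓢(RSpace d, ℂ)} (hM : HasCompactSupport M)
    (hm : HasCompactSupport m) (hn : HasCompactSupport n) {α : ℝ} (hα : 0 ≤ α)
    {h₁ h₂ : RSpace d → ℂ} (hh₁ : IsBddCont h₁) (hh₂ : IsBddCont h₂) (x : RSpace d) :
    multOp (fun ν => M ν * gevreySymbol α ν) (fun w => multOp m h₁ w * multOp n h₂ w) x =
      ∑ ε : Fin d → SignType, signCoeff ε *
        multOp (fun ν => prodSymbol (signDamp α ε) (signDamp α ε) ν * M ν)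
          (fun w => multOp (fun ν => m ν * signExp α ε ν) h₁ w *
            multOp (fun ν => n ν * signExp α ε ν) h₂ w) x := by
  have h := sum_multOp_mul_eq_zero (Finset.univ : Finset (Option (Fin d → SignType)))
    (fun o => o.elim (-1) signCoeff)
    (M := fun o => o.elim (fun ν => M ν * gevreySymbol α ν)
      fun ε ν => prodSymbol (signDamp α ε) (signDamp α ε) ν * M ν)
    (m := fun o => o.elim (m : RSpace d → ℂ) fun ε ν => m ν * signExp α ε ν)
    (n := fun o => o.elim (n : RSpace d → ℂ) fun ε ν => n ν * signExp α ε ν)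
    (h₁ := h₁) (h₂ := h₂) ?_ ?_ ?_ hh₁ hh₂ ?_ x
  · rw [Fintype.sum_option] at h
    simp only [Option.elim_none, Option.elim_some] at h
    linear_combination -h
  · rintro (_ | ε) -
    · exact isSymbol_mul_gevreySymbol hM hα
    · exact (poisson_symbol (signDamp_nonneg hα ε) M.isSymbol).1
  · rintro (_ | ε) -
    · exact m.isSymbol
    · exact isSymbol_mul_signExp hm α ε
  · rintro (_ | ε) -
    · exact n.isSymbol
    · exact isSymbol_mul_signExp hn α ε
  · intro ξ η
    rw [Fintype.sum_option]
    simp only [Option.elim_none, Option.elim_some]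
    rw [gevreySymbol_eq_sum, Finset.mul_sum, Finset.sum_mul, Finset.sum_mul, Finset.mul_sum,
      ← Finset.sum_add_distrib]
    refine Finset.sum_eq_zero fun ε _ => ?_
    rw [signExp_add]; ring

end Gevrey

/-! ### Tempered distributions and convolution -/

section Tempered

open BoundedContinuousFunction
open scoped LineDeriv

variable {V : Type*} [NormedAddCommGroup V] [InnerProductSpace ℝ V] [FiniteDimensional ℝ V]
  [MeasurableSpace V] [BorelSpace V]

/-- The bounded continuous function `z ↦ ‖z‖ᵏ D^n ψ(z)`, whose norm is the seminorm of index
`(k, n)` of `ψ`. -/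
def weightedDeriv (k n : ℕ) : 𝓢(V, ℂ) →ₗ[ℂ] (V →ᵇ (V [×n]→L[ℝ] ℂ)) where
  toFun ψ := BoundedContinuousFunction.ofNormedAddCommGroup
    (fun z => (‖z‖ ^ k : ℝ) • iteratedFDeriv ℝ n ψ z)
    ((continuous_norm.pow k).smul ((ψ.smooth n).continuous_iteratedFDeriv (by simp)))
    (SchwartzMap.seminorm ℂ k n ψ) (fun z => by
      rw [norm_smul, Real.norm_of_nonneg (by positivity)]
      exact SchwartzMap.le_seminorm ℂ k n ψ z)
  map_add' f g := by
    ext1 z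
    have : iteratedFDeriv ℝ n (⇑(f + g)) z = iteratedFDeriv ℝ n f z + iteratedFDeriv ℝ n g z :=
      iteratedFDeriv_add_apply (f.smooth n).contDiffAt (g.smooth n).contDiffAt
    change (‖z‖ ^ k : ℝ) • iteratedFDeriv ℝ n (⇑(f + g)) z = _
    rw [this, smul_add]; rfl
  map_smul' c f := by
    ext1 z
    have : iteratedFDeriv ℝ n (⇑(c • f)) z = c • iteratedFDeriv ℝ n f z :=
      iteratedFDeriv_const_smul_apply (f.smooth n).contDiffAt
    change (‖z‖ ^ k : ℝ) • iteratedFDeriv ℝ n (⇑(c • f)) z = _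
    rw [this, smul_comm]; rfl

lemma weightedDeriv_apply (k n : ℕ) (ψ : 𝓢(V, ℂ)) (z : V) :
    weightedDeriv k n ψ z = (‖z‖ ^ k : ℝ) • iteratedFDeriv ℝ n ψ z := rfl

/-- A finite product of spaces of bounded continuous functions, in which Schwartz functions are
recorded through finitely many weighted derivatives. -/
def JetSpace (V : Type*) [NormedAddCommGroup V] [InnerProductSpace ℝ V] (s : Finset (ℕ × ℕ)) :
    Type _ :=
  (i : s) → V →ᵇ (V [×i.1.2]→L[ℝ] ℂ)

instance (s : Finset (ℕ × ℕ)) : NormedAddCommGroup (JetSpace V s) :=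
  Pi.normedAddCommGroup (G := fun i : s => V →ᵇ (V [×i.1.2]→L[ℝ] ℂ))

instance (s : Finset (ℕ × ℕ)) : NormedSpace ℂ (JetSpace V s) :=
  Pi.normedSpace (E := fun i : s => V →ᵇ (V [×i.1.2]→L[ℝ] ℂ))

instance (s : Finset (ℕ × ℕ)) : CompleteSpace (JetSpace V s) :=
  inferInstanceAs (CompleteSpace ((i : s) → V →ᵇ (V [×i.1.2]→L[ℝ] ℂ)))

/-- The embedding of Schwartz space into `JetSpace V s`. Each tempered distribution factors through
it for some `s`, and integrals of functions with values in Schwartz space are computed there. -/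
def jetMap (s : Finset (ℕ × ℕ)) : 𝓢(V, ℂ) →ₗ[ℂ] JetSpace V s where
  toFun ψ := fun i : s => weightedDeriv i.1.1 i.1.2 ψ
  map_add' f g := funext fun i : s => map_add (weightedDeriv i.1.1 i.1.2) f g
  map_smul' c f := funext fun i : s => map_smul (weightedDeriv i.1.1 i.1.2) c f

lemma jetMap_apply (s : Finset (ℕ × ℕ)) (ψ : 𝓢(V, ℂ)) (i : s) :
    jetMap s ψ i = weightedDeriv i.1.1 i.1.2 ψ := rfl

lemma norm_jet_le_iff {s : Finset (ℕ × ℕ)} (f : JetSpace V s) {r : ℝ} (hr : 0 ≤ r) :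
    ‖f‖ ≤ r ↔ ∀ i, ‖f i‖ ≤ r := pi_norm_le_iff_of_nonneg hr

/-- Evaluation of a component of an element of `JetSpace V s` at a point. -/
def jetEval (s : Finset (ℕ × ℕ)) (i : s) (z : V) : JetSpace V s →L[ℂ] (V [×i.1.2]→L[ℝ] ℂ) :=
  LinearMap.mkContinuous
    { toFun := fun f => f i z
      map_add' := fun _ _ => rfl
      map_smul' := fun _ _ => rfl } 1 fun f => by
    rw [one_mul]
    exact ((f i).norm_coe_le_norm z).trans ((norm_jet_le_iff f (norm_nonneg f)).1 le_rfl i)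

/-- A linear form dominated by the norm of `Φ` factors through `Φ`, by the Hahn-Banach theorem. -/
lemma exists_factor_of_bound {E F : Type*} [AddCommGroup E] [Module ℂ E] [NormedAddCommGroup F]
    [NormedSpace ℂ F] (Φ : E →ₗ[ℂ] F) (u : E →ₗ[ℂ] ℂ) (C : ℝ) (h : ∀ ψ, ‖u ψ‖ ≤ C * ‖Φ ψ‖) :
    ∃ T : F →L[ℂ] ℂ, ∀ ψ, T (Φ ψ) = u ψ := by
  have hker : Φ.ker ≤ u.ker := by
    intro ψ hψ
    have := h ψ
    rw [LinearMap.mem_ker.1 hψ, norm_zero, mul_zero] at this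
    exact norm_le_zero_iff.1 this
  have e : ∀ ψ, (Φ.ker.liftQ u hker) (Φ.quotKerEquivRange.symm ⟨Φ ψ, ψ, rfl⟩) = u ψ := by
    intro ψ
    rw [LinearMap.quotKerEquivRange_symm_apply_image Φ ψ ⟨ψ, rfl⟩]
    rfl
  obtain ⟨T, hT, -⟩ := exists_extension_norm_eq _
    (LinearMap.mkContinuous ((Φ.ker.liftQ u hker) ∘ₗ
      (Φ.quotKerEquivRange.symm : Φ.range →ₗ[ℂ] E ⧸ Φ.ker)) C (by
      rintro ⟨_, ψ, rfl⟩
      exact (congrArg norm (e ψ)).trans_le (h ψ)))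
  exact ⟨T, fun ψ => (hT ⟨Φ ψ, ψ, rfl⟩).trans (e ψ)⟩

lemma exists_factor_jetMap (u : 𝓢'(V, ℂ)) :
    ∃ (s : Finset (ℕ × ℕ)) (T : JetSpace V s →L[ℂ] ℂ), ∀ ψ, T (jetMap s ψ) = u ψ := by
  obtain ⟨s, C, -, hC⟩ := Seminorm.bound_of_continuous (schwartz_withSeminorms ℂ V ℂ)
    ((normSeminorm ℂ ℂ).comp (u : 𝓢(V, ℂ) →ₗ[ℂ] ℂ)) (by
      exact continuous_norm.comp u.continuous)
  refine ⟨s, exists_factor_of_bound (jetMap s) (u : 𝓢(V, ℂ) →ₗ[ℂ] ℂ) C fun ψ => ?_⟩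
  refine (hC ψ).trans ?_
  rw [_root_.smul_apply, NNReal.smul_def, smul_eq_mul]
  gcongr
  refine Seminorm.finset_sup_apply_le (norm_nonneg _) fun i hi => ?_
  refine SchwartzMap.seminorm_le_bound ℂ i.1 i.2 ψ (norm_nonneg _) fun z => ?_
  have h1 := (norm_jet_le_iff (jetMap s ψ) (norm_nonneg _)).1 le_rfl ⟨i, hi⟩
  have h2 := (jetMap s ψ ⟨i, hi⟩).norm_coe_le_norm z
  refine le_trans (le_of_eq ?_) (h2.trans h1)
  rw [jetMap_apply, weightedDeriv_apply, norm_smul, Real.norm_of_nonneg (by positivity)]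

lemma weightedDeriv_translate (k n : ℕ) (η : 𝓢(V, ℂ)) (x z : V) :
    weightedDeriv k n (SchwartzMap.compSubConstCLM ℂ x η) z =
      (‖z‖ ^ k : ℝ) • iteratedFDeriv ℝ n η (z - x) := by
  rw [weightedDeriv_apply]
  congr 1
  exact iteratedFDeriv_comp_sub n x z

lemma pow_mul_norm_iteratedFDeriv_le (k n : ℕ) (η : 𝓢(V, ℂ)) {R : ℝ} (hR : 0 ≤ R) {z y : V}
    (h : ‖z‖ ≤ ‖y‖ + R) : ‖z‖ ^ k * ‖iteratedFDeriv ℝ n η y‖ ≤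
      2 ^ (k - 1) * (SchwartzMap.seminorm ℝ k n η + R ^ k * SchwartzMap.seminorm ℝ 0 n η) := by
  have h1 : ‖z‖ ^ k ≤ 2 ^ (k - 1) * (‖y‖ ^ k + R ^ k) :=
    (pow_le_pow_left₀ (norm_nonneg _) h k).trans (add_pow_le (norm_nonneg _) hR k)
  have h2 := SchwartzMap.le_seminorm ℝ k n η y
  have h3 := SchwartzMap.norm_iteratedFDeriv_le_seminorm ℝ η n y
  calc ‖z‖ ^ k * ‖iteratedFDeriv ℝ n η y‖
      ≤ 2 ^ (k - 1) * (‖y‖ ^ k + R ^ k) * ‖iteratedFDeriv ℝ n η y‖ := by gcongr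
    _ = 2 ^ (k - 1) * (‖y‖ ^ k * ‖iteratedFDeriv ℝ n η y‖ +
        R ^ k * ‖iteratedFDeriv ℝ n η y‖) := by ring
    _ ≤ _ := by gcongr

lemma norm_weightedDeriv_translate_le (k n : ℕ) (η : 𝓢(V, ℂ)) (x : V) :
    ‖weightedDeriv k n (SchwartzMap.compSubConstCLM ℂ x η)‖ ≤
      2 ^ (k - 1) * (SchwartzMap.seminorm ℝ k n η + ‖x‖ ^ k * SchwartzMap.seminorm ℝ 0 n η) := by
  refine (BoundedContinuousFunction.norm_le (by positivity)).2 fun z => ?_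
  rw [weightedDeriv_translate, norm_smul, Real.norm_of_nonneg (by positivity)]
  refine pow_mul_norm_iteratedFDeriv_le k n η (norm_nonneg x) ?_
  simpa using norm_add_le (z - x) x

lemma continuous_weightedDeriv_translate (k n : ℕ) (η : 𝓢(V, ℂ)) :
    Continuous fun x => weightedDeriv k n (SchwartzMap.compSubConstCLM ℂ x η) := by
  rw [continuous_iff_continuousAt]
  intro x₀
  set L := 2 ^ (k - 1) * (SchwartzMap.seminorm ℝ k (n + 1) η +
    (‖x₀‖ + 1) ^ k * SchwartzMap.seminorm ℝ 0 (n + 1) η) with hL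
  have hL0 : 0 ≤ L := by positivity
  have hd : Differentiable ℝ (iteratedFDeriv ℝ n η) :=
    (η.smooth ⊤).differentiable_iteratedFDeriv (by exact_mod_cast ENat.natCast_lt_top n)
  have key : ∀ x ∈ Metric.ball x₀ 1, dist
      (weightedDeriv k n (SchwartzMap.compSubConstCLM ℂ x η))
      (weightedDeriv k n (SchwartzMap.compSubConstCLM ℂ x₀ η)) ≤ L * dist x x₀ := by
    intro x hx
    refine (BoundedContinuousFunction.dist_le (by positivity)).2 fun z => ?_
    rw [weightedDeriv_translate, weightedDeriv_translate, dist_eq_norm, dist_eq_norm]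
    refine (convex_ball x₀ 1).norm_image_sub_le_of_norm_hasFDerivWithin_le
      (f := fun x => (‖z‖ ^ k : ℝ) • iteratedFDeriv ℝ n η (z - x))
      (f' := fun x => (‖z‖ ^ k : ℝ) •
        ((fderiv ℝ (iteratedFDeriv ℝ n η) (z - x)).comp (-ContinuousLinearMap.id ℝ V)))
      (fun y _ => ?_) (fun y hy => ?_) (Metric.mem_ball_self one_pos) hx
    · have h0 : HasFDerivAt (fun x : V => z - x) (-ContinuousLinearMap.id ℝ V) y :=
        (hasFDerivAt_id y).const_sub z
      exact (((hd (z - y)).hasFDerivAt.comp y h0).const_smul (‖z‖ ^ k : ℝ)).hasFDerivWithinAt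
    · rw [norm_smul, Real.norm_of_nonneg (by positivity)]
      have h1 : ‖(fderiv ℝ (iteratedFDeriv ℝ n η) (z - y)).comp (-ContinuousLinearMap.id ℝ V)‖ ≤
          ‖iteratedFDeriv ℝ (n + 1) η (z - y)‖ := by
        rw [← norm_fderiv_iteratedFDeriv]
        refine (ContinuousLinearMap.opNorm_comp_le _ _).trans ?_
        refine mul_le_of_le_one_right (norm_nonneg _) ?_
        rw [norm_neg]
        exact ContinuousLinearMap.norm_id_le
      refine (mul_le_mul_of_nonneg_left h1 (by positivity)).trans ?_
      refine pow_mul_norm_iteratedFDeriv_le k (n + 1) η (by positivity) ?_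
      have h2 : ‖z‖ ≤ ‖z - y‖ + ‖y‖ := by simpa using norm_add_le (z - y) y
      have h3 : ‖y‖ ≤ ‖x₀‖ + 1 := by
        have h4 : ‖y - x₀‖ < 1 := by simpa [dist_eq_norm] using hy
        have h5 : ‖y‖ ≤ ‖y - x₀‖ + ‖x₀‖ := by simpa using norm_add_le (y - x₀) x₀
        linarith
      linarith
  rw [ContinuousAt, tendsto_iff_dist_tendsto_zero]
  have h0 : Tendsto (fun x => L * dist x x₀) (𝓝 x₀) (𝓝 0) := by
    have : Tendsto (fun x => L * dist x x₀) (𝓝 x₀) (𝓝 (L * dist x₀ x₀)) :=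
      (by fun_prop : Continuous fun x => L * dist x x₀).tendsto x₀
    simpa using this
  refine squeeze_zero' (Eventually.of_forall fun _ => dist_nonneg) ?_ h0
  filter_upwards [Metric.ball_mem_nhds x₀ one_pos] with x hx using key x hx

/-- Convolution of Schwartz functions, as a Schwartz function. -/
def schwartzConv (ψ η : 𝓢(V, ℂ)) : 𝓢(V, ℂ) :=
  SchwartzMap.convolution (ContinuousLinearMap.mul ℂ ℂ) ψ η

lemma schwartzConv_apply (ψ η : 𝓢(V, ℂ)) (z : V) :
    schwartzConv ψ η z = ∫ y, ψ y * η (z - y) := by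
  rw [schwartzConv, SchwartzMap.convolution_apply]
  rfl

lemma fourier_schwartzConv_apply (ψ η : 𝓢(V, ℂ)) (ξ : V) :
    𝓕 (schwartzConv ψ η) ξ = 𝓕 ψ ξ * 𝓕 η ξ := by
  rw [schwartzConv, SchwartzMap.fourier_convolution]
  simp

lemma fourier_lineDeriv_apply (f : 𝓢(V, ℂ)) (v ξ : V) :
    𝓕 (∂_{v} f) ξ = (2 * Real.pi * Complex.I) * (inner ℝ ξ v * 𝓕 f ξ) := by
  have : (inner ℝ · v : V → ℝ).HasTemperateGrowth := ((innerSL ℝ).flip v).hasTemperateGrowth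
  rw [SchwartzMap.fourier_lineDerivOp_eq]
  simp [this]

lemma lineDeriv_schwartzConv (ψ η : 𝓢(V, ℂ)) (v : V) :
    ∂_{v} (schwartzConv ψ η) = schwartzConv ψ (∂_{v} η) := by
  have h : 𝓕 (∂_{v} (schwartzConv ψ η)) = 𝓕 (schwartzConv ψ (∂_{v} η)) := by
    ext ξ
    rw [fourier_lineDeriv_apply, fourier_schwartzConv_apply, fourier_schwartzConv_apply,
      fourier_lineDeriv_apply]
    ring
  simpa using congrArg (fun f : 𝓢(V, ℂ) => 𝓕⁻ f) h

lemma iteratedLineDeriv_schwartzConv (ψ η : 𝓢(V, ℂ)) {n : ℕ} (m : Fin n → V) :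
    ∂^{m} (schwartzConv ψ η) = schwartzConv ψ (∂^{m} η) := by
  induction n with
  | zero => simp
  | succ n ih =>
    rw [LineDeriv.iteratedLineDerivOp_succ_left, LineDeriv.iteratedLineDerivOp_succ_left, ih,
      lineDeriv_schwartzConv]

lemma integrable_smul_iteratedFDeriv (ψ η : 𝓢(V, ℂ)) (n : ℕ) (z : V) :
    Integrable fun y => ψ y • iteratedFDeriv ℝ n η (z - y) := by
  refine ψ.integrable.smul_bdd (SchwartzMap.seminorm ℝ 0 n η)
    (Continuous.aestronglyMeasurable ?_) (Eventually.of_forall fun y =>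
      SchwartzMap.norm_iteratedFDeriv_le_seminorm ℝ η n _)
  exact ((η.smooth n).continuous_iteratedFDeriv (by simp)).comp (by fun_prop)

lemma iteratedFDeriv_schwartzConv (ψ η : 𝓢(V, ℂ)) (n : ℕ) (z : V) :
    iteratedFDeriv ℝ n (schwartzConv ψ η) z = ∫ y, ψ y • iteratedFDeriv ℝ n η (z - y) := by
  ext m
  have h1 := ContinuousLinearMap.integral_comp_comm
    (ContinuousMultilinearMap.apply ℝ (fun _ : Fin n => V) ℂ m)
    (integrable_smul_iteratedFDeriv ψ η n z)
  change _ = (ContinuousMultilinearMap.apply ℝ (fun _ : Fin n => V) ℂ m) _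
  rw [← h1, ← SchwartzMap.iteratedLineDerivOp_eq_iteratedFDeriv, iteratedLineDeriv_schwartzConv,
    schwartzConv_apply]
  congr 1; ext y
  simp [SchwartzMap.iteratedLineDerivOp_eq_iteratedFDeriv]

lemma continuous_jetMap_translate (s : Finset (ℕ × ℕ)) (η : 𝓢(V, ℂ)) :
    Continuous fun x => jetMap s (SchwartzMap.compSubConstCLM ℂ x η) :=
  continuous_pi (A := fun i : s => V →ᵇ (V [×i.1.2]→L[ℝ] ℂ))
    fun i => continuous_weightedDeriv_translate i.1.1 i.1.2 η

lemma integrable_smul_jetMap (s : Finset (ℕ × ℕ)) (ψ η : 𝓢(V, ℂ)) :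
    Integrable fun y => ψ y • jetMap s (SchwartzMap.compSubConstCLM ℂ y η) := by
  have hc := ψ.continuous.smul (continuous_jetMap_translate s η)
  have hb : Integrable fun y => ∑ i : s, 2 ^ (i.1.1 - 1) *
      (SchwartzMap.seminorm ℝ i.1.1 i.1.2 η * ‖ψ y‖ +
        SchwartzMap.seminorm ℝ 0 i.1.2 η * (‖y‖ ^ i.1.1 * ‖ψ y‖)) := by
    refine integrable_finsetSum _ fun i _ => Integrable.const_mul (Integrable.add ?_ ?_) _
    · exact ψ.integrable.norm.const_mul _
    · exact (SchwartzMap.integrable_pow_mul volume ψ i.1.1).const_mul _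
  refine hb.mono' hc.aestronglyMeasurable (Eventually.of_forall fun y => ?_)
  rw [norm_smul, mul_comm]
  refine (mul_le_mul_of_nonneg_right (b := ‖jetMap s (SchwartzMap.compSubConstCLM ℂ y η)‖)
    (c := ∑ i : s, 2 ^ (i.1.1 - 1) * (SchwartzMap.seminorm ℝ i.1.1 i.1.2 η +
      ‖y‖ ^ i.1.1 * SchwartzMap.seminorm ℝ 0 i.1.2 η)) ?_ (norm_nonneg _)).trans (le_of_eq ?_)
  · refine (norm_jet_le_iff _ (by positivity)).2 fun i => ?_
    rw [jetMap_apply]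
    refine (norm_weightedDeriv_translate_le i.1.1 i.1.2 η y).trans ?_
    exact Finset.single_le_sum (f := fun i : s => (2 : ℝ) ^ (i.1.1 - 1) *
      (SchwartzMap.seminorm ℝ i.1.1 i.1.2 η + ‖y‖ ^ i.1.1 * SchwartzMap.seminorm ℝ 0 i.1.2 η))
      (fun i _ => by positivity) (Finset.mem_univ i)
  · rw [Finset.sum_mul]
    exact Finset.sum_congr rfl fun i _ => by ring

lemma integral_smul_jetMap (s : Finset (ℕ × ℕ)) (ψ η : 𝓢(V, ℂ)) :
    ∫ y, ψ y • jetMap s (SchwartzMap.compSubConstCLM ℂ y η) = jetMap s (schwartzConv ψ η) := by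
  refine funext fun i => ?_
  refine BoundedContinuousFunction.ext fun z => ?_
  have h := (jetEval s i z).integral_comp_comm (integrable_smul_jetMap s ψ η)
  refine h.symm.trans ?_
  change _ = (‖z‖ ^ i.1.1 : ℝ) • iteratedFDeriv ℝ i.1.2 (schwartzConv ψ η) z
  rw [iteratedFDeriv_schwartzConv, ← integral_smul]
  congr 1; ext1 y
  change ψ y • weightedDeriv i.1.1 i.1.2 (SchwartzMap.compSubConstCLM ℂ y η) z = _
  rw [weightedDeriv_translate, smul_comm]

/-- The convolution of a tempered distribution and a Schwartz function is continuous. -/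
lemma continuous_translate_apply (u : 𝓢'(V, ℂ)) (η : 𝓢(V, ℂ)) :
    Continuous fun x => u (SchwartzMap.compSubConstCLM ℂ x η) := by
  obtain ⟨s, T, hT⟩ := exists_factor_jetMap u
  simp_rw [← hT]
  exact T.continuous.comp (continuous_jetMap_translate s η)

/-- Convolution of tempered distributions with Schwartz functions is associative. -/
lemma integral_mul_translate_apply (u : 𝓢'(V, ℂ)) (ψ η : 𝓢(V, ℂ)) :
    ∫ y, ψ y * u (SchwartzMap.compSubConstCLM ℂ y η) = u (schwartzConv ψ η) := by
  obtain ⟨s, T, hT⟩ := exists_factor_jetMap u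
  simp_rw [← hT]
  rw [← integral_smul_jetMap, ← T.integral_comp_comm (integrable_smul_jetMap s ψ η)]
  congr 1; ext y
  rw [map_smul, smul_eq_mul]

end Tempered

section Multiplier

variable {d : ℕ}

open LittlewoodPaley

lemma continuous_schwartzMultiplier (m : 𝓢(RSpace d, ℂ)) (u : 𝓢'(RSpace d, ℂ)) :
    Continuous (schwartzMultiplier m u) :=
  continuous_translate_apply u (𝓕 m)

lemma fourier_mul_eq_schwartzConv (m n k : 𝓢(RSpace d, ℂ)) (h : ∀ ν, k ν = m ν * n ν) :
    𝓕 k = schwartzConv (𝓕 m) (𝓕 n) := by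
  have h1 : 𝓕⁻ (schwartzConv (𝓕 m) (𝓕 n)) = k := by
    ext ν
    have h2 : 𝓕⁻ (schwartzConv (𝓕 m) (𝓕 n)) ν = 𝓕 (schwartzConv (𝓕 m) (𝓕 n)) (-ν) := by
      rw [SchwartzMap.fourierInv_coe, SchwartzMap.fourier_coe, Real.fourierInv_eq_fourier_neg]
    have h3 : ∀ m : 𝓢(RSpace d, ℂ), 𝓕 (𝓕 m) (-ν) = m ν := by
      intro m
      have : 𝓕⁻ (𝓕 m) ν = 𝓕 (𝓕 m) (-ν) := by
        rw [SchwartzMap.fourierInv_coe, SchwartzMap.fourier_coe (𝓕 m),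
          Real.fourierInv_eq_fourier_neg]
      rw [← this]; simp
    rw [h2, fourier_schwartzConv_apply, h3, h3, h]
  rw [← h1]; simp

/-- The multiplier of symbol `m` applied to the function `n(D)u`. -/
lemma multOp_schwartzMultiplier (m n k : 𝓢(RSpace d, ℂ)) (h : ∀ ν, k ν = m ν * n ν)
    (u : 𝓢'(RSpace d, ℂ)) :
    multOp m (schwartzMultiplier n u) = schwartzMultiplier k u := by
  ext x
  rw [multOp, conv]
  have e1 : ∫ y, 𝓕⁻ (m : RSpace d → ℂ) y * schwartzMultiplier n u (x - y) =
      ∫ y, 𝓕⁻ (m : RSpace d → ℂ) (x - y) * schwartzMultiplier n u y := by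
    rw [← integral_sub_left_eq_self _ volume x]
    simp
  have e2 : ∀ y, 𝓕⁻ (m : RSpace d → ℂ) (x - y) =
      SchwartzMap.compSubConstCLM ℂ x (𝓕 m) y := by
    intro y
    rw [SchwartzMap.compSubConstCLM_apply, SchwartzMap.fourier_coe, Real.fourierInv_eq_fourier_neg,
      neg_sub]
  rw [e1]
  simp_rw [e2]
  simp only [schwartzMultiplier]
  rw [integral_mul_translate_apply]
  congr 1
  ext z
  rw [schwartzConv_apply, SchwartzMap.compSubConstCLM_apply, fourier_mul_eq_schwartzConv m n k h,
    schwartzConv_apply, ← integral_add_right_eq_self _ x]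
  congr 1; ext y
  simp only [SchwartzMap.compSubConstCLM_apply]
  congr 2 <;> abel

end Multiplier

/-! ### Dilations and Bernstein's inequality -/

/-- The power `2^x` as an extended nonnegative real. -/
def twoPow (x : ℝ) : ℝ≥0∞ := ENNReal.ofReal ((2 : ℝ) ^ x)

lemma twoPow_add (x y : ℝ) : twoPow (x + y) = twoPow x * twoPow y := by
  rw [twoPow, Real.rpow_add two_pos, ENNReal.ofReal_mul (by positivity)]; rfl

lemma twoPow_zero : twoPow 0 = 1 := by simp [twoPow]

lemma twoPow_rpow (x y : ℝ) : twoPow x ^ y = twoPow (x * y) := by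
  rw [twoPow, twoPow, ENNReal.ofReal_rpow_of_pos (by positivity), ← Real.rpow_mul two_pos.le]

lemma twoPow_ne_top (x : ℝ) : twoPow x ≠ ∞ := ENNReal.ofReal_ne_top

lemma twoPow_mono {x y : ℝ} (h : x ≤ y) : twoPow x ≤ twoPow y :=
  ENNReal.ofReal_le_ofReal (Real.rpow_le_rpow_of_exponent_le one_le_two h)

lemma twoPow_neg_mul (x : ℝ) : twoPow (-x) * twoPow x = 1 := by
  rw [← twoPow_add, neg_add_cancel, twoPow_zero]

section Dilation

variable {d : ℕ}

/-- The symbol `ν ↦ m(2^{-j}ν)`. -/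
def dilate (j : ℤ) (m : RSpace d → ℂ) (ν : RSpace d) : ℂ := m ((2 : ℝ) ^ (-j) • ν)

/-- `m` is a symbol whose kernel has `L¹` norm at most `c` and supremum at most `c R`. -/
structure HasKernelBound (m : RSpace d → ℂ) (c R : ℝ≥0∞) : Prop where
  isSymbol : IsSymbol m
  lintegral_le : ∫⁻ x, ‖𝓕⁻ m x‖ₑ ≤ c
  enorm_le : ∀ x, ‖𝓕⁻ m x‖ₑ ≤ c * R

lemma HasKernelBound.poisson {m : RSpace d → ℂ} {c R : ℝ≥0∞} (h : HasKernelBound m c R)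
    {b : Fin d → ℝ} (hb : ∀ i, 0 ≤ b i) :
    HasKernelBound (fun ν => prodSymbol b b ν * m ν) c R := by
  obtain ⟨h1, h2, h3⟩ := poisson_symbol hb h.isSymbol
  exact ⟨h1, h2.trans h.lintegral_le, h3 _ h.enorm_le⟩

lemma HasKernelBound.mono {m : RSpace d → ℂ} {c c' R : ℝ≥0∞} (h : HasKernelBound m c R)
    (hc : c ≤ c') : HasKernelBound m c' R :=
  ⟨h.isSymbol, h.lintegral_le.trans hc, fun x => (h.enorm_le x).trans (by gcongr)⟩

lemma HasKernelBound.recipNorm_le {m : RSpace d → ℂ} {c R : ℝ≥0∞} (h : HasKernelBound m c R)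
    {f : RSpace d → ℂ} (hf : IsBddCont f) {t t' : ℝ} (ht : 0 < t) (ht1 : t ≤ 1) (ht' : 0 ≤ t')
    (htt : t' ≤ t) : recipNorm t' (multOp m f) ≤ c * R ^ (t - t') * recipNorm t f :=
  recipNorm_conv_le_of_bounds h.isSymbol.kerInt.1 hf.1.measurable ht ht1 ht' htt h.lintegral_le
    h.enorm_le

lemma HasKernelBound.enorm_multOp_le {m : RSpace d → ℂ} {c R : ℝ≥0∞} (h : HasKernelBound m c R)
    {f : RSpace d → ℂ} {M : ℝ≥0∞} (hM : ∀ x, ‖f x‖ₑ ≤ M) (x : RSpace d) :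
    ‖multOp m f x‖ₑ ≤ c * M := by
  refine (enorm_integral_le_lintegral_enorm _).trans ?_
  calc ∫⁻ y, ‖𝓕⁻ m y * f (x - y)‖ₑ ≤ ∫⁻ y, ‖𝓕⁻ m y‖ₑ * M := by
        refine lintegral_mono fun y => ?_
        rw [enorm_mul]
        gcongr
        exact hM _
    _ ≤ c * M := by
        rw [lintegral_mul_const _ h.isSymbol.continuous_ker.measurable.enorm]
        gcongr
        exact h.lintegral_le

lemma fourierInv_comp_smul (m : RSpace d → ℂ) {a : ℝ} (ha : 0 < a) (x : RSpace d) :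
    𝓕⁻ (fun ν => m (a⁻¹ • ν)) x = ((a ^ d : ℝ) : ℂ) * 𝓕⁻ m (a • x) := by
  rw [fourierInv_eq_integral_mul, fourierInv_eq_integral_mul]
  have h := Measure.integral_comp_smul (volume : Measure (RSpace d))
    (fun ν => (Real.fourierChar (inner ℝ ν (a • x)) : ℂ) * m ν) a⁻¹
  rw [finrank_euclideanSpace, Fintype.card_fin, inv_pow, inv_inv, abs_of_pos (by positivity)] at h
  rw [← Complex.real_smul, ← h]
  congr 1; ext ν
  rw [inner_smul_left, inner_smul_right]
  congr 3
  simp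
  field_simp

lemma exists_hasKernelBound_dilate {m : RSpace d → ℂ} (hm : IsSymbol m) :
    ∃ c : ℝ≥0, ∀ j : ℤ, HasKernelBound (dilate j m) c (twoPow (j * d)) := by
  obtain ⟨M, hM⟩ : ∃ M : ℝ, ∀ x, ‖𝓕⁻ m x‖ ≤ M := ⟨_, fun x => norm_fourierInv_le x⟩
  have hM0 : 0 ≤ M := (norm_nonneg _).trans (hM 0)
  refine ⟨(∫⁻ x, ‖𝓕⁻ m x‖ₑ).toNNReal + M.toNNReal, fun j => ?_⟩
  set a : ℝ := (2 : ℝ) ^ j with ha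
  have ha0 : 0 < a := by positivity
  have hd : dilate j m = fun ν => m (a⁻¹ • ν) := by
    ext ν; rw [dilate, zpow_neg]
  have hker : 𝓕⁻ (dilate j m) = fun x => ((a ^ d : ℝ) : ℂ) * 𝓕⁻ m (a • x) := by
    rw [hd]; ext x; exact fourierInv_comp_smul m ha0 x
  have hfin : ∫⁻ x, ‖𝓕⁻ m x‖ₑ ≠ ∞ := hm.kerInt.2.ne
  have hpow : ‖((a ^ d : ℝ) : ℂ)‖ₑ = twoPow (j * d) := by
    rw [← ofReal_norm, Complex.norm_real, Real.norm_of_nonneg (by positivity), twoPow]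
    congr 1
    rw [Real.rpow_mul two_pos.le, Real.rpow_intCast, Real.rpow_natCast]
  refine ⟨⟨?_, ?_, ?_⟩, ?_, ?_⟩
  · rw [hd]; exact hm.cont.comp (by fun_prop)
  · rw [hd]; exact hm.int.comp_smul (by positivity)
  · rw [hker]; exact (hm.kerInt.comp_smul ha0.ne').const_mul _
  · have h2 : ∫⁻ x, ‖𝓕⁻ (dilate j m) x‖ₑ = ∫⁻ x, ‖𝓕⁻ m x‖ₑ := by
      rw [hker, ← ofReal_integral_norm_eq_lintegral_enorm hm.kerInt,
        ← ofReal_integral_norm_eq_lintegral_enorm ((hm.kerInt.comp_smul ha0.ne').const_mul _)]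
      simp_rw [norm_mul]
      rw [integral_const_mul, Measure.integral_comp_smul volume (fun x => ‖𝓕⁻ m x‖),
        finrank_euclideanSpace, Fintype.card_fin, abs_of_pos (by positivity), smul_eq_mul,
        ← mul_assoc, Complex.norm_real, Real.norm_of_nonneg (by positivity),
        mul_inv_cancel₀ (by positivity), one_mul]
    rw [h2, ENNReal.coe_add, ENNReal.coe_toNNReal hfin]
    exact le_self_add
  · intro x
    rw [hker]
    simp only [enorm_mul]
    rw [hpow, mul_comm]
    gcongr
    calc ‖𝓕⁻ m (a • x)‖ₑ = ENNReal.ofReal ‖𝓕⁻ m (a • x)‖ := (ofReal_norm _).symm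
      _ ≤ ENNReal.ofReal M := ENNReal.ofReal_le_ofReal (hM _)
      _ ≤ _ := by push_cast; exact le_add_self

end Dilation

/-! ### Littlewood-Paley symbols -/

namespace LittlewoodPaley

variable {d : ℕ} (L : LittlewoodPaley d)

/-- The symbol of `Δ̇_{j-1} + Δ̇_j + Δ̇_{j+1}`. -/
def fatSymbol (j : ℤ) : 𝓢(RSpace d, ℂ) :=
  L.blockSymbol (j - 1) + L.blockSymbol j + L.blockSymbol (j + 1)

lemma lowSymbol_apply (j : ℤ) (ν : RSpace d) :
    L.lowSymbol j ν = ((L.χ (((2 : ℝ) ^ (-j)) • ((2 * Real.pi) • ν)) : ℝ) : ℂ) := rfl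

lemma blockSymbol_apply (j : ℤ) (ν : RSpace d) :
    L.blockSymbol j ν = L.lowSymbol (j + 1) ν - L.lowSymbol j ν := rfl

lemma fatSymbol_apply (j : ℤ) (ν : RSpace d) :
    L.fatSymbol j ν = L.blockSymbol (j - 1) ν + L.blockSymbol j ν + L.blockSymbol (j + 1) ν := rfl

lemma norm_low_arg (j : ℤ) (ν : RSpace d) :
    ‖((2 : ℝ) ^ (-j)) • ((2 * Real.pi) • ν)‖ = (2 * Real.pi * ‖ν‖) / 2 ^ j := by
  rw [norm_smul, norm_smul, Real.norm_of_nonneg (by positivity),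
    Real.norm_of_nonneg (by positivity), zpow_neg]
  ring

lemma lowSymbol_eq_one {j : ℤ} {ν : RSpace d} (h : 2 * Real.pi * ‖ν‖ ≤ 3 / 4 * 2 ^ j) :
    L.lowSymbol j ν = 1 := by
  rw [lowSymbol_apply, L.eq_one, Complex.ofReal_one]
  rw [norm_low_arg, div_le_iff₀ (by positivity)]
  exact h

lemma lowSymbol_eq_zero {j : ℤ} {ν : RSpace d} (h : 4 / 3 * 2 ^ j ≤ 2 * Real.pi * ‖ν‖) :
    L.lowSymbol j ν = 0 := by
  rw [lowSymbol_apply]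
  have : ((2 : ℝ) ^ (-j)) • ((2 * Real.pi) • ν) ∉ tsupport L.χ := by
    intro hmem
    have := mem_ball_zero_iff.1 (L.tsupport_subset hmem)
    rw [norm_low_arg, div_lt_iff₀ (by positivity)] at this
    linarith
  rw [image_eq_zero_of_notMem_tsupport this, Complex.ofReal_zero]

lemma zpow_mono_two {j k : ℤ} (h : j ≤ k) : (2 : ℝ) ^ j ≤ 2 ^ k :=
  zpow_le_zpow_right₀ one_le_two h

lemma lt_of_blockSymbol_ne_zero {j : ℤ} {ν : RSpace d} (h : L.blockSymbol j ν ≠ 0) :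
    3 / 4 * 2 ^ j < 2 * Real.pi * ‖ν‖ ∧ 2 * Real.pi * ‖ν‖ < 8 / 3 * 2 ^ j := by
  have e : (2 : ℝ) ^ (j + 1) = 2 * 2 ^ j := by rw [zpow_add₀ two_ne_zero, zpow_one]; ring
  have hpos : (0 : ℝ) < 2 ^ j := by positivity
  constructor
  · by_contra! h'
    apply h
    rw [blockSymbol_apply, L.lowSymbol_eq_one h', L.lowSymbol_eq_one (by rw [e]; linarith), sub_self]
  · by_contra! h'
    apply h
    rw [blockSymbol_apply, L.lowSymbol_eq_zero (by rw [e]; linarith),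
      L.lowSymbol_eq_zero (by linarith), sub_self]

lemma lt_of_lowSymbol_ne_zero {j : ℤ} {ν : RSpace d} (h : L.lowSymbol j ν ≠ 0) :
    2 * Real.pi * ‖ν‖ < 4 / 3 * 2 ^ j := by
  by_contra! h'
  exact h (L.lowSymbol_eq_zero h')

lemma fatSymbol_eq_low (j : ℤ) (ν : RSpace d) :
    L.fatSymbol j ν = L.lowSymbol (j + 2) ν - L.lowSymbol (j - 1) ν := by
  rw [fatSymbol_apply, blockSymbol_apply, blockSymbol_apply, blockSymbol_apply, sub_add_cancel,
    show j + 2 = j + 1 + 1 by ring]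
  ring

lemma blockSymbol_mul_fatSymbol (j : ℤ) (ν : RSpace d) :
    L.blockSymbol j ν * L.fatSymbol j ν = L.blockSymbol j ν := by
  by_cases h : L.blockSymbol j ν = 0
  · rw [h, zero_mul]
  obtain ⟨h1, h2⟩ := L.lt_of_blockSymbol_ne_zero h
  have e2 : (2 : ℝ) ^ (j + 2) = 4 * 2 ^ j := by rw [zpow_add₀ two_ne_zero]; norm_num; ring
  have e1 : (2 : ℝ) ^ (j - 1) = 2 ^ j / 2 := by rw [zpow_sub₀ two_ne_zero, zpow_one]
  have hpos : (0 : ℝ) < 2 ^ j := by positivity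
  rw [fatSymbol_eq_low, L.lowSymbol_eq_one (by rw [e2]; linarith),
    L.lowSymbol_eq_zero (by rw [e1]; linarith), sub_zero, mul_one]

lemma blockSymbol_mul_blockSymbol {j k : ℤ} (h : j + 2 ≤ k ∨ k + 2 ≤ j) (ν : RSpace d) :
    L.blockSymbol j ν * L.blockSymbol k ν = 0 := by
  have key : ∀ {j k : ℤ}, j + 2 ≤ k → L.blockSymbol j ν * L.blockSymbol k ν = 0 := by
    intro j k h
    by_contra hne
    obtain ⟨h1, h2⟩ := not_or.1 (mt mul_eq_zero.2 hne)
    have h3 := (L.lt_of_blockSymbol_ne_zero h1).2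
    have h4 := (L.lt_of_blockSymbol_ne_zero h2).1
    have e2 : (2 : ℝ) ^ (j + 2) = 4 * 2 ^ j := by rw [zpow_add₀ two_ne_zero]; norm_num; ring
    have h5 := zpow_mono_two h
    have hpos : (0 : ℝ) < 2 ^ j := by positivity
    linarith
  rcases h with h | h
  · exact key h
  · rw [mul_comm]; exact key h

lemma lowSymbol_mul_blockSymbol_of_lt {j k : ℤ} (h : j < k) (ν : RSpace d) :
    L.lowSymbol j ν * L.blockSymbol k ν = 0 := by
  by_contra hne
  obtain ⟨h1, h2⟩ := not_or.1 (mt mul_eq_zero.2 hne)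
  have h3 := L.lt_of_lowSymbol_ne_zero h1
  have h4 := (L.lt_of_blockSymbol_ne_zero h2).1
  have h5 : (2 : ℝ) ^ j ≤ 2 ^ (k - 1) := zpow_mono_two (by omega)
  rw [zpow_sub₀ two_ne_zero, zpow_one] at h5
  have hpos : (0 : ℝ) < 2 ^ k := by positivity
  linarith

lemma norm_two_pi_add_le (ξ η : RSpace d) :
    2 * Real.pi * ‖ξ + η‖ ≤ 2 * Real.pi * ‖ξ‖ + 2 * Real.pi * ‖η‖ := by
  rw [← mul_add]
  exact mul_le_mul_of_nonneg_left (norm_add_le _ _) (by positivity)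

lemma norm_two_pi_sub_le (ξ η : RSpace d) :
    2 * Real.pi * ‖η‖ - 2 * Real.pi * ‖ξ‖ ≤ 2 * Real.pi * ‖ξ + η‖ := by
  have h : ‖η‖ ≤ ‖ξ + η‖ + ‖ξ‖ := by
    have := norm_sub_le (ξ + η) ξ
    rwa [add_sub_cancel_left] at this
  nlinarith [Real.pi_pos]

/-- The product of two blocks has no frequencies much above theirs. -/
lemma block_mul_block_eq_zero_of_le {m j k : ℤ} (hj : j + 3 ≤ m) (hk : k + 3 ≤ m)
    (ξ η : RSpace d) : L.blockSymbol m (ξ + η) * L.blockSymbol j ξ * L.blockSymbol k η = 0 := by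
  by_contra hne
  obtain ⟨h1, h2⟩ := not_or.1 (mt mul_eq_zero.2 hne)
  obtain ⟨h0, h1⟩ := not_or.1 (mt mul_eq_zero.2 h1)
  have a0 := (L.lt_of_blockSymbol_ne_zero h0).1
  have a1 := (L.lt_of_blockSymbol_ne_zero h1).2
  have a2 := (L.lt_of_blockSymbol_ne_zero h2).2
  have b := norm_two_pi_add_le ξ η
  have b1 := zpow_mono_two hj
  have b2 := zpow_mono_two hk
  have e1 : (2 : ℝ) ^ (j + 3) = 8 * 2 ^ j := by rw [zpow_add₀ two_ne_zero]; norm_num; ring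
  have e2 : (2 : ℝ) ^ (k + 3) = 8 * 2 ^ k := by rw [zpow_add₀ two_ne_zero]; norm_num; ring
  have hpos : (0 : ℝ) < 2 ^ m := by positivity
  linarith

/-- The product of a block of low frequency and one of high frequency is localized at the high
frequency. -/
lemma block_mul_block_eq_zero_of_far {m j k : ℤ} (hj : j + 3 ≤ k) (hm : m + 3 ≤ k ∨ k + 3 ≤ m)
    (ξ η : RSpace d) : L.blockSymbol m (ξ + η) * L.blockSymbol j ξ * L.blockSymbol k η = 0 := by
  rcases hm with hm | hm
  · by_contra hne
    obtain ⟨h1, h2⟩ := not_or.1 (mt mul_eq_zero.2 hne)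
    obtain ⟨h0, h1⟩ := not_or.1 (mt mul_eq_zero.2 h1)
    have a0 := (L.lt_of_blockSymbol_ne_zero h0).2
    have a1 := (L.lt_of_blockSymbol_ne_zero h1).2
    have a2 := (L.lt_of_blockSymbol_ne_zero h2).1
    have b := norm_two_pi_sub_le ξ η
    have b1 := zpow_mono_two hj
    have b2 := zpow_mono_two hm
    have e1 : (2 : ℝ) ^ (j + 3) = 8 * 2 ^ j := by rw [zpow_add₀ two_ne_zero]; norm_num; ring
    have e2 : (2 : ℝ) ^ (m + 3) = 8 * 2 ^ m := by rw [zpow_add₀ two_ne_zero]; norm_num; ring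
    have hpos : (0 : ℝ) < 2 ^ k := by positivity
    linarith
  · exact L.block_mul_block_eq_zero_of_le (by omega) hm ξ η

lemma blockSymbol_hasCompactSupport (j : ℤ) : HasCompactSupport (L.blockSymbol j) :=
  (L.lowFun_hasCompactSupport (j + 1)).sub (L.lowFun_hasCompactSupport j)

lemma fatSymbol_hasCompactSupport (j : ℤ) : HasCompactSupport (L.fatSymbol j) :=
  ((L.blockSymbol_hasCompactSupport (j - 1)).add (L.blockSymbol_hasCompactSupport j)).add
    (L.blockSymbol_hasCompactSupport (j + 1))

lemma lowSymbol_eq_dilate (j : ℤ) : (L.lowSymbol j : RSpace d → ℂ) = dilate j (L.lowSymbol 0) := by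
  ext ν
  rw [dilate, lowSymbol_apply, lowSymbol_apply, neg_zero, zpow_zero, one_smul,
    smul_comm ((2 : ℝ) ^ (-j))]

lemma dilate_dilate (j k : ℤ) (m : RSpace d → ℂ) : dilate j (dilate k m) = dilate (j + k) m := by
  ext ν
  rw [dilate, dilate, dilate, smul_smul, neg_add, zpow_add₀ two_ne_zero, mul_comm]

lemma blockSymbol_eq_dilate (j : ℤ) :
    (L.blockSymbol j : RSpace d → ℂ) = dilate j (L.blockSymbol 0) := by
  ext ν
  rw [blockSymbol_apply, L.lowSymbol_eq_dilate (j + 1), L.lowSymbol_eq_dilate j,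
    ← dilate_dilate, ← L.lowSymbol_eq_dilate 1]
  rfl

lemma fatSymbol_eq_dilate (j : ℤ) :
    (L.fatSymbol j : RSpace d → ℂ) = dilate j (L.fatSymbol 0) := by
  ext ν
  rw [fatSymbol_apply, L.blockSymbol_eq_dilate (j - 1), L.blockSymbol_eq_dilate j,
    L.blockSymbol_eq_dilate (j + 1), sub_eq_add_neg j 1, ← dilate_dilate, ← dilate_dilate,
    ← L.blockSymbol_eq_dilate (-1), ← L.blockSymbol_eq_dilate 1]
  rfl

lemma lowSymbol_neg (j : ℤ) (ν : RSpace d) : L.lowSymbol j (-ν) = L.lowSymbol j ν := by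
  rw [lowSymbol_apply, lowSymbol_apply]
  congr 1
  refine L.radial _ _ ?_
  rw [norm_low_arg, norm_low_arg, norm_neg]

lemma blockSymbol_neg (j : ℤ) (ν : RSpace d) : L.blockSymbol j (-ν) = L.blockSymbol j ν := by
  rw [blockSymbol_apply, blockSymbol_apply, lowSymbol_neg, lowSymbol_neg]

lemma fatSymbol_neg (j : ℤ) (ν : RSpace d) : L.fatSymbol j (-ν) = L.fatSymbol j ν := by
  simp only [fatSymbol_apply, blockSymbol_neg]

/-- A constant bounding the kernels of all Littlewood-Paley symbols. -/
lemma exists_hasKernelBound : ∃ c : ℝ≥0, ∀ j : ℤ,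
    HasKernelBound (L.lowSymbol j) c (twoPow (j * d)) ∧
    HasKernelBound (L.blockSymbol j) c (twoPow (j * d)) ∧
    HasKernelBound (L.fatSymbol j) c (twoPow (j * d)) := by
  obtain ⟨c1, h1⟩ := exists_hasKernelBound_dilate (L.lowSymbol 0).isSymbol
  obtain ⟨c2, h2⟩ := exists_hasKernelBound_dilate (L.blockSymbol 0).isSymbol
  obtain ⟨c3, h3⟩ := exists_hasKernelBound_dilate (L.fatSymbol 0).isSymbol
  refine ⟨c1 + c2 + c3, fun j => ⟨?_, ?_, ?_⟩⟩
  · rw [L.lowSymbol_eq_dilate]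
    exact (h1 j).mono (by push_cast; exact le_add_right le_self_add)
  · rw [L.blockSymbol_eq_dilate]
    exact (h2 j).mono (by push_cast; exact le_add_right le_add_self)
  · rw [L.fatSymbol_eq_dilate]
    exact (h3 j).mono (by push_cast; exact le_add_self)

end LittlewoodPaley

/-! ### Blocks of a distribution -/

lemma enorm_le_eLpNorm_top {X : Type*} [TopologicalSpace X] [MeasureSpace X]
    [(volume : Measure X).IsOpenPosMeasure] {f : X → ℂ} (hf : Continuous f) (x : X) :
    ‖f x‖ₑ ≤ eLpNorm f ∞ volume := by
  by_contra! h
  have ho : IsOpen {y | eLpNorm f ∞ volume < ‖f y‖ₑ} := isOpen_lt continuous_const hf.enorm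
  have h0 : volume {y | eLpNorm f ∞ volume < ‖f y‖ₑ} = 0 := by
    rw [eLpNorm_exponent_top]
    have := ae_le_eLpNormEssSup (f := f) (μ := (volume : Measure X))
    rw [ae_iff] at this
    simpa [not_le] using this
  have := (ho.measure_eq_zero_iff volume).1 h0
  exact (this ▸ h : x ∈ (∅ : Set X))

lemma isBddCont_of_eLpNorm_top {X : Type*} [TopologicalSpace X] [MeasureSpace X]
    [(volume : Measure X).IsOpenPosMeasure] {f : X → ℂ} (hf : Continuous f)
    (h : eLpNorm f ∞ volume < ∞) : IsBddCont f := by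
  refine ⟨hf, (eLpNorm f ∞ volume).toReal, fun x => ?_⟩
  have h1 := ENNReal.toReal_mono h.ne (enorm_le_eLpNorm_top hf x)
  simpa using h1

lemma eLpNorm_top_le {X : Type*} [MeasureSpace X] {f : X → ℂ} {M : ℝ≥0∞} (h : ∀ x, ‖f x‖ₑ ≤ M) :
    eLpNorm f ∞ volume ≤ M := by
  rw [eLpNorm_exponent_top]
  exact essSup_le_of_ae_le _ (Eventually.of_forall h)

lemma IsBddCont.eLpNorm_top_lt {X : Type*} [TopologicalSpace X] [MeasureSpace X] {f : X → ℂ}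
    (hf : IsBddCont f) : eLpNorm f ∞ volume < ∞ := by
  obtain ⟨-, M, hM⟩ := hf
  refine (eLpNorm_top_le (M := ENNReal.ofReal M) fun x => ?_).trans_lt ENNReal.ofReal_lt_top
  rw [← ofReal_norm]
  exact ENNReal.ofReal_le_ofReal (hM x)

/-- Hölder's inequality. -/
lemma recipNorm_mul_le {X : Type*} [TopologicalSpace X] [MeasureSpace X] [OpensMeasurableSpace X]
    {f g : X → ℂ} (hf : Continuous f) (hg : Continuous g) {t₁ t₂ : ℝ}
    (h₁ : 0 ≤ t₁) (h₂ : 0 ≤ t₂) :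
    recipNorm (t₁ + t₂) (fun x => f x * g x) ≤ recipNorm t₁ f * recipNorm t₂ g := by
  have : ENNReal.HolderTriple (ENNReal.ofReal t₁)⁻¹ (ENNReal.ofReal t₂)⁻¹
      (ENNReal.ofReal (t₁ + t₂))⁻¹ := ⟨by
    rw [inv_inv, inv_inv, inv_inv, ENNReal.ofReal_add h₁ h₂]⟩
  exact eLpNorm_smul_le_mul_eLpNorm (f := g) (φ := f) hg.aestronglyMeasurable
    hf.aestronglyMeasurable

namespace LittlewoodPaley

variable {d : ℕ} (L : LittlewoodPaley d)

/-- The function `(Δ̇_{j-1} + Δ̇_j + Δ̇_{j+1})u`. -/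
def fatBlock (j : ℤ) (u : 𝓢'(RSpace d, ℂ)) (x : RSpace d) : ℂ :=
  L.dyadicBlock (j - 1) u x + L.dyadicBlock j u x + L.dyadicBlock (j + 1) u x

lemma schwartzMultiplier_add (m n : 𝓢(RSpace d, ℂ)) (u : 𝓢'(RSpace d, ℂ)) (x : RSpace d) :
    schwartzMultiplier (m + n) u x = schwartzMultiplier m u x + schwartzMultiplier n u x := by
  simp only [schwartzMultiplier, FourierTransform.fourier_add, map_add]

lemma schwartzMultiplier_sub (m n : 𝓢(RSpace d, ℂ)) (u : 𝓢'(RSpace d, ℂ)) (x : RSpace d) :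
    schwartzMultiplier (m - n) u x = schwartzMultiplier m u x - schwartzMultiplier n u x := by
  have h : 𝓕 (m - n) = 𝓕 m - 𝓕 n := map_sub (FourierTransform.fourierCLM ℂ 𝓢(RSpace d, ℂ)) m n
  simp only [schwartzMultiplier, h, map_sub]

lemma fatBlock_eq (j : ℤ) (u : 𝓢'(RSpace d, ℂ)) :
    L.fatBlock j u = schwartzMultiplier (L.fatSymbol j) u := by
  ext x
  rw [fatSymbol, schwartzMultiplier_add, schwartzMultiplier_add]
  rfl

lemma dyadicBlock_eq_multOp (j : ℤ) (u : 𝓢'(RSpace d, ℂ)) :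
    L.dyadicBlock j u = multOp (L.blockSymbol j) (L.fatBlock j u) := by
  rw [fatBlock_eq, multOp_schwartzMultiplier (L.blockSymbol j) (L.fatSymbol j) (L.blockSymbol j)
    fun ν => (L.blockSymbol_mul_fatSymbol j ν).symm]
  rfl

lemma continuous_dyadicBlock (j : ℤ) (u : 𝓢'(RSpace d, ℂ)) : Continuous (L.dyadicBlock j u) :=
  continuous_schwartzMultiplier _ _

lemma lowCut_succ (j : ℤ) (u : 𝓢'(RSpace d, ℂ)) (x : RSpace d) :
    L.lowCut (j + 1) u x = L.lowCut j u x + L.dyadicBlock j u x := by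
  rw [dyadicBlock, blockSymbol, schwartzMultiplier_sub, lowCut, lowCut]
  ring

lemma isBddCont_fatBlock {u : 𝓢'(RSpace d, ℂ)}
    (hu : ∀ j, eLpNorm (L.dyadicBlock j u) ∞ volume < ∞) (j : ℤ) : IsBddCont (L.fatBlock j u) :=
  ((isBddCont_of_eLpNorm_top (L.continuous_dyadicBlock _ u) (hu _)).add
    (isBddCont_of_eLpNorm_top (L.continuous_dyadicBlock _ u) (hu _))).add
    (isBddCont_of_eLpNorm_top (L.continuous_dyadicBlock _ u) (hu _))

lemma gevreyBlock_eq_multOp (α : ℝ) (j : ℤ) (u : 𝓢'(RSpace d, ℂ)) :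
    L.gevreyBlock α j u =
      multOp (fun ν => L.blockSymbol j ν * gevreySymbol α ν) (L.fatBlock j u) := rfl

/-- A distribution in `𝓢'₀` is the sum of its blocks. -/
lemma lowCut_eq_tsum {u : 𝓢'(RSpace d, ℂ)} (hu : L.MemS0 u) (n : ℤ) (x : RSpace d)
    (hs : Summable fun j : ℤ => if j < n then L.dyadicBlock j u x else 0) :
    L.lowCut n u x = ∑' j : ℤ, if j < n then L.dyadicBlock j u x else 0 := by
  have h1 : ∀ N : ℕ, L.lowCut n u x = L.lowCut (n - N) u x +
      ∑ j ∈ Finset.Ico (n - N) n, L.dyadicBlock j u x := by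
    intro N
    induction N with
    | zero => simp
    | succ N ih =>
      have e : Finset.Ico (n - ((N + 1 : ℕ) : ℤ)) n =
          insert (n - ((N + 1 : ℕ) : ℤ)) (Finset.Ico (n - N) n) := by
        ext i; simp only [Finset.mem_Ico, Finset.mem_insert]; push_cast; omega
      rw [e, Finset.sum_insert (by rw [Finset.mem_Ico]; push_cast; omega), ← add_assoc, ← lowCut_succ, ih]
      have e2 : n - ((N + 1 : ℕ) : ℤ) + 1 = n - N := by push_cast; ring
      rw [e2]
  have h2 : Tendsto (fun N : ℕ => n - (N : ℤ)) atTop atBot :=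
    tendsto_atBot.2 fun b => by
      filter_upwards [eventually_ge_atTop (n - b).toNat] with N hN
      omega
  have h3 : Tendsto (fun N : ℕ => L.lowCut (n - N) u x) atTop (𝓝 0) := by
    rw [tendsto_zero_iff_enorm_tendsto_zero]
    exact tendsto_of_tendsto_of_tendsto_of_le_of_le tendsto_const_nhds (hu.comp h2)
      (fun _ => zero_le) fun N =>
        enorm_le_eLpNorm_top (continuous_schwartzMultiplier _ _) x
  have h4 : Tendsto (fun N : ℕ => ∑ j ∈ Finset.Ico (n - (N : ℤ)) n,
      if j < n then L.dyadicBlock j u x else 0) atTop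
      (𝓝 (∑' j : ℤ, if j < n then L.dyadicBlock j u x else 0)) := by
    have hg : ∀ N : ℕ, ∑ j ∈ Finset.Ico (n - (N : ℤ)) n,
        (if j < n then L.dyadicBlock j u x else 0) =
        ∑ j ∈ Finset.Ico (n - (N : ℤ)) (n + N), (if j < n then L.dyadicBlock j u x else 0) := by
      intro N
      refine Finset.sum_subset (fun i hi => ?_) fun i hi hi' => ?_
      · rw [Finset.mem_Ico] at hi ⊢; omega
      · rw [Finset.mem_Ico] at hi hi'
        rw [if_neg]; omega
    simp_rw [hg]
    refine hs.hasSum.comp (tendsto_atTop_finset_of_monotone (fun N N' h => ?_) fun i => ?_)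
    · exact Finset.Ico_subset_Ico (by omega) (by omega)
    · exact ⟨(i - n).natAbs + 1, by rw [Finset.mem_Ico]; omega⟩
  refine tendsto_nhds_unique tendsto_const_nhds ((h3.add h4).congr fun N => ?_) |>.trans (zero_add _)
  rw [h1 N]
  congr 1
  exact Finset.sum_congr rfl fun j hj => if_pos (Finset.mem_Ico.1 hj).2

end LittlewoodPaley

/-! ### Products of blocks -/

/-- The interaction strength of the blocks `j` and `k` in the block `m` of a product: paraproduct of
low `j` with high `k`, resonant terms, and paraproduct of high `j` with low `k`. The first needs no
decay in `j`, over which the sum is taken in `ℓ¹`. -/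
def paraWeight (e : ℝ) (m j k : ℤ) : ℝ≥0∞ :=
  (if |m - k| ≤ 2 then 1 else 0) + (if |j - k| ≤ 2 then 1 else 0) +
    twoPow (-(e * |((j - k : ℤ) : ℝ)|))

lemma tsum_ite_abs_le (m : ℤ) : ∑' k : ℤ, (if |m - k| ≤ 2 then (1 : ℝ≥0∞) else 0) = 5 := by
  rw [tsum_eq_sum (s := Finset.Icc (m - 2) (m + 2))]
  · rw [Finset.sum_congr rfl (g := fun _ => (1 : ℝ≥0∞))]
    · simp
      rw [show m + 2 + 1 - (m - 2) = 5 by ring]; rfl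
    · intro k hk
      rw [Finset.mem_Icc] at hk
      rw [if_pos]; rw [abs_le]; omega
  · intro k hk
    rw [Finset.mem_Icc] at hk
    rw [if_neg]; rw [abs_le]; omega

lemma tsum_twoPow_neg_abs_ne_top {e : ℝ} (he : 0 < e) :
    ∑' n : ℤ, twoPow (-(e * |(n : ℝ)|)) ≠ ∞ := by
  have hr0 : 0 ≤ (2 : ℝ) ^ (-e) := by positivity
  have hr1 : (2 : ℝ) ^ (-e) < 1 := Real.rpow_lt_one_of_one_lt_of_neg one_lt_two (by linarith)
  have hs : Summable fun n : ℤ => (2 : ℝ) ^ (-(e * |(n : ℝ)|)) := by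
    have hg := summable_geometric_of_lt_one hr0 hr1
    have e1 : ∀ n : ℕ, ((2 : ℝ) ^ (-e)) ^ n = (2 : ℝ) ^ (-(e * |((n : ℤ) : ℝ)|)) := by
      intro n
      rw [← Real.rpow_natCast, ← Real.rpow_mul two_pos.le]
      congr 1
      rw [Int.cast_natCast, abs_of_nonneg (by positivity)]; ring
    refine Summable.of_nat_of_neg (hg.congr e1) (hg.congr fun n => ?_)
    rw [e1]; simp
  unfold twoPow
  rw [← ENNReal.ofReal_tsum_of_nonneg (fun n => by positivity) hs]
  exact ENNReal.ofReal_ne_top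

lemma exists_tsum_paraWeight_le {e : ℝ} (he : 0 < e) :
    ∃ Ω : ℝ≥0, ∀ m j : ℤ, ∑' k : ℤ, paraWeight e m j k ≤ Ω := by
  have hsum := tsum_twoPow_neg_abs_ne_top he
  refine ⟨5 + 5 + (∑' n : ℤ, twoPow (-(e * |(n : ℝ)|))).toNNReal, fun m j => ?_⟩
  unfold paraWeight
  rw [ENNReal.tsum_add, ENNReal.tsum_add, tsum_ite_abs_le, tsum_ite_abs_le, ENNReal.coe_add,
    ENNReal.coe_toNNReal hsum]
  have h := (Equiv.subLeft j).tsum_eq fun n : ℤ => twoPow (-(e * |(n : ℝ)|))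
  simp only [Equiv.subLeft_apply] at h
  rw [h]
  exact le_of_eq rfl

lemma exponent_low_high {x₁ x₂ y s₁ s₂ t₁ t₂ D E : ℝ} {m j k : ℤ} (ht : t₁ + t₂ = y)
    (hE : E = s₁ + s₂ - D * (x₁ + x₂) + D * y) (he : s₁ ≤ D * (x₁ - t₁)) (hjk : j ≤ k)
    (hm : |m - k| ≤ 2) :
    (j : ℝ) * (D * (x₁ - t₁) - s₁) + k * (D * (x₂ - t₂) - s₂) ≤ -(m * E) + 2 * |E| := by
  have h1 : (j : ℝ) * (D * (x₁ - t₁) - s₁) ≤ k * (D * (x₁ - t₁) - s₁) :=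
    mul_le_mul_of_nonneg_right (by exact_mod_cast hjk) (by linarith)
  have h2 : |((m - k : ℤ) : ℝ)| ≤ 2 := by exact_mod_cast hm
  have h3 : ((m - k : ℤ) : ℝ) * E ≤ 2 * |E| :=
    (le_abs_self _).trans (by rw [abs_mul]; gcongr)
  push_cast at h3
  have h4 : (k : ℝ) * (D * (x₁ - t₁) - s₁) + k * (D * (x₂ - t₂) - s₂) = -(k * E) := by
    rw [hE, ← ht]; ring
  linarith

lemma exponent_high_low {x₁ x₂ y s₁ s₂ t₁ t₂ D E : ℝ} {m j k : ℤ} (ht : t₁ + t₂ = y)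
    (hE : E = s₁ + s₂ - D * (x₁ + x₂) + D * y) (hjk : k ≤ j) (hm : |m - j| ≤ 2) :
    (j : ℝ) * (D * (x₁ - t₁) - s₁) + k * (D * (x₂ - t₂) - s₂) ≤
      -(m * E) + 2 * |E| + -((D * (x₂ - t₂) - s₂) * |((j - k : ℤ) : ℝ)|) := by
  have h2 : |((m - j : ℤ) : ℝ)| ≤ 2 := by exact_mod_cast hm
  have h3 : ((m - j : ℤ) : ℝ) * E ≤ 2 * |E| :=
    (le_abs_self _).trans (by rw [abs_mul]; gcongr)
  have h5 : |((j - k : ℤ) : ℝ)| = j - k := by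
    rw [abs_of_nonneg (by exact_mod_cast sub_nonneg.2 hjk)]; push_cast; rfl
  push_cast at h3
  rw [h5]
  have h4 : (j : ℝ) * (D * (x₁ - t₁) - s₁) + k * (D * (x₂ - t₂) - s₂) =
      -(j * E) - (D * (x₂ - t₂) - s₂) * (j - k) := by
    rw [hE, ← ht]; ring
  linarith

lemma exponent_resonant {x₁ x₂ y s₁ s₂ t₁ t₂ τ D E κ : ℝ} {m j k : ℤ} (ht : t₁ + t₂ = τ)
    (hE : E = s₁ + s₂ - D * (x₁ + x₂) + D * y) (hκ : κ = s₁ + s₂ - D * (x₁ + x₂) + D * τ)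
    (hκ0 : 0 ≤ κ) (hjk : |j - k| ≤ 2) (hm : m ≤ j + 4) :
    m * (D * (τ - y)) + (j : ℝ) * (D * (x₁ - t₁) - s₁) + k * (D * (x₂ - t₂) - s₂) ≤
      -(m * E) + (4 * κ + 2 * |D * (x₂ - t₂) - s₂|) := by
  have h2 : |((k - j : ℤ) : ℝ)| ≤ 2 := by rw [abs_sub_comm] at hjk; exact_mod_cast hjk
  have h3 : ((k - j : ℤ) : ℝ) * (D * (x₂ - t₂) - s₂) ≤ 2 * |D * (x₂ - t₂) - s₂| :=
    (le_abs_self _).trans (by rw [abs_mul]; gcongr)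
  have h1 : (m : ℝ) * κ ≤ (j + 4) * κ :=
    mul_le_mul_of_nonneg_right (by exact_mod_cast hm) hκ0
  push_cast at h3
  have h4 : m * (D * (τ - y)) + (j : ℝ) * (D * (x₁ - t₁) - s₁) + k * (D * (x₂ - t₂) - s₂) =
      -(m * E) + m * κ - j * κ + (k - j) * (D * (x₂ - t₂) - s₂) := by
    rw [hE, hκ, ← ht]; ring
  linarith

section Product

variable {d : ℕ} {L : LittlewoodPaley d} {c : ℝ≥0}

/-- Bernstein's inequality for functions with frequencies in the annulus of index `j`. -/
lemma recipNorm_le_of_fat (hc : ∀ j : ℤ, HasKernelBound (L.fatSymbol j) c (twoPow (j * d)))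
    {j : ℤ} {f : RSpace d → ℂ} (hf : IsBddCont f) (hfat : multOp (L.fatSymbol j) f = f) {t t' : ℝ}
    (ht : 0 < t) (ht1 : t ≤ 1) (ht' : 0 ≤ t') (htt : t' ≤ t) :
    recipNorm t' f ≤ c * twoPow (j * (d * (t - t'))) * recipNorm t f := by
  have := (hc j).recipNorm_le hf ht ht1 ht' htt
  rwa [hfat, twoPow_rpow, mul_assoc (j : ℝ)] at this

lemma recipNorm_product_le (hc : ∀ j : ℤ, HasKernelBound (L.fatSymbol j) c (twoPow (j * d)))
    {m j k : ℤ} {T f g : RSpace d → ℂ} (hT : HasKernelBound T c (twoPow (m * d)))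
    (hf : IsBddCont f) (hg : IsBddCont g) (hff : multOp (L.fatSymbol j) f = f)
    (hgg : multOp (L.fatSymbol k) g = g) {x₁ x₂ y t₁ t₂ τ s₁ s₂ : ℝ} (hx₁ : 0 < x₁) (hx₁' : x₁ ≤ 1)
    (hx₂ : 0 < x₂) (hx₂' : x₂ ≤ 1) (hy : 0 < y) (hyτ : y ≤ τ) (hτ : τ ≤ 1) (ht : t₁ + t₂ = τ)
    (ht₁ : 0 ≤ t₁) (htx₁ : t₁ ≤ x₁) (ht₂ : 0 ≤ t₂) (htx₂ : t₂ ≤ x₂) {a b : ℝ≥0∞}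
    (ha : recipNorm x₁ f ≤ twoPow (-(j * s₁)) * a) (hb : recipNorm x₂ g ≤ twoPow (-(k * s₂)) * b) :
    recipNorm y (multOp T fun x => f x * g x) ≤
      c ^ 3 * twoPow (m * (d * (τ - y)) + j * (d * (x₁ - t₁) - s₁) + k * (d * (x₂ - t₂) - s₂)) *
        (a * b) := by
  have h1 := hT.recipNorm_le (hf.mul hg) (hy.trans_le hyτ) hτ hy.le hyτ
  have h2 := recipNorm_mul_le hf.1 hg.1 ht₁ ht₂
  have h3 := recipNorm_le_of_fat hc hf hff hx₁ hx₁' ht₁ htx₁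
  have h4 := recipNorm_le_of_fat hc hg hgg hx₂ hx₂' ht₂ htx₂
  rw [ht] at h2
  rw [twoPow_rpow] at h1
  calc recipNorm y (multOp T fun x => f x * g x)
      ≤ c * twoPow (m * d * (τ - y)) * ((c * twoPow (j * (d * (x₁ - t₁))) *
          (twoPow (-(j * s₁)) * a)) * (c * twoPow (k * (d * (x₂ - t₂))) *
          (twoPow (-(k * s₂)) * b))) := by
        refine h1.trans ?_
        gcongr
        refine h2.trans ?_
        gcongr
        · exact h3.trans (by gcongr)
        · exact h4.trans (by gcongr)
    _ = c ^ 3 * (twoPow (m * d * (τ - y)) * (twoPow (j * (d * (x₁ - t₁))) * twoPow (-(j * s₁))) *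
          (twoPow (k * (d * (x₂ - t₂))) * twoPow (-(k * s₂)))) * (a * b) := by ring
    _ = _ := by
        rw [← twoPow_add, ← twoPow_add, ← twoPow_add, ← twoPow_add]
        congr 3
        ring

/-- The indices `m`, `j`, `k` for which the frequency supports force the block `m` of the product of a
block `j` and a block `k` to vanish. -/
def FarApart (m j k : ℤ) : Prop :=
  (j + 3 ≤ m ∧ k + 3 ≤ m) ∨ (j + 3 ≤ k ∧ (m + 3 ≤ k ∨ k + 3 ≤ m)) ∨
    (k + 3 ≤ j ∧ (m + 3 ≤ j ∨ j + 3 ≤ m))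

/-- The exponents of the product law: `x₁`, `x₂` and `y` are reciprocal Lebesgue exponents and
`s₁`, `s₂` regularities. The bounds on `s₁` and `s₂` control the two paraproducts, those on `s₁ + s₂`
the resonant terms. -/
structure ProductExponents (d : ℕ) (x₁ x₂ y s₁ s₂ : ℝ) : Prop where
  x₁_pos : 0 < x₁
  x₁_lt : x₁ < 1
  x₂_pos : 0 < x₂
  x₂_lt : x₂ < 1
  y_pos : 0 < y
  y_lt : y < 1
  y_le : y ≤ x₁ + x₂
  s₁_le : s₁ ≤ d * x₁
  s₁_le' : s₁ ≤ d * (x₁ + x₂ - y)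
  s₂_lt : s₂ < d * x₂
  s₂_lt' : s₂ < d * (x₁ + x₂ - y)
  nonneg : 0 ≤ s₁ + s₂
  le_add : d * (x₁ + x₂ - 1) ≤ s₁ + s₂

/-- Paraproduct and resonance estimates for the blocks of a product. -/
lemma exists_product_bound {x₁ x₂ y s₁ s₂ : ℝ} (P : ProductExponents d x₁ x₂ y s₁ s₂)
    (hc : ∀ j : ℤ, HasKernelBound (L.fatSymbol j) c (twoPow (j * d))) :
    ∃ e : ℝ, 0 < e ∧ ∃ K : ℝ≥0, ∀ (m j k : ℤ) (T f g : RSpace d → ℂ) (a b : ℝ≥0∞),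
      HasKernelBound T c (twoPow (m * d)) → IsBddCont f → IsBddCont g →
      multOp (L.fatSymbol j) f = f → multOp (L.fatSymbol k) g = g →
      (FarApart m j k → ∀ x, multOp T (fun x => f x * g x) x = 0) →
      recipNorm x₁ f ≤ twoPow (-(j * s₁)) * a → recipNorm x₂ g ≤ twoPow (-(k * s₂)) * b →
      recipNorm y (multOp T fun x => f x * g x) ≤
        K * twoPow (-(m * (s₁ + s₂ - d * (x₁ + x₂) + d * y))) * (a * b) * paraWeight e m j k := by
  obtain ⟨hx₁, hx₁', hx₂, hx₂', hy, hy', hyx, hs₁, hs₁', hs₂, hs₂', h0, h1⟩ := P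
  set E := s₁ + s₂ - d * (x₁ + x₂) + d * y with hE
  set τ := min 1 (x₁ + x₂) with hτ
  set κ := s₁ + s₂ - d * (x₁ + x₂) + d * τ with hκ
  have hd : (0 : ℝ) ≤ d := Nat.cast_nonneg d
  have hκ0 : 0 ≤ κ := by
    rcases le_total 1 (x₁ + x₂) with h | h
    · rw [hκ, hτ, min_eq_left h]; linarith
    · rw [hκ, hτ, min_eq_right h]; linarith
  have hyτ : y ≤ τ := le_min hy'.le hyx
  have hτ1 : τ ≤ 1 := min_le_left _ _
  have hτx : τ ≤ x₁ + x₂ := min_le_right _ _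
  have hτ0 : 0 < τ := hy.trans_le hyτ
  -- the exponents for the product of low frequencies `j` and high frequencies `k`
  set u := max 0 (y - x₂) with hu
  -- the exponents for the product of high frequencies `j` and low frequencies `k`
  set v := max 0 (y - x₁) with hv
  -- the exponents for the product of comparable frequencies
  set w := x₂ * (τ / (x₁ + x₂)) with hw
  have hu0 : 0 ≤ u := le_max_left _ _
  have hv0 : 0 ≤ v := le_max_left _ _
  have hux : u ≤ x₁ := max_le hx₁.le (by linarith)
  have hvx : v ≤ x₂ := max_le hx₂.le (by linarith)
  have huy : u ≤ y := max_le hy.le (by linarith)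
  have hvy : v ≤ y := max_le hy.le (by linarith)
  have huy' : y - u ≤ x₂ := by have := le_max_right 0 (y - x₂); linarith
  have hvy' : y - v ≤ x₁ := by have := le_max_right 0 (y - x₁); linarith
  have hus : s₁ ≤ d * (x₁ - u) := by
    rcases max_choice 0 (y - x₂) with h | h
    · rw [hu, h, sub_zero]; exact hs₁
    · rw [hu, h]; convert hs₁' using 2; ring
  have hvs : s₂ < d * (x₂ - v) := by
    rcases max_choice 0 (y - x₁) with h | h
    · rw [hv, h, sub_zero]; exact hs₂
    · rw [hv, h]; convert hs₂' using 2; ring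
  have hq : τ / (x₁ + x₂) ≤ 1 := (div_le_one (by linarith)).2 hτx
  have hq0 : 0 < τ / (x₁ + x₂) := by positivity
  have hw0 : 0 ≤ w := by positivity
  have hwx : w ≤ x₂ := mul_le_of_le_one_right hx₂.le hq
  have hwτ : τ - w = x₁ * (τ / (x₁ + x₂)) := by
    rw [hw]; field_simp; ring
  have hwx' : τ - w ≤ x₁ := by rw [hwτ]; exact mul_le_of_le_one_right hx₁.le hq
  have hwτ0 : 0 ≤ τ - w := by rw [hwτ]; positivity
  set Q := 2 * |E| + (4 * κ + 2 * |d * (x₂ - w) - s₂|) with hQ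
  have hQE : 2 * |E| ≤ Q := le_add_of_nonneg_right (by positivity)
  have hQE' : (4 * κ + 2 * |d * (x₂ - w) - s₂|) ≤ Q := le_add_of_nonneg_left (by positivity)
  refine ⟨d * (x₂ - v) - s₂, by linarith, c ^ 3 * (twoPow Q).toNNReal, ?_⟩
  intro m j k T f g a b hT hf hg hff hgg hfar ha hb
  rw [ENNReal.coe_mul, ENNReal.coe_toNNReal (twoPow_ne_top Q), ENNReal.coe_pow]
  by_cases hF : FarApart m j k
  · have : (multOp T fun x => f x * g x) = fun _ => 0 := funext (hfar hF)
    rw [this]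
    simp [recipNorm]
  have hfin : ∀ {X w : ℝ} {W : ℝ≥0∞}, X ≤ -(m * E) + Q + w → twoPow w ≤ W →
      (c : ℝ≥0∞) ^ 3 * twoPow X * (a * b) ≤
        (c ^ 3 * twoPow Q) * twoPow (-(m * E)) * (a * b) * W := by
    intro X w W hX hW
    calc (c : ℝ≥0∞) ^ 3 * twoPow X * (a * b)
        ≤ (c : ℝ≥0∞) ^ 3 * twoPow (-(m * E) + Q + w) * (a * b) := by
          gcongr; exact twoPow_mono hX
      _ = (c ^ 3 * twoPow Q) * twoPow (-(m * E)) * (a * b) * twoPow w := by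
          rw [twoPow_add, twoPow_add]; ring
      _ ≤ _ := by gcongr
  rw [FarApart] at hF
  rcases lt_or_ge j (k - 2) with hjk | hjk
  · have hmk : |m - k| ≤ 2 := by rw [abs_le]; omega
    refine (recipNorm_product_le (t₁ := u) (t₂ := y - u) (τ := y) hc hT hf hg hff hgg hx₁ hx₁'.le
      hx₂ hx₂'.le hy le_rfl hy'.le (by ring) hu0 hux (by linarith) huy' ha hb).trans ?_
    have hX := exponent_low_high (x₂ := x₂) (s₂ := s₂) (t₂ := y - u) (y := y) (by ring) hE hus
      (by omega : j ≤ k) hmk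
    refine hfin (w := 0) ?_ ?_
    · rw [sub_self, mul_zero, mul_zero]; linarith
    · rw [twoPow_zero, paraWeight, if_pos hmk, add_assoc]
      exact le_self_add
  rcases lt_or_ge k (j - 2) with hkj | hkj
  · have hmj : |m - j| ≤ 2 := by rw [abs_le]; omega
    refine (recipNorm_product_le (t₁ := y - v) (t₂ := v) (τ := y) hc hT hf hg hff hgg hx₁ hx₁'.le
      hx₂ hx₂'.le hy le_rfl hy'.le (by ring) (by linarith) hvy' hv0 hvx ha hb).trans ?_
    have hX := exponent_high_low (x₁ := x₁) (s₁ := s₁) (s₂ := s₂) (x₂ := x₂) (t₁ := y - v)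
      (t₂ := v) (y := y) (by ring) hE (by omega : k ≤ j) hmj
    refine hfin (w := -((d * (x₂ - v) - s₂) * |((j - k : ℤ) : ℝ)|)) ?_ ?_
    · rw [sub_self, mul_zero, mul_zero]; linarith
    · rw [paraWeight]
      exact le_add_self
  · have hjk' : |j - k| ≤ 2 := by rw [abs_le]; omega
    refine (recipNorm_product_le (t₁ := τ - w) (t₂ := w) (τ := τ) hc hT hf hg hff hgg hx₁ hx₁'.le
      hx₂ hx₂'.le hy hyτ hτ1 (by ring) hwτ0 hwx' hw0 hwx ha hb).trans ?_
    have hX := exponent_resonant (x₁ := x₁) (s₁ := s₁) (s₂ := s₂) (x₂ := x₂) (t₁ := τ - w)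
      (t₂ := w) (y := y) (by ring) hE hκ hκ0 hjk' (by omega : m ≤ j + 4)
    refine hfin (w := 0) ?_ ?_
    · linarith
    · rw [twoPow_zero, paraWeight, if_pos hjk', add_comm _ (1 : ℝ≥0∞), add_assoc]
      exact le_self_add

end Product

/-! ### Distributions with prescribed blocks -/

section Transpose

variable {d : ℕ}

lemma multOp_schwartz {m : RSpace d → ℂ} (hm : IsSymbol m) (ψ : 𝓢(RSpace d, ℂ)) :
    multOp m ψ = 𝓕⁻ (fun ν => m ν * 𝓕 ψ ν) := by
  have h1 : (ψ : RSpace d → ℂ) = 𝓕⁻ ((𝓕 ψ : 𝓢(RSpace d, ℂ)) : RSpace d → ℂ) := by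
    rw [← SchwartzMap.fourierInv_coe]; simp
  rw [multOp]
  conv_lhs => rw [h1]
  rw [conv_fourierInv hm.kerInt (𝓕 ψ).integrable, hm.fourier_ker]

lemma fourierInv_even {m : RSpace d → ℂ} (he : ∀ ν, m (-ν) = m ν) (x : RSpace d) :
    𝓕⁻ m (-x) = 𝓕⁻ m x := by
  rw [fourierInv_eq_integral_mul, fourierInv_eq_integral_mul, ← integral_neg_eq_self]
  congr 1; ext ν
  rw [he, inner_neg_neg]

lemma integrable_mul_comp_add {k f : RSpace d → ℂ} (hk : Integrable k) (hkc : Continuous k)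
    (hf : Integrable f) (hfc : Continuous f) :
    Integrable (fun z : RSpace d × RSpace d => k z.1 * f (z.2 + z.1)) (volume.prod volume) := by
  have hc : Continuous fun z : RSpace d × RSpace d => k z.1 * f (z.2 + z.1) :=
    (hkc.comp continuous_fst).mul (hfc.comp (continuous_snd.add continuous_fst))
  rw [integrable_prod_iff hc.aestronglyMeasurable]
  refine ⟨Eventually.of_forall fun y => (hf.comp_add_right y).const_mul (k y), ?_⟩
  have h : ∀ y : RSpace d, ∫ x, ‖k y * f (x + y)‖ = ‖k y‖ * ∫ x, ‖f x‖ := by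
    intro y
    simp_rw [norm_mul]
    rw [integral_const_mul, integral_add_right_eq_self (fun x => ‖f x‖)]
  simp_rw [h]
  exact hk.norm.mul_const _

/-- A multiplier with even symbol is its own transpose. -/
lemma integral_multOp_mul {m : RSpace d → ℂ} (hm : IsSymbol m) (he : ∀ ν, m (-ν) = m ν)
    {v : RSpace d → ℂ} (hv : IsBddCont v) (ψ : 𝓢(RSpace d, ℂ)) :
    ∫ x, multOp m v x * ψ x = ∫ x, v x * multOp m ψ x := by
  obtain ⟨hvc, M, hM⟩ := hv
  set k := 𝓕⁻ m with hk
  have hki : Integrable k := hm.kerInt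
  have hkc : Continuous k := hm.continuous_ker
  have i1 : Integrable (Function.uncurry fun x y : RSpace d => k y * v (x - y) * ψ x)
      (volume.prod volume) := by
    have h := (ψ.integrable (μ := volume)).mul_prod hki
    refine (h.mul_bdd (c := M) (g := fun z : RSpace d × RSpace d => v (z.1 - z.2)) ?_ ?_).congr ?_
    · exact (hvc.comp (by fun_prop)).aestronglyMeasurable
    · exact Eventually.of_forall fun z => hM _
    · exact Eventually.of_forall fun z => by simp only [Function.uncurry]; ring
  have i2 : Integrable (Function.uncurry fun y x : RSpace d => k y * v x * ψ (x + y))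
      (volume.prod volume) := by
    have h0 : Integrable (fun z : RSpace d × RSpace d => k z.1 * ψ (z.2 + z.1))
        (volume.prod volume) := integrable_mul_comp_add hki hkc ψ.integrable ψ.continuous
    refine (h0.mul_bdd (c := M) (g := fun z : RSpace d × RSpace d => v z.2) ?_ ?_).congr ?_
    · exact (hvc.comp continuous_snd).aestronglyMeasurable
    · exact Eventually.of_forall fun z => hM _
    · exact Eventually.of_forall fun z => by simp only [Function.uncurry]; ring
  calc ∫ x, multOp m v x * ψ x = ∫ x, ∫ y, k y * v (x - y) * ψ x := by
        congr 1; ext x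
        rw [integral_mul_const]; rfl
    _ = ∫ y, ∫ x, k y * v (x - y) * ψ x := integral_integral_swap i1
    _ = ∫ y, ∫ x, k y * v x * ψ (x + y) := by
        congr 1; ext y
        rw [← integral_add_right_eq_self _ y]
        simp
    _ = ∫ x, ∫ y, k y * v x * ψ (x + y) := integral_integral_swap i2
    _ = ∫ x, v x * multOp m ψ x := by
        congr 1; ext x
        rw [multOp, conv, ← integral_const_mul, ← integral_neg_eq_self]
        congr 1; ext y
        rw [hk, fourierInv_even he, sub_eq_add_neg]
        ring

/-- The operator with symbol `‖ν‖^{2N}`, a power of the Laplacian up to normalization. -/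
def laplacePow (N : ℕ) : 𝓢(RSpace d, ℂ) →L[ℂ] 𝓢(RSpace d, ℂ) :=
  SchwartzMap.fourierMultiplierCLM ℂ (fun ν : RSpace d => (((‖ν‖ ^ 2) ^ N : ℝ) : ℂ))

lemma fourier_laplacePow (N : ℕ) (ψ : 𝓢(RSpace d, ℂ)) (ν : RSpace d) :
    𝓕 (laplacePow N ψ) ν = (((‖ν‖ ^ 2) ^ N : ℝ) : ℂ) * 𝓕 ψ ν := by
  have h : (fun ν : RSpace d => (((‖ν‖ ^ 2) ^ N : ℝ) : ℂ)).HasTemperateGrowth := by fun_prop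
  rw [laplacePow, SchwartzMap.fourierMultiplierCLM_apply]
  simp only [FourierTransform.fourier_fourierInv_eq]
  rw [SchwartzMap.smulLeftCLM_apply_apply h, smul_eq_mul]

variable (L : LittlewoodPaley d)

lemma isSymbol_fat_div (N : ℕ) :
    IsSymbol (fun ν => L.fatSymbol 0 ν * (((‖ν‖ ^ 2) ^ N : ℝ) : ℂ)⁻¹) := by
  refine isSymbol_of_contDiff ?_ (L.fatSymbol_hasCompactSupport 0).mul_right
  rw [contDiff_iff_contDiffAt]
  intro ν
  by_cases hν : ν = 0
  · have h0 : (fun ν => L.fatSymbol 0 ν * (((‖ν‖ ^ 2) ^ N : ℝ) : ℂ)⁻¹) =ᶠ[𝓝 ν] fun _ => 0 := by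
      have hc : Continuous fun η : RSpace d => 2 * Real.pi * ‖η‖ := by fun_prop
      have : ∀ᶠ η in 𝓝 ν, 2 * Real.pi * ‖η‖ < 3 / 8 := by
        refine hc.continuousAt.eventually_lt continuousAt_const ?_
        rw [hν]; norm_num
      filter_upwards [this] with η hη
      rw [L.fatSymbol_eq_low, L.lowSymbol_eq_one (by norm_num; linarith),
        L.lowSymbol_eq_one (by norm_num; linarith), sub_self, zero_mul]
    exact contDiffAt_const.congr_of_eventuallyEq h0
  · refine ((L.fatSymbol 0).smooth ⊤).contDiffAt.mul (ContDiffAt.inv ?_ ?_)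
    · exact (Complex.ofRealCLM.contDiff.comp ((contDiff_norm_sq ℝ).pow N)).contDiffAt
    · have : ‖ν‖ ≠ 0 := norm_ne_zero_iff.2 hν
      exact_mod_cast pow_ne_zero N (pow_ne_zero 2 this)

/-- The blocks of a Schwartz function decay rapidly at high frequency. -/
lemma exists_lintegral_fat_le (N : ℕ) : ∃ c : ℝ≥0, ∀ (m : ℤ) (ψ : 𝓢(RSpace d, ℂ)),
    ∫⁻ x, ‖multOp (L.fatSymbol m) ψ x‖ₑ ≤
      c * twoPow (-(m * (2 * N))) * ∫⁻ x, ‖laplacePow N ψ x‖ₑ := by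
  obtain ⟨c, hc⟩ := exists_hasKernelBound_dilate (isSymbol_fat_div L N)
  refine ⟨c, fun m ψ => ?_⟩
  set θ := dilate m (fun ν => L.fatSymbol 0 ν * (((‖ν‖ ^ 2) ^ N : ℝ) : ℂ)⁻¹) with hθ
  set r : ℂ := (((2 : ℝ) ^ (-((m : ℝ) * (2 * N))) : ℝ) : ℂ) with hr
  have hsym : ∀ ν, L.fatSymbol m ν = r * θ ν * (((‖ν‖ ^ 2) ^ N : ℝ) : ℂ) := by
    intro ν
    rw [hθ, dilate, L.fatSymbol_eq_dilate m, dilate]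
    by_cases hν : ν = 0
    · rw [hν, smul_zero]
      have : L.fatSymbol 0 (0 : RSpace d) = 0 := by
        rw [L.fatSymbol_eq_low, L.lowSymbol_eq_one (by norm_num),
          L.lowSymbol_eq_one (by norm_num), sub_self]
      rw [this]; simp
    · have hn : ‖ν‖ ≠ 0 := norm_ne_zero_iff.2 hν
      have h2 : (‖(2 : ℝ) ^ (-m) • ν‖ ^ 2) ^ N = 2 ^ (-((m : ℝ) * (2 * N))) * (‖ν‖ ^ 2) ^ N := by
        rw [norm_smul, Real.norm_of_nonneg (by positivity), mul_pow, mul_pow]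
        congr 1
        rw [← pow_mul, ← Real.rpow_natCast, ← Real.rpow_intCast, ← Real.rpow_mul two_pos.le]
        congr 1; push_cast; ring
      rw [h2]
      push_cast
      rw [← hr]
      have hr0 : r ≠ 0 := by
        rw [hr]; exact_mod_cast (by positivity : (2 : ℝ) ^ (-((m : ℝ) * (2 * N))) ≠ 0)
      have hn' : (‖ν‖ : ℂ) ≠ 0 := by exact_mod_cast hn
      field_simp
  have hop : multOp (L.fatSymbol m) ψ = fun x => r * multOp θ (laplacePow N ψ) x := by
    have h1 := multOp_schwartz ((hc m).isSymbol.const_mul r) (laplacePow N ψ)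
    rw [multOp_schwartz (L.fatSymbol m).isSymbol]
    ext x
    rw [← multOp_const_mul_symbol, h1]
    refine congrArg (fun g : RSpace d → ℂ => 𝓕⁻ g x) (funext fun ν => ?_)
    rw [fourier_laplacePow, hsym]; ring
  have hre : ‖r‖ₑ = twoPow (-(m * (2 * N))) := by
    rw [hr, ← ofReal_norm, Complex.norm_real, Real.norm_of_nonneg (by positivity), twoPow]
  rw [hop]
  simp_rw [enorm_mul]
  rw [hre]
  have hψ : IsBddCont (laplacePow N ψ : RSpace d → ℂ) :=
    ⟨(laplacePow N ψ).continuous, _, SchwartzMap.norm_le_seminorm ℝ _⟩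
  rw [lintegral_const_mul _ (hψ.multOp (hc m).isSymbol).1.measurable.enorm, mul_right_comm, mul_comm]
  gcongr
  exact (lintegral_conv_le (hc m).isSymbol.kerInt (laplacePow N ψ).continuous).trans
    (by gcongr; exact (hc m).lintegral_le)

lemma exists_tsum_fat_le {σ : ℝ} (hσ : 0 < σ) : ∃ (N : ℕ) (K : ℝ≥0), ∀ ψ : 𝓢(RSpace d, ℂ),
    ∑' m : ℤ, twoPow (m * σ) * ∫⁻ x, ‖multOp (L.fatSymbol m) ψ x‖ₑ ≤
      K * ((∫⁻ x, ‖ψ x‖ₑ) + ∫⁻ x, ‖laplacePow N ψ x‖ₑ) := by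
  obtain ⟨N, hN⟩ := exists_nat_gt σ
  obtain ⟨c, hc⟩ := exists_lintegral_fat_le L N
  obtain ⟨c', hc'⟩ := L.exists_hasKernelBound
  set δ := min σ (2 * N - σ) with hδ
  have hδ0 : 0 < δ := lt_min hσ (by linarith)
  have hS := tsum_twoPow_neg_abs_ne_top hδ0
  refine ⟨N, (c + c') * (∑' n : ℤ, twoPow (-(δ * |(n : ℝ)|))).toNNReal, fun ψ => ?_⟩
  set I := ∫⁻ x, ‖ψ x‖ₑ with hI
  set J := ∫⁻ x, ‖laplacePow N ψ x‖ₑ with hJ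
  have hm : ∀ m : ℤ, twoPow (m * σ) * ∫⁻ x, ‖multOp (L.fatSymbol m) ψ x‖ₑ ≤
      (c + c') * (I + J) * twoPow (-(δ * |(m : ℝ)|)) := by
    intro m
    rcases le_total 0 m with h | h
    · have h0 : (0 : ℝ) ≤ m := by exact_mod_cast h
      calc twoPow (m * σ) * ∫⁻ x, ‖multOp (L.fatSymbol m) ψ x‖ₑ
          ≤ twoPow (m * σ) * (c * twoPow (-(m * (2 * N))) * J) := by gcongr; exact hc m ψ
        _ = c * J * twoPow (m * σ + -(m * (2 * N))) := by rw [twoPow_add]; ring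
        _ ≤ (c + c') * (I + J) * twoPow (-(δ * |(m : ℝ)|)) := by
          gcongr ?_ * ?_ * ?_
          · exact le_self_add
          · exact le_add_self
          · refine twoPow_mono ?_
            rw [abs_of_nonneg h0]
            nlinarith [min_le_right σ (2 * N - σ)]
    · have h0 : (m : ℝ) ≤ 0 := by exact_mod_cast h
      have h1 : ∫⁻ x, ‖multOp (L.fatSymbol m) ψ x‖ₑ ≤ c' * I :=
        (lintegral_conv_le (hc' m).2.2.isSymbol.kerInt ψ.continuous).trans
          (by gcongr; exact (hc' m).2.2.lintegral_le)
      calc twoPow (m * σ) * ∫⁻ x, ‖multOp (L.fatSymbol m) ψ x‖ₑ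
          ≤ twoPow (m * σ) * (c' * I) := by gcongr
        _ = c' * I * twoPow (m * σ) := by ring
        _ ≤ (c + c') * (I + J) * twoPow (-(δ * |(m : ℝ)|)) := by
          gcongr ?_ * ?_ * ?_
          · exact le_add_self
          · exact le_self_add
          · refine twoPow_mono ?_
            rw [abs_of_nonpos h0]
            nlinarith [min_le_left σ (2 * N - σ)]
  refine (ENNReal.tsum_le_tsum hm).trans ?_
  rw [ENNReal.tsum_mul_left, ENNReal.coe_mul, ENNReal.coe_toNNReal hS, ENNReal.coe_add]
  exact le_of_eq (by ring)

lemma integral_mul_translate_fourier (m : 𝓢(RSpace d, ℂ)) (v : RSpace d → ℂ) (x : RSpace d) :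
    ∫ y, v y * SchwartzMap.compSubConstCLM ℂ x (𝓕 m) y = multOp m v x := by
  rw [multOp, conv, ← integral_sub_left_eq_self _ volume x]
  congr 1; ext y
  rw [SchwartzMap.compSubConstCLM_apply, SchwartzMap.fourier_coe, Real.fourierInv_eq_fourier_neg,
    mul_comm, sub_sub_cancel_left]

lemma enorm_integral_mul_le {v : RSpace d → ℂ} (hv : IsBddCont v) {m : ℤ}
    (hfat : multOp (L.fatSymbol m) v = v) {M : ℝ≥0∞} (hM : ∀ x, ‖v x‖ₑ ≤ M)
    (ψ : 𝓢(RSpace d, ℂ)) :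
    ‖∫ x, v x * ψ x‖ₑ ≤ M * ∫⁻ x, ‖multOp (L.fatSymbol m) ψ x‖ₑ := by
  have h : ∫ x, v x * ψ x = ∫ x, v x * multOp (L.fatSymbol m) ψ x := by
    conv_lhs => rw [← hfat]
    exact integral_multOp_mul (L.fatSymbol m).isSymbol (L.fatSymbol_neg m) hv ψ
  have hψ : IsBddCont (ψ : RSpace d → ℂ) :=
    ⟨ψ.continuous, _, SchwartzMap.norm_le_seminorm ℝ _⟩
  rw [h]
  refine (enorm_integral_le_lintegral_enorm _).trans ?_
  rw [← lintegral_const_mul _ (hψ.multOp (L.fatSymbol m).isSymbol).1.measurable.enorm]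
  refine lintegral_mono fun x => ?_
  rw [enorm_mul]
  gcongr
  exact hM x

lemma integrable_mul_schwartz {v : RSpace d → ℂ} (hv : IsBddCont v) (ψ : 𝓢(RSpace d, ℂ)) :
    Integrable fun x => v x * ψ x :=
  ψ.integrable.bdd_mul hv.1.aestronglyMeasurable (Eventually.of_forall hv.2.choose_spec)

lemma enorm_schwartz_lintegral (ψ : 𝓢(RSpace d, ℂ)) :
    ∫⁻ x, ‖ψ x‖ₑ = ENNReal.ofReal ‖ψ.toLp 1 volume‖ := by
  rw [SchwartzMap.norm_toLp, ENNReal.ofReal_toReal, eLpNorm_one_eq_lintegral_enorm]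
  exact (ψ.memLp 1 volume).2.ne

/-- Blocks of size `O(2^{mσ})`, `σ > 0`, are summable to a tempered distribution: at low frequency
by absolute convergence in `L^∞`, and at high frequency by testing against Schwartz functions. -/
lemma exists_distribution {σ : ℝ} (hσ : 0 < σ) {v : ℤ → RSpace d → ℂ} (hv : ∀ m, IsBddCont (v m))
    (hfat : ∀ m, multOp (L.fatSymbol m) (v m) = v m) {B : ℝ≥0}
    (hB : ∀ m x, ‖v m x‖ₑ ≤ B * twoPow (m * σ)) :
    ∃ u : 𝓢'(RSpace d, ℂ), ∀ ψ, HasSum (fun m => ∫ x, v m x * ψ x) (u ψ) := by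
  obtain ⟨N, K, hK⟩ := exists_tsum_fat_le L hσ
  set G : 𝓢(RSpace d, ℂ) → ℝ := fun ψ =>
    B * K * (‖ψ.toLp 1 volume‖ + ‖(laplacePow N ψ).toLp 1 volume‖) with hG
  have hsum : ∀ ψ : 𝓢(RSpace d, ℂ), ∑' m, ‖∫ x, v m x * ψ x‖ₑ ≤ ENNReal.ofReal (G ψ) := by
    intro ψ
    calc ∑' m, ‖∫ x, v m x * ψ x‖ₑ
        ≤ ∑' m : ℤ, B * (twoPow (m * σ) * ∫⁻ x, ‖multOp (L.fatSymbol m) ψ x‖ₑ) := by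
          refine ENNReal.tsum_le_tsum fun m => ?_
          rw [← mul_assoc]
          exact enorm_integral_mul_le L (hv m) (hfat m) (hB m) ψ
      _ ≤ B * (K * ((∫⁻ x, ‖ψ x‖ₑ) + ∫⁻ x, ‖laplacePow N ψ x‖ₑ)) := by
          rw [ENNReal.tsum_mul_left]; gcongr; exact hK ψ
      _ = ENNReal.ofReal (G ψ) := by
          rw [enorm_schwartz_lintegral, enorm_schwartz_lintegral, hG,
            ENNReal.ofReal_mul (by positivity), ENNReal.ofReal_mul (by positivity),
            ENNReal.ofReal_add (by positivity) (by positivity), ENNReal.ofReal_coe_nnreal,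
            ENNReal.ofReal_coe_nnreal, mul_assoc]
  have hsummable : ∀ ψ : 𝓢(RSpace d, ℂ), Summable fun m => ∫ x, v m x * ψ x := by
    intro ψ
    refine Summable.of_enorm ?_
    exact ((hsum ψ).trans_lt ENNReal.ofReal_lt_top).ne
  set A : 𝓢(RSpace d, ℂ) →ₗ[ℂ] ℂ :=
    { toFun := fun ψ => ∑' m, ∫ x, v m x * ψ x
      map_add' := fun f g => by
        rw [← (hsummable f).tsum_add (hsummable g)]
        congr 1; ext m
        rw [← integral_add (integrable_mul_schwartz (hv m) f) (integrable_mul_schwartz (hv m) g)]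
        congr 1; ext x
        simp [mul_add]
      map_smul' := fun c f => by
        rw [RingHom.id_apply, smul_eq_mul, ← tsum_mul_left]
        congr 1; ext m
        rw [← integral_const_mul]
        congr 1; ext x
        simp only [_root_.smul_apply, smul_eq_mul]
        ring } with hA
  have hAG : ∀ ψ, ‖A ψ‖ ≤ G ψ := by
    intro ψ
    have hG0 : 0 ≤ G ψ := by positivity
    have h1 : ‖A ψ‖ₑ ≤ ENNReal.ofReal (G ψ) := enorm_tsum_le_tsum_enorm.trans (hsum ψ)
    rw [← ofReal_norm] at h1
    exact (ENNReal.ofReal_le_ofReal_iff hG0).1 h1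
  have hcont : Continuous A := by
    refine continuous_of_continuousAt_zero A ?_
    rw [ContinuousAt, map_zero]
    refine squeeze_zero_norm hAG ?_
    have hGc : Continuous G := by
      have h1 := (SchwartzMap.toLpCLM ℂ ℂ 1 (volume : Measure (RSpace d))).continuous
      have h2 := h1.comp (laplacePow (d := d) N).continuous
      exact continuous_const.mul (h1.norm.add h2.norm)
    have h0 : G 0 = 0 := by
      have h1 : (0 : 𝓢(RSpace d, ℂ)).toLp 1 volume = 0 :=
        map_zero (SchwartzMap.toLpCLM ℂ ℂ 1 (volume : Measure (RSpace d)))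
      simp only [hG, map_zero, h1, norm_zero, add_zero, mul_zero]
    simpa [h0] using hGc.tendsto 0
  refine ⟨ContinuousLinearMap.toPointwiseConvergenceCLM _ _ _ _ ⟨A, hcont⟩, fun ψ => ?_⟩
  exact (hsummable ψ).hasSum

end Transpose

section Reconstruction

variable {d : ℕ} {L : LittlewoodPaley d}

lemma multOp_add_fun {m f g : RSpace d → ℂ} (hm : IsSymbol m) (hf : IsBddCont f)
    (hg : IsBddCont g) (x : RSpace d) :
    multOp m (fun x => f x + g x) x = multOp m f x + multOp m g x := by
  simp only [multOp, conv, mul_add]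
  exact integral_add (integrable_conv hm.kerInt hf.1.measurable hf.2.choose_spec x)
    (integrable_conv hm.kerInt hg.1.measurable hg.2.choose_spec x)

lemma multOp_fat_eq {f : RSpace d → ℂ} (hf : IsBddCont f) (k : ℤ) (x : RSpace d) :
    multOp (L.fatSymbol k) f x = multOp (L.blockSymbol (k - 1)) f x + multOp (L.blockSymbol k) f x +
      multOp (L.blockSymbol (k + 1)) f x := by
  rw [← multOp_add_symbol (L.blockSymbol _).isSymbol (L.blockSymbol _).isSymbol hf,
    ← multOp_add_symbol ((L.blockSymbol _).isSymbol.add (L.blockSymbol _).isSymbol)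
      (L.blockSymbol _).isSymbol hf]
  rfl

lemma tsum_ite_twoPow_le {σ : ℝ} (n : ℤ) :
    ∑' k : ℤ, (if k ≤ n then twoPow (k * σ) else 0) ≤
      twoPow (n * σ) * ∑' i : ℤ, twoPow (-(σ * |(i : ℝ)|)) := by
  rw [← (Equiv.subLeft n).tsum_eq fun i : ℤ => twoPow (-(σ * |(i : ℝ)|)), ← ENNReal.tsum_mul_left]
  refine ENNReal.tsum_le_tsum fun k => ?_
  split_ifs with h
  · have h' : (k : ℝ) ≤ n := by exact_mod_cast h
    rw [← twoPow_add, Equiv.subLeft_apply, Int.cast_sub, abs_of_nonneg (sub_nonneg.2 h')]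
    exact le_of_eq (by congr 1; ring)
  · exact zero_le

lemma tendsto_twoPow_atBot {σ : ℝ} (hσ : 0 < σ) :
    Tendsto (fun j : ℤ => twoPow (j * σ)) atBot (𝓝 0) := by
  have h : Tendsto (fun j : ℤ => (2 : ℝ) ^ ((j : ℝ) * σ)) atBot (𝓝 0) := by
    have := (tendsto_rpow_atBot_of_base_gt_one 2 one_lt_two).comp
      (tendsto_intCast_atBot_iff (R := ℝ).2 tendsto_id |>.atBot_mul_const hσ)
    exact this
  have h2 := ENNReal.tendsto_ofReal h
  rwa [ENNReal.ofReal_zero] at h2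

/-- Blocks of size `O(2^{mσ})`, `σ > 0`, with the right frequency localization are the blocks of an
element of `𝓢'₀`. -/
lemma exists_distribution_of_blocks {σ : ℝ} (hσ : 0 < σ) {v : ℤ → RSpace d → ℂ}
    (hv : ∀ m, IsBddCont (v m)) {B : ℝ≥0} (hB : ∀ m x, ‖v m x‖ₑ ≤ B * twoPow (m * σ))
    (hfat : ∀ m, multOp (L.fatSymbol m) (v m) = v m)
    (hcomm : ∀ k m, multOp (L.blockSymbol k) (v m) = multOp (L.blockSymbol m) (v k))
    (hfar : ∀ k m, k + 2 ≤ m ∨ m + 2 ≤ k → ∀ x, multOp (L.blockSymbol k) (v m) x = 0)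
    (hlow : ∀ j m, j < m → ∀ x, multOp (L.lowSymbol j) (v m) x = 0) :
    ∃ u : 𝓢'(RSpace d, ℂ), (∀ ψ, HasSum (fun m => ∫ x, v m x * ψ x) (u ψ)) ∧ L.MemS0 u ∧
      ∀ k, L.dyadicBlock k u = v k := by
  obtain ⟨u, hu⟩ := exists_distribution L hσ hv hfat hB
  have hmul : ∀ (S : 𝓢(RSpace d, ℂ)) (x : RSpace d),
      HasSum (fun m => multOp S (v m) x) (LittlewoodPaley.schwartzMultiplier S u x) := by
    intro S x
    have h := hu (SchwartzMap.compSubConstCLM ℂ x (𝓕 S))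
    simp_rw [integral_mul_translate_fourier] at h
    exact h
  refine ⟨u, hu, ?_, fun k => ?_⟩
  · obtain ⟨c, hc⟩ := L.exists_hasKernelBound
    set S := ∑' i : ℤ, twoPow (-(σ * |(i : ℝ)|)) with hS
    have hbound : ∀ j : ℤ, eLpNorm (L.lowCut j u) ∞ volume ≤ c * B * S * twoPow (j * σ) := by
      intro j
      refine eLpNorm_top_le fun x => ?_
      have hsum := (hmul (L.lowSymbol j) x).tsum_eq
      rw [LittlewoodPaley.lowCut, ← hsum]
      calc ‖∑' m, multOp (L.lowSymbol j) (v m) x‖ₑ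
          ≤ ∑' m, ‖multOp (L.lowSymbol j) (v m) x‖ₑ := enorm_tsum_le_tsum_enorm
        _ ≤ ∑' m : ℤ, c * B * (if m ≤ j then twoPow (m * σ) else 0) := by
            refine ENNReal.tsum_le_tsum fun m => ?_
            split_ifs with h
            · rw [mul_assoc]
              exact (hc j).1.enorm_multOp_le (hB m) x
            · rw [hlow j m (not_le.1 h)]; simp
        _ ≤ c * B * (twoPow (j * σ) * S) := by
            rw [ENNReal.tsum_mul_left]
            gcongr
            exact tsum_ite_twoPow_le j
        _ = _ := by ring
    have hlim : Tendsto (fun j : ℤ => c * B * S * twoPow (j * σ)) atBot (𝓝 0) := by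
      have h := ENNReal.Tendsto.const_mul (a := (c : ℝ≥0∞) * B * S) (tendsto_twoPow_atBot hσ)
        (Or.inr (ENNReal.mul_ne_top (ENNReal.mul_ne_top ENNReal.coe_ne_top ENNReal.coe_ne_top)
          (tsum_twoPow_neg_abs_ne_top hσ)))
      rwa [mul_zero] at h
    exact tendsto_of_tendsto_of_tendsto_of_le_of_le tendsto_const_nhds hlim (fun _ => zero_le)
      hbound
  · ext x
    refine (hmul (L.blockSymbol k) x).unique ?_
    have h : HasSum (fun m => multOp (L.blockSymbol k) (v m) x)
        (∑ m ∈ ({k - 1, k, k + 1} : Finset ℤ), multOp (L.blockSymbol k) (v m) x) := by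
      refine hasSum_sum_of_ne_finset_zero fun m hm => hfar k m ?_ x
      simp only [Finset.mem_insert, Finset.mem_singleton, not_or] at hm
      omega
    convert h using 1
    rw [Finset.sum_insert (by simp only [Finset.mem_insert, Finset.mem_singleton]; omega), Finset.sum_insert (by simp), Finset.sum_singleton,
      hcomm k (k - 1), hcomm k (k + 1), ← add_assoc, ← multOp_fat_eq (hv k), hfat]

/-! ### Littlewood-Paley decomposition of a bounded function -/

/-- The kernels of the symbols `ν ↦ m(2^{-j}ν)` with `m(0) = 1` form an approximate identity. -/
lemma tendsto_multOp_dilate {m f : RSpace d → ℂ} (hm : IsSymbol m) (h0 : m 0 = 1)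
    (hf : IsBddCont f) (x : RSpace d) :
    Tendsto (fun N : ℕ => multOp (dilate (N : ℤ) m) f x) atTop (𝓝 (f x)) := by
  obtain ⟨hfc, M, hM⟩ := hf
  have hscale : ∀ N : ℕ, multOp (dilate (N : ℤ) m) f x =
      ∫ u, 𝓕⁻ m u * f (x - ((2 : ℝ) ^ N)⁻¹ • u) := by
    intro N
    set a : ℝ := (2 : ℝ) ^ N with ha
    have ha0 : 0 < a := by positivity
    have hd : dilate (N : ℤ) m = fun ν => m (a⁻¹ • ν) := by
      ext ν; rw [dilate, zpow_neg, zpow_natCast]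
    have h := Measure.integral_comp_smul (volume : Measure (RSpace d))
      (fun u => 𝓕⁻ m u * f (x - a⁻¹ • u)) a
    rw [finrank_euclideanSpace, Fintype.card_fin, abs_of_pos (by positivity)] at h
    rw [multOp, conv, hd]
    simp_rw [fourierInv_comp_smul m ha0, mul_assoc]
    rw [integral_const_mul]
    simp_rw [inv_smul_smul₀ ha0.ne'] at h
    rw [h, Complex.real_smul, ← mul_assoc, ← Complex.ofReal_mul,
      mul_inv_cancel₀ (by positivity), Complex.ofReal_one, one_mul]
  have hint : ∫ u, 𝓕⁻ m u = 1 := by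
    have h := congrFun hm.fourier_ker 0
    rw [fourier_eq_integral_mul, h0] at h
    simpa using h
  have hlim : Tendsto (fun N : ℕ => ∫ u, 𝓕⁻ m u * f (x - ((2 : ℝ) ^ N)⁻¹ • u)) atTop
      (𝓝 (∫ u, 𝓕⁻ m u * f x)) := by
    refine tendsto_integral_of_dominated_convergence (fun u => ‖𝓕⁻ m u‖ * M) ?_
      (hm.kerInt.norm.mul_const M) ?_ ?_
    · exact fun N => hm.kerInt.1.mul
        (by fun_prop : Continuous fun u : RSpace d =>
          f (x - ((2 : ℝ) ^ N)⁻¹ • u)).aestronglyMeasurable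
    · refine fun N => Eventually.of_forall fun u => ?_
      rw [norm_mul]; gcongr; exact hM _
    · refine Eventually.of_forall fun u => Tendsto.const_mul _ ?_
      have h1 : Tendsto (fun N : ℕ => ((2 : ℝ) ^ N)⁻¹) atTop (𝓝 0) :=
        tendsto_inv_atTop_zero.comp (tendsto_pow_atTop_atTop_of_one_lt one_lt_two)
      have h2 : Tendsto (fun y : ℝ => f (x - y • u)) (𝓝 0) (𝓝 (f (x - (0 : ℝ) • u))) :=
        (by fun_prop : Continuous fun y : ℝ => f (x - y • u)).tendsto 0
      simpa using! h2.comp h1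
  rw [integral_mul_const, hint, one_mul] at hlim
  exact hlim.congr fun N => (hscale N).symm

lemma sum_multOp_block {f : RSpace d → ℂ} (hf : IsBddCont f) (N : ℕ) (x : RSpace d) :
    ∑ m ∈ Finset.Ico (-(N : ℤ)) N, multOp (L.blockSymbol m) f x =
      multOp (L.lowSymbol N) f x - multOp (L.lowSymbol (-N)) f x := by
  have hstep : ∀ m : ℤ, multOp (L.lowSymbol (m + 1)) f x =
      multOp (L.lowSymbol m) f x + multOp (L.blockSymbol m) f x := by
    intro m
    rw [← multOp_add_symbol (L.lowSymbol m).isSymbol (L.blockSymbol m).isSymbol hf]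
    congr 1; ext ν
    rw [L.blockSymbol_apply]; ring
  have key : ∀ n : ℕ, ∑ m ∈ Finset.Ico (-(N : ℤ)) (-N + n), multOp (L.blockSymbol m) f x =
      multOp (L.lowSymbol (-N + n)) f x - multOp (L.lowSymbol (-N)) f x := by
    intro n
    induction n with
    | zero => simp
    | succ n ih =>
      have e : Finset.Ico (-(N : ℤ)) (-N + ((n + 1 : ℕ) : ℤ)) =
          insert (-N + (n : ℤ)) (Finset.Ico (-(N : ℤ)) (-N + n)) := by
        ext i; simp only [Finset.mem_Ico, Finset.mem_insert]; push_cast; omega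
      rw [e, Finset.sum_insert (by rw [Finset.mem_Ico]; omega), ih]
      have := hstep (-N + (n : ℤ))
      rw [show -(N : ℤ) + ((n + 1 : ℕ) : ℤ) = -N + n + 1 by push_cast; ring, this]
      ring
  have := key (2 * N)
  rwa [show -(N : ℤ) + ((2 * N : ℕ) : ℤ) = N by push_cast; ring] at this

/-- A bounded function that is integrable to some finite power is the sum of its Littlewood-Paley
blocks: the decay at infinity excludes a contribution of zero frequency. -/
lemma hasSum_integral_block (hd : 1 ≤ d) {f : RSpace d → ℂ} (hf : IsBddCont f) {t : ℝ} (ht : 0 < t)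
    (ht1 : t ≤ 1) (hft : recipNorm t f ≠ ∞) (ψ : 𝓢(RSpace d, ℂ))
    (hs : Summable fun m => ∫ x, multOp (L.blockSymbol m) f x * ψ x) :
    HasSum (fun m => ∫ x, multOp (L.blockSymbol m) f x * ψ x) (∫ x, f x * ψ x) := by
  obtain ⟨c, hc⟩ := L.exists_hasKernelBound
  obtain ⟨M, hM⟩ := hf.2
  have hM' : ∀ x, ‖f x‖ₑ ≤ ENNReal.ofReal M := fun x => by
    rw [← ofReal_norm]; exact ENNReal.ofReal_le_ofReal (hM x)
  have hlow : ∀ m, IsBddCont (multOp (L.lowSymbol m) f) := fun m => hf.multOp (L.lowSymbol m).isSymbol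
  have h1 : Tendsto (fun N : ℕ => ∫ x, multOp (L.lowSymbol N) f x * ψ x) atTop
      (𝓝 (∫ x, f x * ψ x)) := by
    refine tendsto_integral_of_dominated_convergence (fun x => (c * M.toNNReal : ℝ≥0) * ‖ψ x‖) ?_
      (ψ.integrable.norm.const_mul _) ?_ ?_
    · exact fun N => (integrable_mul_schwartz (hlow N) ψ).1
    · refine fun N => Eventually.of_forall fun x => ?_
      rw [norm_mul]
      gcongr
      have h := (hc N).1.enorm_multOp_le hM' x
      rw [← ofReal_norm, ENNReal.ofReal_le_iff_le_toReal (by finiteness), ENNReal.toReal_mul,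
        ENNReal.toReal_ofReal'] at h
      push_cast
      simpa using h
    · refine Eventually.of_forall fun x => Tendsto.mul_const _ ?_
      have := tendsto_multOp_dilate (L.lowSymbol 0).isSymbol
        (L.lowSymbol_eq_one (by norm_num)) hf x
      refine this.congr fun N => ?_
      rw [← L.lowSymbol_eq_dilate]
  have h2 : Tendsto (fun N : ℕ => ∫ x, multOp (L.lowSymbol (-N)) f x * ψ x) atTop (𝓝 0) := by
    rw [tendsto_zero_iff_enorm_tendsto_zero]
    have hdt : 0 < (d : ℝ) * t := by
      have : (1 : ℝ) ≤ d := by exact_mod_cast hd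
      positivity
    have hI : ∫⁻ x, ‖ψ x‖ₑ ≠ ∞ := ψ.integrable.2.ne
    have hbound : ∀ N : ℕ, ‖∫ x, multOp (L.lowSymbol (-N)) f x * ψ x‖ₑ ≤
        c * recipNorm t f * (∫⁻ x, ‖ψ x‖ₑ) * twoPow (((-(N : ℤ) : ℤ) : ℝ) * (d * t)) := by
      intro N
      have h3 := (hc (-N)).1.recipNorm_le hf ht ht1 le_rfl ht.le
      rw [recipNorm_zero, sub_zero, twoPow_rpow] at h3
      calc ‖∫ x, multOp (L.lowSymbol (-N)) f x * ψ x‖ₑ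
          ≤ ∫⁻ x, ‖multOp (L.lowSymbol (-N)) f x * ψ x‖ₑ := enorm_integral_le_lintegral_enorm _
        _ ≤ ∫⁻ x, (c * twoPow (((-(N : ℤ) : ℤ) : ℝ) * d * t) * recipNorm t f) * ‖ψ x‖ₑ := by
            refine lintegral_mono fun x => ?_
            rw [enorm_mul]
            gcongr
            exact (enorm_le_eLpNorm_top (hlow _).1 x).trans h3
        _ = _ := by
            rw [lintegral_const_mul _ ψ.continuous.measurable.enorm, mul_assoc _ (d : ℝ) t]
            ring
    have hN : Tendsto (fun N : ℕ => -(N : ℤ)) atTop atBot :=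
      tendsto_neg_atTop_atBot.comp tendsto_natCast_atTop_atTop
    have hlim := ENNReal.Tendsto.const_mul (a := c * recipNorm t f * ∫⁻ x, ‖ψ x‖ₑ)
      ((tendsto_twoPow_atBot hdt).comp hN)
      (Or.inr (ENNReal.mul_ne_top (ENNReal.mul_ne_top ENNReal.coe_ne_top hft) hI))
    rw [mul_zero] at hlim
    exact tendsto_of_tendsto_of_tendsto_of_le_of_le tendsto_const_nhds hlim (fun _ => zero_le)
      hbound
  have h3 : Tendsto (fun N : ℕ => ∑ m ∈ Finset.Ico (-(N : ℤ)) N,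
      ∫ x, multOp (L.blockSymbol m) f x * ψ x) atTop (𝓝 (∫ x, f x * ψ x)) := by
    have h4 := h1.sub h2
    rw [sub_zero] at h4
    refine h4.congr fun N => ?_
    rw [← integral_sub (integrable_mul_schwartz (hlow _) ψ) (integrable_mul_schwartz (hlow _) ψ),
      ← integral_finsetSum _ fun m _ =>
        integrable_mul_schwartz (hf.multOp (L.blockSymbol m).isSymbol) ψ]
    congr 1; ext x
    rw [← Finset.sum_mul, sum_multOp_block hf, sub_mul]
  have h4 : Tendsto (fun N : ℕ => Finset.Ico (-(N : ℤ)) N) atTop atTop :=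
    tendsto_atTop_finset_of_monotone
      (fun N N' h => Finset.Ico_subset_Ico (by omega) (by omega))
      fun i => ⟨i.natAbs + 1, by rw [Finset.mem_Ico]; omega⟩
  rw [tendsto_nhds_unique h3 (hs.hasSum.comp h4)]
  exact hs.hasSum

end Reconstruction

/-! ### Series of bounded functions -/

section Series

lemma norm_le_toReal_of_enorm_le {z : ℂ} {M : ℝ≥0∞} (h : ‖z‖ₑ ≤ M) (hM : M ≠ ∞) :
    ‖z‖ ≤ M.toReal := by
  simpa using ENNReal.toReal_mono hM h

variable {d : ℕ} {ι : Type*} [Countable ι] {f : ι → RSpace d → ℂ} {U : ι → ℝ≥0∞}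

lemma IsBddCont.tsum_of_enorm_le (hf : ∀ i, IsBddCont (f i)) (hU : ∑' i, U i ≠ ∞)
    (hfU : ∀ i x, ‖f i x‖ₑ ≤ U i) : IsBddCont (fun x => ∑' i, f i x) :=
  IsBddCont.tsum hf (ENNReal.summable_toReal hU) fun i x =>
    norm_le_toReal_of_enorm_le (hfU i x) (ENNReal.ne_top_of_tsum_ne_top hU i)

lemma multOp_tsum_of_enorm_le {m : RSpace d → ℂ} (hm : IsSymbol m) (hf : ∀ i, IsBddCont (f i))
    (hU : ∑' i, U i ≠ ∞) (hfU : ∀ i x, ‖f i x‖ₑ ≤ U i) (x : RSpace d) :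
    multOp m (fun x => ∑' i, f i x) x = ∑' i, multOp m (f i) x :=
  multOp_tsum hm hf (ENNReal.summable_toReal hU) (fun i x =>
    norm_le_toReal_of_enorm_le (hfU i x) (ENNReal.ne_top_of_tsum_ne_top hU i)) x

lemma hasSum_integral_mul_schwartz (hf : ∀ i, IsBddCont (f i)) (hU : ∑' i, U i ≠ ∞)
    (hfU : ∀ i x, ‖f i x‖ₑ ≤ U i) (ψ : 𝓢(RSpace d, ℂ)) :
    HasSum (fun i => ∫ x, f i x * ψ x) (∫ x, (∑' i, f i x) * ψ x) := by
  have hu := ENNReal.summable_toReal hU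
  have hfu : ∀ i x, ‖f i x‖ ≤ (U i).toReal := fun i x =>
    norm_le_toReal_of_enorm_le (hfU i x) (ENNReal.ne_top_of_tsum_ne_top hU i)
  refine hasSum_integral_of_dominated_convergence (fun i x => (U i).toReal * ‖ψ x‖)
    (fun i => (integrable_mul_schwartz (hf i) ψ).1) ?_ ?_ ?_ ?_
  · refine fun i => Eventually.of_forall fun x => ?_
    rw [norm_mul]
    gcongr
    exact hfu i x
  · exact Eventually.of_forall fun x => hu.mul_right _
  · simp_rw [tsum_mul_right]
    exact ψ.integrable.norm.const_mul _
  · exact Eventually.of_forall fun x => (summable_apply_of_bound hu hfu x).hasSum.mul_right _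

lemma recipNorm_tsum_le (hf : ∀ i, IsBddCont (f i)) (hU : ∑' i, U i ≠ ∞)
    (hfU : ∀ i x, ‖f i x‖ₑ ≤ U i) {t : ℝ} (ht : t ≤ 1) :
    recipNorm t (fun x => ∑' i, f i x) ≤ ∑' i, recipNorm t (f i) := by
  have h1 : 1 ≤ (ENNReal.ofReal t)⁻¹ := ENNReal.one_le_inv.2 (ENNReal.ofReal_le_one.2 ht)
  refine eLpNorm_le_of_tendsto (l := (atTop : Filter (Finset ι)))
    (g := fun s x => ∑ i ∈ s, f i x) (Eventually.of_forall fun s => ?_)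
    (Eventually.of_forall fun s => ?_) fun x => ?_
  · exact (continuous_finsetSum _ fun i _ => (hf i).1).aestronglyMeasurable
  · have h2 := eLpNorm_sum_le (μ := (volume : Measure (RSpace d))) (s := s) (f := f)
      (fun i _ => (hf i).1.aestronglyMeasurable) h1
    have h3 : (∑ i ∈ s, f i) = fun x => ∑ i ∈ s, f i x := by ext x; simp
    rw [h3] at h2
    exact h2.trans (ENNReal.sum_le_tsum s)
  · exact (summable_apply_of_bound (ENNReal.summable_toReal hU) (fun i x =>
      norm_le_toReal_of_enorm_le (hfU i x) (ENNReal.ne_top_of_tsum_ne_top hU i)) x).hasSum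

end Series

/-! ### Sums of functions, block by block -/

section BlockSeries

variable {d : ℕ} {L : LittlewoodPaley d} {ι : Type*} [Countable ι]

/-- The block of index `m` of `g(D) ∑ᵢ cᵢ`. The sum over `i` is only required to converge block by
block. -/
def blockSeries (L : LittlewoodPaley d) (g : RSpace d → ℂ) (c : ι → RSpace d → ℂ) (m : ℤ)
    (x : RSpace d) : ℂ := ∑' i, multOp (fun ν => L.blockSymbol m ν * g ν) (c i) x

/-- The blocks of `g(D) ∑ᵢ cᵢ` converge absolutely in `L^∞`, with sums of size `O(2^{mσ})`. The numbers
`U m i` bound the block `m` of the term `i`. -/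
structure BlockSummable (L : LittlewoodPaley d) (g : RSpace d → ℂ) (c : ι → RSpace d → ℂ)
    (U : ℤ → ι → ℝ≥0∞) (B : ℝ≥0) (σ : ℝ) : Prop where
  isBddCont : ∀ i, IsBddCont (c i)
  isSymbol : ∀ m, IsSymbol fun ν => L.blockSymbol m ν * g ν
  enorm_le : ∀ m i x, ‖multOp (fun ν => L.blockSymbol m ν * g ν) (c i) x‖ₑ ≤ U m i
  tsum_le : ∀ m, ∑' i, U m i ≤ B * twoPow (m * σ)

namespace BlockSummable

variable {g g' : RSpace d → ℂ} {c : ι → RSpace d → ℂ} {U U' : ℤ → ι → ℝ≥0∞} {B B' : ℝ≥0} {σ : ℝ}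

lemma tsum_ne_top (h : BlockSummable L g c U B σ) (m : ℤ) : ∑' i, U m i ≠ ∞ :=
  ((h.tsum_le m).trans_lt (ENNReal.mul_lt_top ENNReal.coe_lt_top (twoPow_ne_top _).lt_top)).ne

lemma isBddCont_term (h : BlockSummable L g c U B σ) (m : ℤ) (i : ι) :
    IsBddCont (multOp (fun ν => L.blockSymbol m ν * g ν) (c i)) :=
  (h.isBddCont i).multOp (h.isSymbol m)

lemma isBddCont_blockSeries (h : BlockSummable L g c U B σ) (m : ℤ) :
    IsBddCont (blockSeries L g c m) :=
  IsBddCont.tsum_of_enorm_le (h.isBddCont_term m) (h.tsum_ne_top m) (h.enorm_le m)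

lemma enorm_blockSeries_le (h : BlockSummable L g c U B σ) (m : ℤ) (x : RSpace d) :
    ‖blockSeries L g c m x‖ₑ ≤ B * twoPow (m * σ) :=
  enorm_tsum_le_tsum_enorm.trans
    ((ENNReal.tsum_le_tsum fun i => h.enorm_le m i x).trans (h.tsum_le m))

lemma multOp_blockSeries (h : BlockSummable L g c U B σ) {S : RSpace d → ℂ} (hS : IsSymbol S)
    (m : ℤ) (x : RSpace d) : multOp S (blockSeries L g c m) x =
      ∑' i, multOp (fun ν => S ν * (L.blockSymbol m ν * g ν)) (c i) x := by
  refine (multOp_tsum_of_enorm_le hS (h.isBddCont_term m) (h.tsum_ne_top m) (h.enorm_le m)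
    x).trans ?_
  exact tsum_congr fun i => by rw [multOp_multOp hS (h.isSymbol m) (h.isBddCont i)]

lemma multOp_blockSeries_eq_zero (h : BlockSummable L g c U B σ) {S : RSpace d → ℂ}
    (hS : IsSymbol S) {m : ℤ} (h0 : ∀ ν, S ν * L.blockSymbol m ν = 0) (x : RSpace d) :
    multOp S (blockSeries L g c m) x = 0 := by
  rw [h.multOp_blockSeries hS]
  simp_rw [← mul_assoc, h0, zero_mul, multOp_zero_symbol, tsum_zero]

lemma multOp_fat_blockSeries (h : BlockSummable L g c U B σ) (m : ℤ) :
    multOp (L.fatSymbol m) (blockSeries L g c m) = blockSeries L g c m := by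
  ext x
  rw [h.multOp_blockSeries (L.fatSymbol m).isSymbol]
  simp_rw [← mul_assoc, mul_comm (L.fatSymbol m _), L.blockSymbol_mul_fatSymbol]
  rfl

/-- The multipliers `g'(D)` and the projections on blocks commute. -/
lemma multOp_blockSeries_comm (h : BlockSummable L g c U B σ) (h' : BlockSummable L g' c U' B' σ)
    (hg : ∀ ν, g ν = 1) (k m : ℤ) :
    multOp (fun ν => L.blockSymbol k ν * g' ν) (blockSeries L g c m) =
      multOp (L.blockSymbol m) (blockSeries L g' c k) := by
  ext x
  rw [h.multOp_blockSeries (h'.isSymbol k), h'.multOp_blockSeries (L.blockSymbol m).isSymbol]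
  refine tsum_congr fun i => ?_
  congr 1
  ext ν
  rw [hg]; ring

lemma multOp_block_comm (h : BlockSummable L g c U B σ) (k m : ℤ) :
    multOp (L.blockSymbol k) (blockSeries L g c m) =
      multOp (L.blockSymbol m) (blockSeries L g c k) := by
  ext x
  rw [h.multOp_blockSeries (L.blockSymbol k).isSymbol,
    h.multOp_blockSeries (L.blockSymbol m).isSymbol]
  refine tsum_congr fun i => ?_
  congr 1
  ext ν
  ring

lemma exists_distribution (h : BlockSummable L g c U B σ) (hσ : 0 < σ) :
    ∃ u : 𝓢'(RSpace d, ℂ), (∀ ψ, HasSum (fun m => ∫ x, blockSeries L g c m x * ψ x) (u ψ)) ∧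
      L.MemS0 u ∧ ∀ k, L.dyadicBlock k u = blockSeries L g c k := by
  refine exists_distribution_of_blocks hσ h.isBddCont_blockSeries h.enorm_blockSeries_le
    h.multOp_fat_blockSeries h.multOp_block_comm (fun k m hkm x => ?_) fun j m hjm x => ?_
  · exact h.multOp_blockSeries_eq_zero (L.blockSymbol k).isSymbol
      (L.blockSymbol_mul_blockSymbol hkm) x
  · exact h.multOp_blockSeries_eq_zero (L.lowSymbol j).isSymbol
      (L.lowSymbol_mul_blockSymbol_of_lt hjm) x

/-- If `u` has the blocks of `∑ᵢ cᵢ`, then `g(D)u` has the blocks of `g(D) ∑ᵢ cᵢ`. -/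
lemma multOp_fatBlock (h : BlockSummable L g c U B σ) (h' : BlockSummable L g' c U' B' σ)
    (hg : ∀ ν, g ν = 1) {u : 𝓢'(RSpace d, ℂ)} (hu : ∀ k, L.dyadicBlock k u = blockSeries L g c k)
    (k : ℤ) : multOp (fun ν => L.blockSymbol k ν * g' ν) (L.fatBlock k u) =
      blockSeries L g' c k := by
  have e : L.fatBlock k u = fun x => (blockSeries L g c (k - 1) x + blockSeries L g c k x) +
      blockSeries L g c (k + 1) x := by
    ext x; rw [LittlewoodPaley.fatBlock, hu, hu, hu]
  ext x
  have hb := h.isBddCont_blockSeries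
  rw [e, multOp_add_fun (h'.isSymbol k) ((hb _).add (hb _)) (hb _),
    multOp_add_fun (h'.isSymbol k) (hb _) (hb _), h.multOp_blockSeries_comm h' hg,
    h.multOp_blockSeries_comm h' hg, h.multOp_blockSeries_comm h' hg,
    ← multOp_fat_eq (h'.isBddCont_blockSeries k), h'.multOp_fat_blockSeries]

/-- A sum `u` of blocks is the sum of the functions `cᵢ` themselves: the double series over the
indices `i` and the blocks converges absolutely when tested against a Schwartz function. -/
lemma hasSum_integral (h : BlockSummable L g c U B σ) (hσ : 0 < σ) (hg : ∀ ν, g ν = 1) (hd : 1 ≤ d)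
    {t : ℝ} (ht : 0 < t) (ht1 : t ≤ 1) (hct : ∀ i, recipNorm t (c i) ≠ ∞) {u : 𝓢'(RSpace d, ℂ)}
    (hu : ∀ ψ, HasSum (fun m => ∫ x, blockSeries L g c m x * ψ x) (u ψ)) (ψ : 𝓢(RSpace d, ℂ)) :
    HasSum (fun i => ∫ x, c i x * ψ x) (u ψ) := by
  obtain ⟨N, K, hK⟩ := exists_tsum_fat_le L hσ
  have hfin : (∑' m : ℤ, twoPow (m * σ) * ∫⁻ x, ‖multOp (L.fatSymbol m) ψ x‖ₑ) ≠ ∞ := by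
    refine ((hK ψ).trans_lt (ENNReal.mul_lt_top ENNReal.coe_lt_top (ENNReal.add_lt_top.2 ⟨?_, ?_⟩))).ne
    · exact ψ.integrable.2
    · exact (laplacePow N ψ).integrable.2
  have hsym : ∀ m, (fun ν => L.blockSymbol m ν * g ν) = L.blockSymbol m := by
    intro m; ext ν; rw [hg, mul_one]
  set I : ι × ℤ → ℂ := fun z => ∫ x, multOp (L.blockSymbol z.2) (c z.1) x * ψ x with hI
  have hterm : ∀ m i, IsBddCont (multOp (L.blockSymbol m) (c i)) := fun m i =>
    (h.isBddCont i).multOp (L.blockSymbol m).isSymbol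
  have hle : ∀ m i x, ‖multOp (L.blockSymbol m) (c i) x‖ₑ ≤ U m i := by
    intro m i x
    have := h.enorm_le m i x
    rwa [hsym] at this
  have hIle : ∀ i m, ‖I (i, m)‖ₑ ≤ U m i * ∫⁻ x, ‖multOp (L.fatSymbol m) ψ x‖ₑ := by
    intro i m
    refine enorm_integral_mul_le L (hterm m i) ?_ (hle m i) ψ
    rw [multOp_multOp (L.fatSymbol m).isSymbol (L.blockSymbol m).isSymbol (h.isBddCont i)]
    congr 1; ext ν
    rw [mul_comm, L.blockSymbol_mul_fatSymbol]
  have hsumI : Summable I := by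
    refine Summable.of_enorm ?_
    rw [ENNReal.tsum_prod', ENNReal.tsum_comm]
    refine ne_top_of_le_ne_top (ENNReal.mul_ne_top (ENNReal.coe_ne_top (r := B)) hfin) ?_
    rw [← ENNReal.tsum_mul_left]
    refine ENNReal.tsum_le_tsum fun m => ?_
    calc ∑' i, ‖I (i, m)‖ₑ ≤ ∑' i, U m i * ∫⁻ x, ‖multOp (L.fatSymbol m) ψ x‖ₑ :=
          ENNReal.tsum_le_tsum fun i => hIle i m
      _ ≤ (B * twoPow (m * σ)) * ∫⁻ x, ‖multOp (L.fatSymbol m) ψ x‖ₑ := by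
          rw [ENNReal.tsum_mul_right]
          gcongr
          exact h.tsum_le m
      _ = _ := mul_assoc _ _ _
  have hrow : ∀ i, HasSum (fun m => I (i, m)) (∫ x, c i x * ψ x) := fun i =>
    hasSum_integral_block hd (h.isBddCont i) ht ht1 (hct i) ψ (hsumI.prod_factor i)
  have hcol : ∀ m, HasSum (fun i => I (i, m)) (∫ x, blockSeries L g c m x * ψ x) := by
    intro m
    have h1 := hasSum_integral_mul_schwartz (hterm m) (h.tsum_ne_top m) (hle m) ψ
    simp only [blockSeries, hsym]
    exact h1
  have h1 := hsumI.hasSum.prod_fiberwise hrow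
  have h2 := ((Equiv.prodComm ℤ ι).hasSum_iff.2 hsumI.hasSum).prod_fiberwise hcol
  rwa [h2.unique (hu ψ)] at h1

end BlockSummable

end BlockSeries

/-! ### The exponentially weighted blocks of a product -/

section Weighted

variable {d : ℕ} {L : LittlewoodPaley d}

/-- The function `e^{αε·D} Δ̇_j u` for a vector of signs `ε`. For `ε = 0` it is the block itself. -/
def signBlock (L : LittlewoodPaley d) (α : ℝ) (ε : Fin d → SignType) (j : ℤ) (u : 𝓢'(RSpace d, ℂ)) :
    RSpace d → ℂ := multOp (fun ν => L.blockSymbol j ν * signExp α ε ν) (L.fatBlock j u)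

lemma signExp_zero_sign (α : ℝ) (ν : RSpace d) : signExp α 0 ν = 1 := by
  simp [signExp]

lemma signBlock_zero_sign (α : ℝ) (j : ℤ) (u : 𝓢'(RSpace d, ℂ)) :
    signBlock L α 0 j u = L.dyadicBlock j u := by
  rw [signBlock, L.dyadicBlock_eq_multOp]
  simp_rw [signExp_zero_sign, mul_one]

lemma isBddCont_signBlock {u : 𝓢'(RSpace d, ℂ)}
    (hu : ∀ j, eLpNorm (L.dyadicBlock j u) ∞ volume < ∞) (α : ℝ) (ε : Fin d → SignType) (j : ℤ) :
    IsBddCont (signBlock L α ε j u) :=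
  (L.isBddCont_fatBlock hu j).multOp (isSymbol_mul_signExp (L.blockSymbol_hasCompactSupport j) α ε)

lemma multOp_fat_signBlock {u : 𝓢'(RSpace d, ℂ)}
    (hu : ∀ j, eLpNorm (L.dyadicBlock j u) ∞ volume < ∞) (α : ℝ) (ε : Fin d → SignType) (j : ℤ) :
    multOp (L.fatSymbol j) (signBlock L α ε j u) = signBlock L α ε j u := by
  rw [signBlock, multOp_multOp (L.fatSymbol j).isSymbol
    (isSymbol_mul_signExp (L.blockSymbol_hasCompactSupport j) α ε) (L.isBddCont_fatBlock hu j)]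
  congr 1; ext ν
  rw [← mul_assoc, mul_comm (L.fatSymbol j ν), L.blockSymbol_mul_fatSymbol]

/-- `e^{αε·D} Δ̇_j u` is the image of `Δ̇_j e^{αΛ₁} u` under a product of one-dimensional multipliers
that are bounded on `L^{1/t}`. -/
lemma exists_recipNorm_signBlock_le (L : LittlewoodPaley d) {t : ℝ} (ht : 0 < t) (ht1 : t < 1) :
    ∃ C : ℝ≥0, ∀ α : ℝ, 0 ≤ α → ∀ u U : 𝓢'(RSpace d, ℂ), L.IsGevrey α u U →
      ∀ (ε : Fin d → SignType) (j : ℤ),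
        recipNorm t (signBlock L α ε j u) ≤ C * recipNorm t (L.dyadicBlock j U) := by
  obtain ⟨C, hC⟩ := exists_lineKernel_convBound (p := 1 / t) ((one_lt_div ht).2 ht1)
  refine ⟨C ^ d, fun α hα u U h ε j => ?_⟩
  have hp : 0 < 1 / t := by positivity
  have := eLpNorm_signExp_le hp hC (L.blockSymbol_hasCompactSupport j) hα ε
    (L.isBddCont_fatBlock h.2.2.1 j)
  rw [← recipNorm_one_div hp, ← recipNorm_one_div hp, one_div_one_div] at this
  rw [h.2.2.2 j, ENNReal.coe_pow]
  exact this

lemma block_mul_block_eq_zero {m j k : ℤ} (h : FarApart m j k) (ξ η : RSpace d) :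
    L.blockSymbol m (ξ + η) * L.blockSymbol j ξ * L.blockSymbol k η = 0 := by
  rcases h with ⟨h1, h2⟩ | ⟨h1, h2⟩ | ⟨h1, h2⟩
  · exact L.block_mul_block_eq_zero_of_le h1 h2 ξ η
  · exact L.block_mul_block_eq_zero_of_far h1 h2 ξ η
  · have := L.block_mul_block_eq_zero_of_far h1 h2 η ξ
    rw [add_comm η ξ] at this
    linear_combination this

lemma multOp_signBlock_mul_eq_zero {a b : 𝓢'(RSpace d, ℂ)}
    (ha : ∀ j, eLpNorm (L.dyadicBlock j a) ∞ volume < ∞)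
    (hb : ∀ j, eLpNorm (L.dyadicBlock j b) ∞ volume < ∞) {m j k : ℤ} (h : FarApart m j k)
    {P : RSpace d → ℂ} (hP : IsSymbol fun ν => P ν * L.blockSymbol m ν) (α : ℝ)
    (ε : Fin d → SignType) (x : RSpace d) :
    multOp (fun ν => P ν * L.blockSymbol m ν)
      (fun x => signBlock L α ε j a x * signBlock L α ε k b x) x = 0 := by
  have := sum_multOp_mul_eq_zero {()} (fun _ => 1) (M := fun _ ν => P ν * L.blockSymbol m ν)
    (m := fun _ ν => L.blockSymbol j ν * signExp α ε ν)
    (n := fun _ ν => L.blockSymbol k ν * signExp α ε ν)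
    (h₁ := L.fatBlock j a) (h₂ := L.fatBlock k b) (fun _ _ => hP)
    (fun _ _ => isSymbol_mul_signExp (L.blockSymbol_hasCompactSupport j) α ε)
    (fun _ _ => isSymbol_mul_signExp (L.blockSymbol_hasCompactSupport k) α ε)
    (L.isBddCont_fatBlock ha j) (L.isBddCont_fatBlock hb k) (fun ξ η => ?_) x
  · simpa using! this
  · rw [Finset.sum_singleton]
    linear_combination (P (ξ + η) * signExp α ε ξ * signExp α ε η) * block_mul_block_eq_zero h ξ η

lemma gevreySymbol_zero (ν : RSpace d) : gevreySymbol 0 ν = 1 := by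
  simp [gevreySymbol]

lemma norm_signCoeff (ε : Fin d → SignType) : ‖signCoeff ε‖ₑ = 1 := by
  rw [← ofReal_norm, signCoeff, norm_prod, Finset.prod_eq_one, ENNReal.ofReal_one]
  intro i _
  split_ifs <;> simp

lemma recipNorm_sum_signCoeff_le {t : ℝ} (ht1 : t ≤ 1) {f : (Fin d → SignType) → RSpace d → ℂ}
    (hf : ∀ ε, Continuous (f ε)) {R : ℝ≥0∞} (hR : ∀ ε, recipNorm t (f ε) ≤ R) :
    recipNorm t (fun x => ∑ ε, signCoeff ε * f ε x) ≤ Fintype.card (Fin d → SignType) * R := by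
  have h1 : 1 ≤ (ENNReal.ofReal t)⁻¹ := ENNReal.one_le_inv.2 (ENNReal.ofReal_le_one.2 ht1)
  have h2 := eLpNorm_sum_le (μ := (volume : Measure (RSpace d))) (s := Finset.univ)
    (f := fun ε x => signCoeff ε * f ε x)
    (fun ε _ => (continuous_const.mul (hf ε)).aestronglyMeasurable) h1
  have h3 : (∑ ε, fun x => signCoeff ε * f ε x) = fun x => ∑ ε, signCoeff ε * f ε x := by
    ext x; simp
  rw [h3] at h2
  refine h2.trans ((Finset.sum_le_card_nsmul _ _ R fun ε _ => ?_).trans ?_)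
  · refine (eLpNorm_const_smul (signCoeff ε) (f ε) _ _).le.trans ?_
    rw [norm_signCoeff, one_mul]
    exact hR ε
  · rw [nsmul_eq_mul, Finset.card_univ]

/-- The sequence `2^{js} ‖Δ̇_j u‖_{L^{1/t}}` whose `ℓ^r` norm is a Besov norm. -/
def besovSeq (L : LittlewoodPaley d) (s t : ℝ) (u : 𝓢'(RSpace d, ℂ)) (j : ℤ) : ℝ≥0∞ :=
  twoPow (j * s) * recipNorm t (L.dyadicBlock j u)

lemma recipNorm_dyadicBlock_eq (s t : ℝ) (u : 𝓢'(RSpace d, ℂ)) (j : ℤ) :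
    recipNorm t (L.dyadicBlock j u) = twoPow (-(j * s)) * besovSeq L s t u j := by
  rw [besovSeq, ← mul_assoc, twoPow_neg_mul, one_mul]

/-- The block `m` of `e^{γΛ₁}(Δ̇_j a Δ̇_k b)` is estimated by the blocks of `A = e^{αΛ₁}a` and
`B = e^{αΛ₁}b`, both without weight (`γ = 0`) and with the full weight (`γ = α`). The constant does not
depend on `α`. -/
lemma exists_gevrey_product_bound (L : LittlewoodPaley d) {x₁ x₂ y s₁ s₂ : ℝ}
    (P : ProductExponents d x₁ x₂ y s₁ s₂) :
    ∃ e : ℝ, 0 < e ∧ ∃ K : ℝ≥0, ∀ (α γ : ℝ) (a b A B : 𝓢'(RSpace d, ℂ)), 0 ≤ α →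
      γ = 0 ∨ γ = α → L.IsGevrey α a A → L.IsGevrey α b B → ∀ m j k : ℤ,
      recipNorm y (multOp (fun ν => L.blockSymbol m ν * gevreySymbol γ ν)
        fun x => L.dyadicBlock j a x * L.dyadicBlock k b x) ≤
        K * twoPow (-(m * (s₁ + s₂ - d * (x₁ + x₂) + d * y))) *
          (besovSeq L s₁ x₁ A j * besovSeq L s₂ x₂ B k) * paraWeight e m j k := by
  obtain ⟨c, hc⟩ := L.exists_hasKernelBound
  obtain ⟨e, he, K, hK⟩ := exists_product_bound P fun j => (hc j).2.2
  obtain ⟨C₁, hC₁⟩ := exists_recipNorm_signBlock_le L P.x₁_pos P.x₁_lt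
  obtain ⟨C₂, hC₂⟩ := exists_recipNorm_signBlock_le L P.x₂_pos P.x₂_lt
  refine ⟨e, he, Fintype.card (Fin d → SignType) * (K * (C₁ * C₂)), ?_⟩
  intro α γ a b A B hα hγ ha hb m j k
  set R := K * twoPow (-(m * (s₁ + s₂ - d * (x₁ + x₂) + d * y))) *
    ((C₁ * besovSeq L s₁ x₁ A j) * (C₂ * besovSeq L s₂ x₂ B k)) * paraWeight e m j k with hR
  have hcomp : ∀ (Q : RSpace d → ℂ) (ε : Fin d → SignType),
      HasKernelBound (fun ν => Q ν * L.blockSymbol m ν) c (twoPow (m * d)) →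
      recipNorm y (multOp (fun ν => Q ν * L.blockSymbol m ν)
        fun x => signBlock L α ε j a x * signBlock L α ε k b x) ≤ R := by
    intro Q ε hQ
    refine hK m j k _ _ _ _ _ hQ (isBddCont_signBlock ha.2.2.1 α ε j)
      (isBddCont_signBlock hb.2.2.1 α ε k) (multOp_fat_signBlock ha.2.2.1 α ε j)
      (multOp_fat_signBlock hb.2.2.1 α ε k)
      (fun h => multOp_signBlock_mul_eq_zero ha.2.2.1 hb.2.2.1 h hQ.isSymbol α ε) ?_ ?_
    · refine (hC₁ α hα a A ha ε j).trans (le_of_eq ?_)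
      rw [recipNorm_dyadicBlock_eq s₁]; ring
    · refine (hC₂ α hα b B hb ε k).trans (le_of_eq ?_)
      rw [recipNorm_dyadicBlock_eq s₂]; ring
  have hfin : Fintype.card (Fin d → SignType) * R =
      (Fintype.card (Fin d → SignType) * (K * (C₁ * C₂)) : ℝ≥0) *
        twoPow (-(m * (s₁ + s₂ - d * (x₁ + x₂) + d * y))) *
          (besovSeq L s₁ x₁ A j * besovSeq L s₂ x₂ B k) * paraWeight e m j k := by
    rw [hR]; push_cast; ring
  rw [← hfin]
  rcases hγ with rfl | rfl
  · have h1 := hcomp (fun _ => 1) 0 (by simpa using (hc m).2.1)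
    simp_rw [signBlock_zero_sign, one_mul] at h1
    simp_rw [gevreySymbol_zero, mul_one]
    exact h1.trans (le_mul_of_one_le_left' (by exact_mod_cast Fintype.card_pos))
  · have h1 : (multOp (fun ν => L.blockSymbol m ν * gevreySymbol γ ν)
        fun x => L.dyadicBlock j a x * L.dyadicBlock k b x) = fun x => ∑ ε, signCoeff ε *
          multOp (fun ν => prodSymbol (signDamp γ ε) (signDamp γ ε) ν * L.blockSymbol m ν)
            (fun x => signBlock L γ ε j a x * signBlock L γ ε k b x) x := by
      ext x
      rw [L.dyadicBlock_eq_multOp, L.dyadicBlock_eq_multOp]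
      exact multOp_gevrey_mul (L.blockSymbol_hasCompactSupport m)
        (L.blockSymbol_hasCompactSupport j) (L.blockSymbol_hasCompactSupport k) hα
        (L.isBddCont_fatBlock ha.2.2.1 j) (L.isBddCont_fatBlock hb.2.2.1 k) x
    rw [h1]
    have hQ := fun ε => (hc m).2.1.poisson (signDamp_nonneg hα ε)
    exact recipNorm_sum_signCoeff_le P.y_lt.le (fun ε =>
      (((isBddCont_signBlock ha.2.2.1 γ ε j).mul (isBddCont_signBlock hb.2.2.1 γ ε k)).multOp
        (hQ ε).isSymbol).1) fun ε => hcomp _ ε (hQ ε)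

end Weighted

/-! ### The product in Besov spaces -/

section BesovProduct

variable {d : ℕ} {L : LittlewoodPaley d}

/-- The blocks of `u` are controlled by those of `e^{αΛ₁}u`, in `L^{1/t}` and in `L^∞`. -/
lemma exists_enorm_dyadicBlock_le (L : LittlewoodPaley d) {t : ℝ} (s : ℝ) (ht : 0 < t)
    (ht1 : t < 1) :
    ∃ C : ℝ≥0, ∀ α : ℝ, 0 ≤ α → ∀ u U : 𝓢'(RSpace d, ℂ), L.IsGevrey α u U → ∀ (j : ℤ),
      recipNorm t (L.dyadicBlock j u) ≤ C * (twoPow (-(j * s)) * besovSeq L s t U j) ∧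
      ∀ x, ‖L.dyadicBlock j u x‖ₑ ≤ C * (twoPow (j * (d * t - s)) * besovSeq L s t U j) := by
  obtain ⟨c, hc⟩ := L.exists_hasKernelBound
  obtain ⟨C, hC⟩ := exists_recipNorm_signBlock_le L ht ht1
  refine ⟨C + c * C, fun α hα u U h j => ?_⟩
  have h1 := hC α hα u U h 0 j
  have h2 := multOp_fat_signBlock h.2.2.1 α 0 j
  have h3 := isBddCont_signBlock h.2.2.1 α 0 j
  rw [signBlock_zero_sign] at h1 h2 h3
  rw [recipNorm_dyadicBlock_eq s t U] at h1
  refine ⟨h1.trans (by push_cast; gcongr; exact le_self_add), fun x => ?_⟩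
  have h4 := recipNorm_le_of_fat (fun j => (hc j).2.2) h3 h2 ht ht1.le le_rfl ht.le
  rw [recipNorm_zero, sub_zero] at h4
  calc ‖L.dyadicBlock j u x‖ₑ ≤ c * twoPow (j * (d * t)) *
        (C * (twoPow (-(j * s)) * besovSeq L s t U j)) :=
        (enorm_le_eLpNorm_top h3.1 x).trans (h4.trans (by gcongr))
    _ = c * C * ((twoPow (j * (d * t)) * twoPow (-(j * s))) * besovSeq L s t U j) := by ring
    _ = c * C * (twoPow (j * (d * t - s)) * besovSeq L s t U j) := by
        rw [← twoPow_add]; congr 4; ring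
    _ ≤ _ := by push_cast; gcongr; exact le_add_self

/-- `Ṡ_n a · Ṡ_n b` is the sum of the products of the blocks of index below `n`. -/
lemma hasSum_integral_lowCut_mul {a b : 𝓢'(RSpace d, ℂ)} (ha : L.MemS0 a) (hb : L.MemS0 b)
    (hab : ∀ j, IsBddCont (L.dyadicBlock j a)) (hbb : ∀ j, IsBddCont (L.dyadicBlock j b)) {n : ℤ}
    {u v : ℤ → ℝ≥0∞} (hu : ∀ j x, ‖L.dyadicBlock j a x‖ₑ ≤ u j)
    (hv : ∀ j x, ‖L.dyadicBlock j b x‖ₑ ≤ v j)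
    (hun : (∑' j, if j < n then u j else 0) ≠ ∞) (hvn : (∑' j, if j < n then v j else 0) ≠ ∞)
    (ψ : 𝓢(RSpace d, ℂ)) :
    HasSum (fun i : ℤ × ℤ => if i.1 < n ∧ i.2 < n then
      ∫ x, L.dyadicBlock i.1 a x * L.dyadicBlock i.2 b x * ψ x else 0)
      (∫ x, L.lowCut n a x * L.lowCut n b x * ψ x) := by
  set f : ℤ → RSpace d → ℂ := fun j x => if j < n then L.dyadicBlock j a x else 0 with hf
  set g : ℤ → RSpace d → ℂ := fun j x => if j < n then L.dyadicBlock j b x else 0 with hg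
  have hfc : ∀ j, IsBddCont (f j) := by
    intro j
    simp only [hf]
    split_ifs
    · exact hab j
    · exact ⟨continuous_const, 0, by simp⟩
  have hgc : ∀ j, IsBddCont (g j) := by
    intro j
    simp only [hg]
    split_ifs
    · exact hbb j
    · exact ⟨continuous_const, 0, by simp⟩
  have hfu : ∀ j x, ‖f j x‖ₑ ≤ if j < n then u j else 0 := by
    intro j x
    simp only [hf]
    split_ifs
    · exact hu j x
    · simp
  have hgv : ∀ j x, ‖g j x‖ₑ ≤ if j < n then v j else 0 := by
    intro j x
    simp only [hg]
    split_ifs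
    · exact hv j x
    · simp
  have hfs : ∀ x, Summable fun j => ‖f j x‖ := fun x =>
    Summable.of_nonneg_of_le (fun _ => norm_nonneg _) (fun j =>
      norm_le_toReal_of_enorm_le (hfu j x) (ENNReal.ne_top_of_tsum_ne_top hun j))
      (ENNReal.summable_toReal hun)
  have hgs : ∀ x, Summable fun j => ‖g j x‖ := fun x =>
    Summable.of_nonneg_of_le (fun _ => norm_nonneg _) (fun j =>
      norm_le_toReal_of_enorm_le (hgv j x) (ENNReal.ne_top_of_tsum_ne_top hvn j))
      (ENNReal.summable_toReal hvn)
  have hU : (∑' i : ℤ × ℤ, (if i.1 < n then u i.1 else 0) * (if i.2 < n then v i.2 else 0)) ≠ ∞ := by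
    rw [ENNReal.tsum_prod']
    simp_rw [ENNReal.tsum_mul_left, ENNReal.tsum_mul_right]
    exact ENNReal.mul_ne_top hun hvn
  have key := hasSum_integral_mul_schwartz (f := fun (i : ℤ × ℤ) x => f i.1 x * g i.2 x)
    (fun i => (hfc i.1).mul (hgc i.2)) hU (fun i x => by
      rw [enorm_mul]; exact mul_le_mul' (hfu _ _) (hgv _ _)) ψ
  convert key using 1
  · ext i
    simp only [hf, hg]
    by_cases h1 : i.1 < n <;> by_cases h2 : i.2 < n <;> simp [h1, h2]
  · congr 1; ext x
    rw [L.lowCut_eq_tsum ha n x (hfs x).of_norm, L.lowCut_eq_tsum hb n x (hgs x).of_norm,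
      tsum_mul_tsum_of_summable_norm (hfs x) (hgs x)]

/-- The product of two distributions in `𝓢'₀` is the sum of the products of their blocks, if this
double series converges. -/
lemma isProduct_of_hasSum {a b w : 𝓢'(RSpace d, ℂ)} (ha : L.MemS0 a) (hb : L.MemS0 b)
    (hab : ∀ j, IsBddCont (L.dyadicBlock j a)) (hbb : ∀ j, IsBddCont (L.dyadicBlock j b))
    {u v : ℤ → ℝ≥0∞} (hu : ∀ j x, ‖L.dyadicBlock j a x‖ₑ ≤ u j)
    (hv : ∀ j x, ‖L.dyadicBlock j b x‖ₑ ≤ v j)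
    (hun : ∀ n, (∑' j, if j < n then u j else 0) ≠ ∞)
    (hvn : ∀ n, (∑' j, if j < n then v j else 0) ≠ ∞)
    (hw : ∀ ψ : 𝓢(RSpace d, ℂ), HasSum (fun i : ℤ × ℤ =>
      ∫ x, L.dyadicBlock i.1 a x * L.dyadicBlock i.2 b x * ψ x) (w ψ)) : L.IsProduct a b w := by
  intro ψ
  rw [← (hw ψ).tsum_eq]
  have h := fun n => (hasSum_integral_lowCut_mul ha hb hab hbb hu hv (hun n) (hvn n) ψ).tsum_eq
  simp_rw [← h]
  -- each pair of blocks is contained in the truncations from some `n` on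
  refine tendsto_tsum_of_dominated_convergence (hw ψ).summable.norm (fun i => ?_)
    (Eventually.of_forall fun n i => ?_)
  · refine tendsto_const_nhds.congr' ?_
    filter_upwards [eventually_gt_atTop (max i.1 i.2)] with n hn
    rw [if_pos (max_lt_iff.1 hn)]
  · split_ifs
    · exact le_rfl
    · simp

/-- The product law for exponentially weighted Besov spaces, for general Lebesgue exponents. -/
theorem exists_gevrey_product (hd : 1 ≤ d) (L : LittlewoodPaley d) {x₁ x₂ y s₁ s₂ : ℝ}
    (P : ProductExponents d x₁ x₂ y s₁ s₂) :
    ∃ C : ℝ≥0, ∀ (α : ℝ) (a b A B : 𝓢'(RSpace d, ℂ)) (N : ℝ≥0∞), 0 ≤ α →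
      L.IsGevrey α a A → L.IsGevrey α b B → (∑' j, besovSeq L s₁ x₁ A j) ≠ ∞ → N ≠ ∞ →
      (∀ k, besovSeq L s₂ x₂ B k ≤ N) →
      ∃ ab W : 𝓢'(RSpace d, ℂ), L.IsProduct a b ab ∧ L.IsGevrey α ab W ∧
        ∀ m, besovSeq L (s₁ + s₂ - d * (x₁ + x₂) + d * y) y W m ≤
          C * (∑' j, besovSeq L s₁ x₁ A j) * N := by
  obtain ⟨c, hc⟩ := L.exists_hasKernelBound
  obtain ⟨e, he, K, hK⟩ := exists_gevrey_product_bound L P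
  obtain ⟨Ω, hΩ⟩ := exists_tsum_paraWeight_le he
  obtain ⟨C₁, hC₁⟩ := exists_enorm_dyadicBlock_le L s₁ P.x₁_pos P.x₁_lt
  obtain ⟨C₂, hC₂⟩ := exists_enorm_dyadicBlock_le L s₂ P.x₂_pos P.x₂_lt
  refine ⟨K * Ω, fun α a b A B N hα ha hb hA hN hB => ?_⟩
  set M := ∑' j, besovSeq L s₁ x₁ A j with hM
  set E := s₁ + s₂ - d * (x₁ + x₂) + d * y with hE
  -- by Bernstein's inequality the blocks of the product are `O(2^{mσ})` in `L^∞`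
  set σ := d * y - E with hσ
  have hσ0 : 0 < σ := by
    have h1 := P.s₁_le
    have h2 := P.s₂_lt
    rw [hσ, hE]; linarith
  have hbdd : ∀ {u : 𝓢'(RSpace d, ℂ)}, (∀ j, eLpNorm (L.dyadicBlock j u) ∞ volume < ∞) →
      ∀ j, IsBddCont (L.dyadicBlock j u) := fun h j =>
    isBddCont_of_eLpNorm_top (L.continuous_dyadicBlock j _) (h j)
  have hab := hbdd ha.2.2.1
  have hbb := hbdd hb.2.2.1
  set f : ℤ × ℤ → RSpace d → ℂ := fun i x => L.dyadicBlock i.1 a x * L.dyadicBlock i.2 b x with hf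
  set Y : ℤ → ℤ × ℤ → ℝ≥0∞ := fun m i => K * twoPow (-(m * E)) *
    (besovSeq L s₁ x₁ A i.1 * besovSeq L s₂ x₂ B i.2) * paraWeight e m i.1 i.2 with hY
  have hYsum : ∀ m, ∑' i, Y m i ≤ K * Ω * M * N * twoPow (-(m * E)) := by
    intro m
    rw [ENNReal.tsum_prod']
    calc ∑' j, ∑' k, Y m (j, k)
        ≤ ∑' j, ∑' k, K * twoPow (-(m * E)) * (besovSeq L s₁ x₁ A j * N) * paraWeight e m j k := by
          refine ENNReal.tsum_le_tsum fun j => ENNReal.tsum_le_tsum fun k => ?_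
          simp only [hY]
          gcongr
          exact hB k
      _ ≤ ∑' j, K * twoPow (-(m * E)) * (besovSeq L s₁ x₁ A j * N) * Ω := by
          refine ENNReal.tsum_le_tsum fun j => ?_
          rw [ENNReal.tsum_mul_left]
          gcongr
          exact hΩ m j
      _ = K * Ω * M * N * twoPow (-(m * E)) := by
          rw [ENNReal.tsum_mul_right, ENNReal.tsum_mul_left, ENNReal.tsum_mul_right]
          ring
  have hfc : ∀ i, IsBddCont (f i) := fun i => (hab i.1).mul (hbb i.2)
  have hS : ∀ γ : ℝ, γ = 0 ∨ γ = α → ∀ m,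
      IsSymbol fun ν => L.blockSymbol m ν * gevreySymbol γ ν := fun γ hγ m =>
    isSymbol_mul_gevreySymbol (L.blockSymbol_hasCompactSupport m)
      (by rcases hγ with rfl | rfl <;> [exact le_rfl; exact hα])
  set B' : ℝ≥0∞ := c * (K * Ω * M * N) with hB'
  have hB'fin : B' ≠ ∞ := by
    rw [hB']; finiteness
  have hsummable : ∀ γ : ℝ, γ = 0 ∨ γ = α → BlockSummable L (gevreySymbol γ) f
      (fun m i => c * twoPow (m * (d * y)) * Y m i) B'.toNNReal σ := by
    intro γ hγ
    refine ⟨hfc, hS γ hγ, fun m i x => ?_, fun m => ?_⟩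
    · have h1 := (hfc i).multOp (hS γ hγ m)
      have h2 : multOp (L.fatSymbol m) (multOp (fun ν => L.blockSymbol m ν * gevreySymbol γ ν) (f i))
          = multOp (fun ν => L.blockSymbol m ν * gevreySymbol γ ν) (f i) := by
        rw [multOp_multOp (L.fatSymbol m).isSymbol (hS γ hγ m) (hfc i)]
        congr 1; ext ν
        rw [← mul_assoc, mul_comm (L.fatSymbol m ν), L.blockSymbol_mul_fatSymbol]
      have h3 := recipNorm_le_of_fat (fun j => (hc j).2.2) h1 h2 P.y_pos P.y_lt.le le_rfl P.y_pos.le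
      rw [recipNorm_zero, sub_zero] at h3
      refine (enorm_le_eLpNorm_top h1.1 x).trans (h3.trans ?_)
      gcongr
      exact hK α γ a b A B hα hγ ha hb m i.1 i.2
    · rw [ENNReal.tsum_mul_left, ENNReal.coe_toNNReal hB'fin]
      calc c * twoPow (m * (d * y)) * ∑' i, Y m i
          ≤ c * twoPow (m * (d * y)) * (K * Ω * M * N * twoPow (-(m * E))) := by
            gcongr; exact hYsum m
        _ = B' * (twoPow (m * (d * y)) * twoPow (-(m * E))) := by rw [hB']; ring
        _ = B' * twoPow (m * σ) := by rw [← twoPow_add, hσ]; congr 2; ring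
  -- `γ = 0` gives the product itself and `γ = α` its image under `e^{αΛ₁}`
  have h0 := hsummable 0 (Or.inl rfl)
  have hα' := hsummable α (Or.inr rfl)
  obtain ⟨V, hV, hV0, hVb⟩ := h0.exists_distribution hσ0
  obtain ⟨W, -, hW0, hWb⟩ := hα'.exists_distribution hσ0
  have hA' : ∀ j, besovSeq L s₁ x₁ A j ≠ ∞ := ENNReal.ne_top_of_tsum_ne_top hA
  refine ⟨V, W, ?_, ⟨hV0, hW0, fun j => ?_, fun j => ?_⟩, fun m => ?_⟩
  · refine isProduct_of_hasSum ha.1 hb.1 hab hbb (fun j => (hC₁ α hα a A ha j).2)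
      (fun k => (hC₂ α hα b B hb k).2) (fun n => ?_) (fun n => ?_)
      (h0.hasSum_integral hσ0 gevreySymbol_zero hd P.x₁_pos P.x₁_lt.le (fun i => ?_) hV)
    · have h1 : (∑' j : ℤ, if j < n then
          C₁ * (twoPow (j * (d * x₁ - s₁)) * besovSeq L s₁ x₁ A j) else 0) ≤
          C₁ * (twoPow (n * (d * x₁ - s₁)) * M) := by
        rw [hM, ← ENNReal.tsum_mul_left, ← ENNReal.tsum_mul_left]
        refine ENNReal.tsum_le_tsum fun j => ?_
        split_ifs with hj
        · gcongr
          refine twoPow_mono (mul_le_mul_of_nonneg_right ?_ (sub_nonneg.2 P.s₁_le))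
          exact_mod_cast hj.le
        · exact zero_le
      exact ne_top_of_le_ne_top (ENNReal.mul_ne_top ENNReal.coe_ne_top
        (ENNReal.mul_ne_top (twoPow_ne_top _) hA)) h1
    · have hpos : 0 < d * x₂ - s₂ := sub_pos.2 P.s₂_lt
      have h1 : (∑' k : ℤ, if k < n then
          C₂ * (twoPow (k * (d * x₂ - s₂)) * besovSeq L s₂ x₂ B k) else 0) ≤
          C₂ * N * ∑' k : ℤ, (if k ≤ n then twoPow (k * (d * x₂ - s₂)) else 0) := by
        rw [← ENNReal.tsum_mul_left]
        refine ENNReal.tsum_le_tsum fun k => ?_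
        split_ifs with h1 h2 h2
        · rw [mul_assoc, mul_comm N]
          gcongr
          exact hB k
        · exact absurd h1.le h2
        · exact zero_le
        · exact zero_le
      refine ne_top_of_le_ne_top (ENNReal.mul_ne_top (ENNReal.mul_ne_top ENNReal.coe_ne_top hN)
        (ne_top_of_le_ne_top ?_ (tsum_ite_twoPow_le n))) h1
      exact ENNReal.mul_ne_top (twoPow_ne_top _) (tsum_twoPow_neg_abs_ne_top hpos)
    · have h1 := recipNorm_mul_le (hab i.1).1 (hbb i.2).1 P.x₁_pos.le le_rfl
      rw [add_zero, recipNorm_zero] at h1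
      refine ne_top_of_le_ne_top (ENNReal.mul_ne_top ?_ (hb.2.2.1 i.2).ne) h1
      exact ne_top_of_le_ne_top (ENNReal.mul_ne_top ENNReal.coe_ne_top
        (ENNReal.mul_ne_top (twoPow_ne_top _) (hA' i.1))) (hC₁ α hα a A ha i.1).1
  · rw [hVb]
    exact (h0.isBddCont_blockSeries j).eLpNorm_top_lt
  · rw [hWb, L.gevreyBlock_eq_multOp, h0.multOp_fatBlock hα' gevreySymbol_zero hVb]
  · have h1 : recipNorm y (L.dyadicBlock m W) ≤ K * Ω * M * N * twoPow (-(m * E)) := by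
      rw [hWb]
      refine (recipNorm_tsum_le (hα'.isBddCont_term m) (hα'.tsum_ne_top m) (hα'.enorm_le m)
        P.y_lt.le).trans ((ENNReal.tsum_le_tsum fun i => ?_).trans (hYsum m))
      exact hK α α a b A B hα (Or.inr rfl) ha hb m i.1 i.2
    calc besovSeq L E y W m ≤ twoPow (m * E) * (K * Ω * M * N * twoPow (-(m * E))) := by
          rw [besovSeq]; gcongr
      _ = (twoPow (-(m * E)) * twoPow (m * E)) * (K * Ω * M * N) := by ring
      _ = _ := by rw [twoPow_neg_mul, one_mul, ENNReal.coe_mul]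

end BesovProduct

namespace LittlewoodPaley

lemma besovNorm_one_eq {d : ℕ} (L : LittlewoodPaley d) (s : ℝ) {p : ℝ} (hp : 0 < p)
    (u : 𝓢'(RSpace d, ℂ)) :
    L.besovNorm s (ENNReal.ofReal p) 1 u = ∑' j, besovSeq L s (1 / p) u j := by
  rw [besovNorm, eLpNorm_one_eq_lintegral_enorm, lintegral_count]
  refine tsum_congr fun j => ?_
  rw [enorm_eq_self, besovSeq, recipNorm_one_div hp, twoPow]

lemma besovNorm_top_eq {d : ℕ} (L : LittlewoodPaley d) (s : ℝ) {p : ℝ} (hp : 0 < p)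
    (u : 𝓢'(RSpace d, ℂ)) :
    L.besovNorm s (ENNReal.ofReal p) ∞ u = ⨆ j, besovSeq L s (1 / p) u j := by
  rw [besovNorm, eLpNorm_exponent_top, eLpNormEssSup_count]
  refine iSup_congr fun j => ?_
  rw [enorm_eq_self, besovSeq, recipNorm_one_div hp, twoPow]

end LittlewoodPaley

lemma exists_gevrey_besov_product {d : ℕ} (hd : 1 ≤ d) (L : LittlewoodPaley d)
    {p₁ p₂ q s s₁ s₂ : ℝ} (hp₁ : 0 < p₁) (hp₂ : 0 < p₂) (hq : 0 < q)
    (P : ProductExponents d (1 / p₁) (1 / p₂) (1 / q) s₁ s₂)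
    (hs : s = s₁ + s₂ - d * (1 / p₁ + 1 / p₂) + d * (1 / q)) :
    ∃ C : ℝ≥0, ∀ c₀ t : ℝ, 0 < c₀ → 0 ≤ t →
      ∀ a b A B : 𝓢'(RSpace d, ℂ),
        L.IsGevrey (Real.sqrt (c₀ * t)) a A → L.IsGevrey (Real.sqrt (c₀ * t)) b B →
        L.MemBesov s₁ (ENNReal.ofReal p₁) 1 A → L.MemBesov s₂ (ENNReal.ofReal p₂) ∞ B →
        ∃ ab W : 𝓢'(RSpace d, ℂ), L.IsProduct a b ab ∧
          L.IsGevrey (Real.sqrt (c₀ * t)) ab W ∧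
          L.besovNorm s (ENNReal.ofReal q) ∞ W ≤
            C * L.besovNorm s₁ (ENNReal.ofReal p₁) 1 A *
              L.besovNorm s₂ (ENNReal.ofReal p₂) ∞ B := by
  obtain ⟨C, hC⟩ := exists_gevrey_product hd L P
  refine ⟨C, fun c₀ t _ _ a b A B ha hb hA hB => ?_⟩
  have hA' := hA.2.ne
  have hB' := hB.2.ne
  rw [L.besovNorm_one_eq s₁ hp₁] at hA' ⊢
  rw [L.besovNorm_top_eq s₂ hp₂] at hB' ⊢
  obtain ⟨ab, W, h1, h2, h3⟩ := hC _ a b A B _ (Real.sqrt_nonneg _) ha hb hA' hB'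
    fun k => le_iSup (fun k => besovSeq L s₂ (1 / p₂) B k) k
  refine ⟨ab, W, h1, h2, ?_⟩
  rw [L.besovNorm_top_eq s hq, hs]
  refine iSup_le fun m => ?_
  exact h3 m

end

theorem lemma2p6 (d : ℕ) (hd : 1 ≤ d) (L : LittlewoodPaley d) (p q s s₁ s₂ : ℝ)
    (hp : 1 < p) (hq : 1 < q) (hpq : p ≤ 2 * q) :
    (d * max 0 (2 / p - 1) ≤ s₁ + s₂ →
      s₁ ≤ d * min (1 / p) (2 / p - 1 / q) →
      s₂ < d * min (1 / p) (2 / p - 1 / q) →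
      s + 2 * d / p - d / q = s₁ + s₂ →
      ∃ C : ℝ≥0, ∀ c₀ t : ℝ, 0 < c₀ → 0 ≤ t →
        ∀ a b A B : 𝓢'(RSpace d, ℂ),
          L.IsGevrey (Real.sqrt (c₀ * t)) a A → L.IsGevrey (Real.sqrt (c₀ * t)) b B →
          L.MemBesov s₁ (ENNReal.ofReal p) 1 A → L.MemBesov s₂ (ENNReal.ofReal p) ∞ B →
          ∃ ab W : 𝓢'(RSpace d, ℂ), L.IsProduct a b ab ∧
            L.IsGevrey (Real.sqrt (c₀ * t)) ab W ∧
            L.besovNorm s (ENNReal.ofReal q) ∞ W ≤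
              C * L.besovNorm s₁ (ENNReal.ofReal p) 1 A *
                L.besovNorm s₂ (ENNReal.ofReal p) ∞ B) ∧
    (d * max 0 (1 / p + 1 / q - 1) ≤ s₁ + s₂ →
      s₁ ≤ d / p →
      s₂ < d * min (1 / p) (1 / q) →
      s + d / p = s₁ + s₂ →
      ∃ C : ℝ≥0, ∀ c₀ t : ℝ, 0 < c₀ → 0 ≤ t →
        ∀ a b A B : 𝓢'(RSpace d, ℂ),
          L.IsGevrey (Real.sqrt (c₀ * t)) a A → L.IsGevrey (Real.sqrt (c₀ * t)) b B →
          L.MemBesov s₁ (ENNReal.ofReal p) 1 A → L.MemBesov s₂ (ENNReal.ofReal q) ∞ B →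
          ∃ ab W : 𝓢'(RSpace d, ℂ), L.IsProduct a b ab ∧
            L.IsGevrey (Real.sqrt (c₀ * t)) ab W ∧
            L.besovNorm s (ENNReal.ofReal q) ∞ W ≤
              C * L.besovNorm s₁ (ENNReal.ofReal p) 1 A *
                L.besovNorm s₂ (ENNReal.ofReal q) ∞ B) := by
  have hp0 : 0 < p := one_pos.trans hp
  have hq0 : 0 < q := one_pos.trans hq
  have hxp : 0 < 1 / p := by positivity
  have hyq : 0 < 1 / q := by positivity
  have hxp' : 1 / p < 1 := (div_lt_one hp0).2 hp
  have hyq' : 1 / q < 1 := (div_lt_one hq0).2 hq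
  have hd0 : (0 : ℝ) ≤ d := Nat.cast_nonneg d
  have h2p : 2 / p = 1 / p + 1 / p := by ring
  constructor
  · intro h0 h1 h2 hs
    refine exists_gevrey_besov_product hd L hp0 hp0 hq0 ?_ (by linear_combination hs)
    have hm1 := mul_le_mul_of_nonneg_left (min_le_left (1 / p) (2 / p - 1 / q)) hd0
    have hm2 := mul_le_mul_of_nonneg_left (min_le_right (1 / p) (2 / p - 1 / q)) hd0
    have hm3 := mul_le_mul_of_nonneg_left (le_max_left 0 (2 / p - 1)) hd0
    have hm4 := mul_le_mul_of_nonneg_left (le_max_right 0 (2 / p - 1)) hd0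
    have hyx : 1 / q ≤ 2 / p := by
      rw [div_le_div_iff₀ hq0 hp0]
      linarith
    rw [h2p] at hyx h0 h1 h2 hm1 hm2 hm3 hm4
    refine ⟨hxp, hxp', hxp, hxp', hyq, hyq', hyx, by linarith, by linarith, by linarith,
      by linarith, by linarith, by linarith⟩
  · intro h0 h1 h2 hs
    refine exists_gevrey_besov_product hd L hp0 hq0 hq0 ?_ (by linear_combination hs)
    have hm1 := mul_le_mul_of_nonneg_left (min_le_left (1 / p) (1 / q)) hd0
    have hm2 := mul_le_mul_of_nonneg_left (min_le_right (1 / p) (1 / q)) hd0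
    have hm3 := mul_le_mul_of_nonneg_left (le_max_left 0 (1 / p + 1 / q - 1)) hd0
    have hm4 := mul_le_mul_of_nonneg_left (le_max_right 0 (1 / p + 1 / q - 1)) hd0
    have h1' : s₁ ≤ d * (1 / p) := by rwa [mul_one_div]
    refine ⟨hxp, hxp', hyq, hyq', hyq, hyq', by linarith, h1', ?_, by linarith, ?_, by linarith,
      by linarith⟩
    · rwa [add_sub_cancel_right]
    · rw [add_sub_cancel_right]; linarith
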